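/- **Definitions.** Let $G$ be a simple graph on a finite vertex set $V$ with extended path metric $d$ ($d(u,v)=\infty$ if $u,v$ lie in different components), and put $\mathrm{len}(x_0,\dots,x_k)=d(x_0,x_1)+\dots+d(x_{k-1},x_k)$. For $a,b\in V$ and $k,\ell\ge 0$ let $EMC_{k,\ell}(a,b)$ be the free abelian group on the tuples $(x_0,\dots,x_k)$ of pairwise distinct vertices with $x_0=a$, $x_k=b$ and $\mathrm{len}(x_0,\dots,x_k)=\ell$. The differential $\partial_{k,\ell}:EMC_{k,\ell}(a,b)\to EMC_{k-1,\ell}(a,b)$ is $\sum_{i=1}^{k-1}(-1)^i\partial^i_{k,\ell}$, where $\partial^i_{k,\ell}(x_0,\dots,x_k)$ is $(x_0,\dots,\widehat{x_i},\dots,x_k)$ if this tuple still has length $\ell$ and is $0$ otherwise. Set $EMH_{k,\ell}(a,b)=\ker\partial_{k,\ell}/\operatorname{im}\partial_{k+1,\ell}$. Let $ET_{\le\ell}(a,b)$ be the complex whose simplices are the nonempty tuples $(x_1,\dots,x_t)$ such that $a,x_1,\dots,x_t,b$ are pairwise distinct and $\mathrm{len}(a,x_1,\dots,x_t,b)\le\ell$;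 the faces of a simplex are its subtuples, and its facets are the simplices that are not proper subtuples of another simplex. Such a complex is *shellable* if its facets can be listed as $F_1,\dots,F_t$ so that for every $k\ge 2$ the intersection of (the simplex spanned by) $F_k$ with $\bigcup_{i<k}F_i$ is the union of a nonempty family of codimension-one faces of $F_k$ (the empty face being counted as the codimension-one face of a point). For $\alpha\ge 0$, $G(n,n^{-\alpha})$ is the random graph on $n$ labelled vertices in which every pair of vertices is joined independently with probability $n^{-\alpha}$. **Theorem.** Fix $\alpha\in[0,\infty)$ and an integer $\ell\ge 3$, and for every $n\ge 1$ let $a=a_n$ and $b=b_n$ be vertices of $G=G(n,n^{-\alpha})$. Let $S_n$ be the event that both $ET_{\le\ell}(a,b)$ and $ET_{\le\ell-1}(a,b)$ are shellable, and let $T_n$ be the event that $EMH_{k,\ell}(a,b)$ is torsion free for every $k$. Then: 1. if both complexes are shellable asymptotically almost surely, i.e. $P(S_n)\to 1$ as $n\to\infty$, then asymptotically almost surely $EMH_{k,\ell}(a,b)$ is torsion free for every $k$, i.e. $P(T_n)\to 1$; 2. in general, the probability that both complexes are shellable but some $EMH_{k,\ell}(a,b)$ has torsion tends to zero, i.e.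 $P(S_n\setminus T_n)\to 0$ as $n\to\infty$. -/

import Mathlib

open Filter Topology MeasureTheory SimpleGraph

namespace EulerianMagnitude

section Graph

variable {V : Type*} (G : SimpleGraph V)

/-- The length `d(x₀,x₁) + ⋯ + d(x_{k-1},x_k)` of a tuple of vertices, where `d` is the extended
path metric of the graph. -/
noncomputable def len : List V → ℕ∞
  | [] => 0
  | [_] => 0
  | x :: y :: w => G.edist x y + len (y :: w)

/-! ### Eulerian magnitude homology -/

/-- `w = (x₀, …, x_k)` is a generator of `EMC_{k,ℓ}(a,b)`: a `k`-trail with pairwise distinct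
landmarks, starting at `a`, ending at `b`, of length `ℓ`. -/
def IsEulerianTrail (a b : V) (k ℓ : ℕ) (w : List V) : Prop :=
  w.Nodup ∧ w.length = k + 1 ∧ w.head? = some a ∧ w.getLast? = some b ∧ len G w = ℓ

/-- The eulerian magnitude chain group `EMC_{k,ℓ}(a,b)`: the free abelian group on the
eulerian `k`-trails of length `ℓ` from `a` to `b`. -/
abbrev EMC (a b : V) (k ℓ : ℕ) : Type _ :=
  {w : List V // IsEulerianTrail G a b k ℓ w} →₀ ℤ

open Classical in
/-- The differential `EMC_{k+1,ℓ}(a,b) → EMC_{k,ℓ}(a,b)`, the alternating sum over the interior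
landmarks `x₁, …, x_k` of `(x₀, …, x_{k+1})` of the tuples with that landmark omitted; a term is
zero when the omission changes the length. (For `1 ≤ i ≤ k` the shortened tuple automatically
satisfies all the requirements of `IsEulerianTrail` except possibly that its length is `ℓ`.) -/
noncomputable def boundary (a b : V) (k ℓ : ℕ) : EMC G a b (k + 1) ℓ →ₗ[ℤ] EMC G a b k ℓ :=
  Finsupp.linearCombination ℤ fun w =>
    ∑ i ∈ Finset.Icc 1 k,
      if h : IsEulerianTrail G a b k ℓ (w.1.eraseIdx i) then
        Finsupp.single ⟨w.1.eraseIdx i, h⟩ ((-1 : ℤ) ^ i)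
      else 0

/-- The cycles in `EMC_{k,ℓ}(a,b)`; the differential on `EMC_{0,ℓ}(a,b)` is zero. -/
noncomputable def cycles (a b : V) : (k ℓ : ℕ) → Submodule ℤ (EMC G a b k ℓ)
  | 0, _ => ⊤
  | k + 1, ℓ => LinearMap.ker (boundary G a b k ℓ)

/-- The eulerian magnitude homology group `EMH_{k,ℓ}(a,b)`: cycles in `EMC_{k,ℓ}(a,b)` modulo
the image of the differential `EMC_{k+1,ℓ}(a,b) → EMC_{k,ℓ}(a,b)`. -/
abbrev EMH (a b : V) (k ℓ : ℕ) : Type _ :=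
  cycles G a b k ℓ ⧸ (LinearMap.range (boundary G a b k ℓ)).comap (cycles G a b k ℓ).subtype

/-! ### The complexes of eulerian trails -/

/-- The complex `ET_{≤ ℓ}(a,b)`: its simplices are the nonempty tuples `(x₁, …, x_t)` such that
`a, x₁, …, x_t, b` are pairwise distinct and `len(a, x₁, …, x_t, b) ≤ ℓ`. The simplices are ordered
tuples of distinct vertices, and the faces of a simplex are its subtuples. -/
def ET (a b : V) (ℓ : ℕ) : Set (List V) :=
  {w | w ≠ [] ∧ (a :: (w ++ [b])).Nodup ∧ len G (a :: (w ++ [b])) ≤ ℓ}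

end Graph

/-! ### Shellability -/

section Shelling

variable {V : Type*}

/-- A facet of a complex of tuples: a simplex that is not a proper subtuple of a simplex. -/
def IsFacet (X : Set (List V)) (F : List V) : Prop :=
  F ∈ X ∧ ∀ w ∈ X, F.Sublist w → w = F

/-- The simplex spanned by `F` with all its faces, including the empty face. -/
def face (F : List V) : Set (List V) :=
  {w | w.Sublist F}

/-- `L = (F₁, …, F_t)` is a shelling of `X`: it lists every facet of `X` exactly once, and for
every facet `F_k` other than the first one, the intersection of `F_k` with the union of the earlier
facets is a union of a non-empty family of facets (faces of codimension one) of `F_k`. -/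
def IsShelling (X : Set (List V)) (L : List (List V)) : Prop :=
  L.Nodup ∧ (∀ F, F ∈ L ↔ IsFacet X F) ∧
    ∀ (k : ℕ) (hk : k < L.length), 0 < k →
      ∃ S : Set (List V), S.Nonempty ∧
        (∀ R ∈ S, R ∈ face L[k] ∧ R.length + 1 = L[k].length) ∧
        face L[k] ∩ (⋃ i : Fin k, face L[i]) = ⋃ R ∈ S, face R

/-- A complex is shellable if it has a shelling. -/
def Shellable (X : Set (List V)) : Prop :=
  ∃ L : List (List V), IsShelling X L

end Shelling

/-! ### The random graph -/

/-- The edge probability `n ^ (-α)` as an element of the unit interval. -/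
noncomputable def edgeProb (α : ℝ) (hα : 0 ≤ α) (n : ℕ) : unitInterval :=
  ⟨(n : ℝ) ^ (-α), Real.rpow_nonneg n.cast_nonneg _, by
    rcases Nat.eq_zero_or_pos n with rfl | hn
    · rcases hα.eq_or_lt with rfl | h
      · simp
      · rw [Nat.cast_zero, Real.zero_rpow (by linarith)]
        exact zero_le_one
    · exact Real.rpow_le_one_of_one_le_of_nonpos (by exact_mod_cast hn) (by linarith)⟩

/-- The law of the Erdős–Rényi random graph `G(n, n ^ (-α))` on the vertex set `Fin n`. -/
noncomputable def erdosRenyi (α : ℝ) (hα : 0 ≤ α) (n : ℕ) : Measure (SimpleGraph (Fin n)) :=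
  binomialRandom (Fin n) (edgeProb α hα n)

/-- The event that both `ET_{≤ ℓ}(a,b)` and `ET_{≤ ℓ-1}(a,b)` are shellable. -/
def bothShellable {n : ℕ} (a b : Fin n) (ℓ : ℕ) : Set (SimpleGraph (Fin n)) :=
  {G | Shellable (ET G a b ℓ) ∧ Shellable (ET G a b (ℓ - 1))}

/-- The event that `EMH_{k,ℓ}(a,b)` is torsion free for every `k`. -/
def torsionFree {n : ℕ} (a b : Fin n) (ℓ : ℕ) : Set (SimpleGraph (Fin n)) :=
  {G | ∀ k : ℕ, IsAddTorsionFree (EMH G a b k ℓ)}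

end EulerianMagnitude

/-! Deleting an interior landmark from a trail of length `ℓ` either keeps the length or gives a
trail of length at most `ℓ - 1`. So the eulerian magnitude complex in length `ℓ` is, up to a shift
of degree, the relative chain complex of the pair formed by `ET_{≤ ℓ}(a,b)` and `ET_{≤ ℓ-1}(a,b)`,
both augmented by the empty tuple where it is admissible. Their tuples have at most `ℓ - 1` and `ℓ -
2` entries. If all facets have exactly that many entries (`Refinable`), a shelling kills all
homology below the top degree (`IsShelling.acyclicBelow`), and the long exact sequence of the pair
gives `EMH_{k,ℓ} = 0` for `k < ℓ`. For `k ≥ ℓ` there are no chains in degree `k + 1`, so `EMH_{k,ℓ}`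
is a group of cycles, hence torsion free. This deterministic part is `isAddTorsionFree_EMH`.

Randomness supplies purity, or else excludes shellability, in three ranges of `α`. If `α < 1/2`,
with high probability any two vertices have a common neighbour outside any prescribed set of bounded
size, so every short tuple can be refined (`refinable_of_common_neighbors`). If `α ≥ 1 - 1/ℓ`, the
expected number of paths from `a` to `b` with fewer than `ℓ` edges tends to zero; hence `d(a,b) ≥
ℓ`, admissible tuples are geodesic, and these can be refined too (`refinable_of_le_edist`). If `1/2
≤ α < 1 - 1/ℓ`, a second moment argument yields at least two paths with `ℓ` edges that cannot be
changed at a single vertex. The facet of such a path shares no codimension-one face with any other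
facet, so it must come first in a shelling; two of them exclude shellability
(`not_shellable_of_isIsolatedPath`, `exists_real_shellable_bound`).

The bounds are uniform in the pair `a ≠ b`, while for `a = b` the homology is always torsion free.
The first claim follows from the second by `P(T) ≥ P(S) - P(S \ T)`. -/

namespace EulerianMagnitude

/-! ### Chains of ordered tuples, and acyclicity of pure shellable complexes below the top degree.
-/

section Chains

variable {V : Type*}

/-- The chain `x * c` obtained by prepending a vertex to all tuples of a chain. -/
noncomputable def consChain (x : V) : (List V →₀ ℤ) →ₗ[ℤ] (List V →₀ ℤ) :=
  Finsupp.lmapDomain ℤ ℤ (List.cons x)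

/-- The alternating sum of the faces of a tuple. -/
noncomputable def faceSum : List V → (List V →₀ ℤ)
  | [] => 0
  | x :: w => Finsupp.single w 1 - consChain x (faceSum w)

/-- The augmented simplicial differential on chains of tuples. -/
noncomputable def diff : (List V →₀ ℤ) →ₗ[ℤ] (List V →₀ ℤ) :=
  Finsupp.linearCombination ℤ faceSum

@[simp] lemma consChain_single (x : V) (w : List V) (z : ℤ) :
    consChain x (Finsupp.single w z) = Finsupp.single (x :: w) z := by
  simp [consChain]

@[simp] lemma diff_single (w : List V) (z : ℤ) : diff (Finsupp.single w z) = z • faceSum w := by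
  simp [diff]

/-- The cone formula; it turns `∂² = 0` into an induction on the tuple. -/
lemma diff_consChain (x : V) (c : List V →₀ ℤ) : diff (consChain x c) = c - consChain x (diff c) := by
  induction c using Finsupp.induction_linear with
  | zero => simp
  | add f g hf hg => simp only [map_add, hf, hg]; abel
  | single w z => simp [faceSum, smul_sub]

lemma diff_faceSum (w : List V) : diff (faceSum w) = 0 := by
  induction w with
  | nil => simp [faceSum]
  | cons x w ih => simp [faceSum, diff_consChain, ih]

lemma diff_diff (c : List V →₀ ℤ) : diff (diff c) = 0 := by
  induction c using Finsupp.induction_linear with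
  | zero => simp
  | add f g hf hg => simp [hf, hg]
  | single w z => simp [diff_faceSum]

lemma faceSum_eq_sum (w : List V) :
    faceSum w = ∑ i ∈ Finset.range w.length, Finsupp.single (w.eraseIdx i) ((-1 : ℤ) ^ i) := by
  induction w with
  | nil => simp [faceSum]
  | cons x w ih =>
    rw [faceSum, ih, List.length_cons, Finset.sum_range_succ']
    simp only [map_sum, consChain_single, List.eraseIdx_cons_succ, List.eraseIdx_cons_zero, pow_zero,
      pow_succ, mul_neg, mul_one, Finsupp.single_neg, Finset.sum_neg_distrib]
    abel

lemma sublist_of_faceSum_ne_zero {u z : List V} (h : faceSum u z ≠ 0) :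
    z.Sublist u ∧ z.length + 1 = u.length := by
  classical
  rw [faceSum_eq_sum, Finsupp.finsetSum_apply] at h
  obtain ⟨i, hi, hne⟩ := Finset.exists_ne_zero_of_sum_ne_zero h
  rw [Finsupp.single_apply] at hne
  split_ifs at hne with h1
  · subst h1
    have := Finset.mem_range.1 hi
    exact ⟨List.eraseIdx_sublist u i, by rw [List.length_eraseIdx_of_lt this]; omega⟩
  · exact absurd rfl hne

lemma diff_apply (c : List V →₀ ℤ) (z : List V) : diff c z = c.sum fun u t => t * faceSum u z := by
  rw [diff, Finsupp.linearCombination_apply, Finsupp.sum, Finsupp.finsetSum_apply]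
  rfl

lemma exists_of_diff_apply_ne_zero {c : List V →₀ ℤ} {z : List V} (h : diff c z ≠ 0) :
    ∃ u, c u ≠ 0 ∧ z.Sublist u ∧ z.length + 1 = u.length := by
  rw [diff_apply] at h
  obtain ⟨u, hu, hne⟩ := Finset.exists_ne_zero_of_sum_ne_zero h
  exact ⟨u, Finsupp.mem_support_iff.1 hu, sublist_of_faceSum_ne_zero (right_ne_zero_of_mul hne)⟩

open Classical in
/-- The coefficients in the boundary of a simplex of the faces that omit a given vertex. -/
lemma exists_sign_faceSum {u : List V} (hu : u.Nodup) {v : V} (hv : v ∈ u) :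
    ∃ ε : ℤ, ε * ε = 1 ∧ ∀ z : List V, v ∉ z → faceSum u z = if z = u.erase v then ε else 0 := by
  induction u with
  | nil => simp at hv
  | cons x u ih =>
    rw [List.nodup_cons] at hu
    have key : ∀ (c : List V →₀ ℤ) (z : List V), consChain x c z =
        match z with | [] => 0 | y :: z' => if y = x then c z' else 0 := by
      intro c z
      induction c using Finsupp.induction_linear with
      | zero => cases z <;> simp
      | add f g hf hg =>
        rw [map_add, Finsupp.add_apply, hf, hg]
        cases z with
        | nil => simp
        | cons y z' => simp only [Finsupp.add_apply]; split_ifs <;> simp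
      | single w t =>
        rw [consChain_single, Finsupp.single_apply]
        cases z with
        | nil => simp
        | cons y z' =>
          simp only [List.cons.injEq, Finsupp.single_apply]
          by_cases h : y = x
          · simp [h]
          · simp [h, Ne.symm h]
    by_cases hxv : x = v
    · subst hxv
      refine ⟨1, by norm_num, fun z hz => ?_⟩
      simp only [faceSum, Finsupp.sub_apply, key, List.erase_cons_head, Finsupp.single_apply]
      cases z with
      | nil => simp [eq_comm]
      | cons y z' =>
        have : y ≠ x := by rintro rfl; simp at hz
        simp [this, eq_comm]
    · have hvu : v ∈ u := by
        rcases List.mem_cons.1 hv with h | h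
        · exact absurd h.symm hxv
        · exact h
      obtain ⟨ε, h1, h2⟩ := ih hu.2 hvu
      refine ⟨-ε, by linarith, fun z hz => ?_⟩
      have hzu : u ≠ z := by rintro rfl; exact hz hvu
      rw [List.erase_cons_tail (by simpa using hxv)]
      simp only [faceSum, Finsupp.sub_apply, key, Finsupp.single_apply, hzu, if_false]
      cases z with
      | nil => simp
      | cons y z' =>
        have hz' : v ∉ z' := fun h => hz (List.mem_cons_of_mem _ h)
        by_cases h : y = x
        · subst h
          simp only [if_true, h2 z' hz', List.cons.injEq, true_and]
          split_ifs <;> simp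
        · simp [h]

/-- All cycles of `K` on tuples with fewer than `m` entries are boundaries in `K`. -/
def AcyclicBelow (K : Set (List V)) (m : ℕ) : Prop :=
  ∀ (j : ℕ) (c : List V →₀ ℤ), j < m → (∀ w, c w ≠ 0 → w ∈ K ∧ w.length = j) → diff c = 0 →
    ∃ e : List V →₀ ℤ, (∀ w, e w ≠ 0 → w ∈ K ∧ w.length = j + 1) ∧ diff e = c

-- Below a tuple without repetitions, a subtuple is determined by its set of entries; this lets the
-- faces of one facet be treated as subsets.
open Classical in
lemma sublist_eq_filter {F w : List V} (hF : F.Nodup) (h : w.Sublist F) :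
    w = F.filter (· ∈ w) := by
  induction h with
  | slnil => simp
  | @cons w F x h ih =>
    rw [List.nodup_cons] at hF
    have : x ∉ w := fun hx => hF.1 (h.subset hx)
    rw [List.filter_cons_of_neg (by simpa using this)]
    exact ih hF.2
  | @cons_cons w F x h ih =>
    rw [List.nodup_cons] at hF
    rw [List.filter_cons_of_pos (by simp)]
    congr 1
    conv_lhs => rw [ih hF.2]
    refine List.filter_congr fun y hy => ?_
    have : y ≠ x := by rintro rfl; exact hF.1 hy
    simp [this]

lemma sublist_eq_of_mem_iff {F w w' : List V} (hF : F.Nodup) (h : w.Sublist F) (h' : w'.Sublist F)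
    (hm : ∀ x, x ∈ w ↔ x ∈ w') : w = w' := by
  classical
  rw [sublist_eq_filter hF h, sublist_eq_filter hF h']
  simp [hm]

lemma sublist_of_subset {F w w' : List V} (hF : F.Nodup) (h : w.Sublist F) (h' : w'.Sublist F)
    (hm : ∀ x ∈ w, x ∈ w') : w.Sublist w' := by
  classical
  rw [sublist_eq_filter hF h, sublist_eq_filter hF h']
  refine List.monotone_filter_right _ fun x hx => ?_
  simpa using hm x (by simpa using hx)

/-- One shelling step. The hypothesis `hr` says that `K` meets the simplex `F` in the union of its
codimension-one faces opposite the vertices in `r`. Either this is the whole boundary of `F` and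
only a top simplex is added, or some `v ∈ F` lies outside `r` and the new faces pair off as `w`, `w
∪ {v}`, so that any cycle can be pushed into `K`. -/
lemma AcyclicBelow.union_face {K : Set (List V)} {m : ℕ} {F : List V} (hK : AcyclicBelow K m)
    (hdown : ∀ w ∈ K, ∀ z : List V, z.Sublist w → z ∈ K) (hF : F.Nodup) (hm : F.length = m)
    (r : Set V) (hr : ∀ w : List V, w.Sublist F → (w ∈ K ↔ ∃ v ∈ r, v ∉ w)) :
    AcyclicBelow (K ∪ face F) m := by
  classical
  intro j c hj hc hdc
  -- If every vertex of `F` lies in `r`, the only face possibly missing from `K` is `F` itself,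
  -- which has `m` entries and cannot occur in a chain of degree `j < m`.
  by_cases hall : ∀ v ∈ F, v ∈ r
  · have hcK : ∀ w, c w ≠ 0 → w ∈ K ∧ w.length = j := by
      intro w hw
      obtain ⟨h | h, hl⟩ := hc w hw
      · exact ⟨h, hl⟩
      · refine ⟨(hr w h).2 ?_, hl⟩
        by_contra! hcon
        have := sublist_eq_of_mem_iff hF h (List.Sublist.refl F)
          fun x => ⟨fun hx => h.subset hx, fun hx => hcon x (hall x hx)⟩
        subst this
        omega
    obtain ⟨e, he, hde⟩ := hK j c hj hcK hdc
    exact ⟨e, fun w hw => ⟨Or.inl (he w hw).1, (he w hw).2⟩, hde⟩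
  push Not at hall
  obtain ⟨v, hvF, hvr⟩ := hall
  -- `add w` is `w` with `v` inserted at its place in `F`: the partner of `w` in the pairing of the
  -- new faces.
  set add : List V → List V := fun w => F.filter fun x => x ∈ w ∨ x = v with hadd
  have add_sub : ∀ w, (add w).Sublist F := fun w => List.filter_sublist
  have add_mem : ∀ w, v ∈ add w := fun w => by simp [hadd, hvF]
  have add_erase : ∀ w : List V, w.Sublist F → v ∉ w → (add w).erase v = w := by
    intro w hw hv
    refine sublist_eq_of_mem_iff hF (List.erase_sublist.trans (add_sub w)) hw fun x => ?_
    rw [(hF.sublist (add_sub w)).mem_erase_iff]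
    simp only [hadd, List.mem_filter, decide_eq_true_eq]
    constructor
    · rintro ⟨h1, h2, h3 | h3⟩
      · exact h3
      · exact absurd h3 h1
    · intro hx
      exact ⟨by rintro rfl; exact hv hx, hw.subset hx, Or.inl hx⟩
  have add_length : ∀ w : List V, w.Sublist F → v ∉ w → (add w).length = w.length + 1 := by
    intro w hw hv
    have h1 := List.length_erase_of_mem (add_mem w)
    rw [add_erase w hw hv] at h1
    have := List.length_pos_of_mem (add_mem w)
    omega
  choose! ε hε1 hε2 using fun (u : List V) (h : u.Nodup ∧ v ∈ u) => exists_sign_faceSum h.1 h.2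
  set T : Finset (List V) := c.support.filter fun w => w ∉ K ∧ v ∉ w with hT
  have hTF : ∀ w ∈ T, w.Sublist F ∧ w ∉ K ∧ v ∉ w ∧ w.length = j := by
    intro w hw
    obtain ⟨h1, h2, h3⟩ := Finset.mem_filter.1 hw
    obtain ⟨h4 | h4, h5⟩ := hc w (Finsupp.mem_support_iff.1 h1)
    · exact absurd h4 h2
    · exact ⟨h4, h2, h3, h5⟩
  -- Among the faces of `add w`, only `w` omits `v`. Since the sign `ε` squares to one, `diff e`
  -- agrees with `c` on the new faces omitting `v`, and `c - diff e` vanishes there.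
  set e : List V →₀ ℤ := ∑ w ∈ T, Finsupp.single (add w) (ε (add w) * c w) with he
  have he_supp : ∀ u, e u ≠ 0 → u.Sublist F ∧ u.length = j + 1 := by
    intro u hu
    rw [he, Finsupp.finsetSum_apply] at hu
    obtain ⟨w, hw, hne⟩ := Finset.exists_ne_zero_of_sum_ne_zero hu
    rw [Finsupp.single_apply] at hne
    split_ifs at hne with h
    · subst h
      obtain ⟨h1, _, h3, h4⟩ := hTF w hw
      exact ⟨add_sub w, by rw [add_length w h1 h3, h4]⟩
    · exact absurd rfl hne
  have hde : ∀ z : List V, v ∉ z → diff e z = if z ∈ T then c z else 0 := by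
    intro z hz
    rw [he, map_sum, Finsupp.finsetSum_apply]
    have : ∀ w ∈ T, (diff (Finsupp.single (add w) (ε (add w) * c w))) z =
        if z = w then c w else 0 := by
      intro w hw
      obtain ⟨h1, _, h3, h4⟩ := hTF w hw
      have hnd : (add w).Nodup ∧ v ∈ add w := ⟨hF.sublist (add_sub w), add_mem w⟩
      rw [diff_single, Finsupp.smul_apply, hε2 _ hnd z hz, add_erase w h1 h3]
      split_ifs
      · rw [smul_eq_mul, mul_right_comm, hε1 _ hnd, one_mul]
      · simp
    rw [Finset.sum_congr rfl this, Finset.sum_ite_eq]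
  set c' := c - diff e with hc'
  have hdc' : diff c' = 0 := by rw [hc', map_sub, hdc, diff_diff, sub_zero]
  have hc'_supp : ∀ w, c' w ≠ 0 → w ∈ K ∪ face F ∧ w.length = j := by
    intro w hw
    by_cases h : c w = 0
    · have : diff e w ≠ 0 := by
        intro h0; apply hw; rw [hc', Finsupp.sub_apply, h, h0, sub_zero]
      obtain ⟨u, hu, h1, h2⟩ := exists_of_diff_apply_ne_zero this
      obtain ⟨h3, h4⟩ := he_supp u hu
      exact ⟨Or.inr (h1.trans h3), by omega⟩
    · exact hc w h
  have hc'v : ∀ w, w.Sublist F → w ∉ K → v ∉ w → c' w = 0 := by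
    intro w h1 h2 h3
    rw [hc', Finsupp.sub_apply, hde w h3]
    split_ifs with h
    · simp
    · have : w ∉ c.support := fun h' => h (Finset.mem_filter.2 ⟨h', h2, h3⟩)
      simpa using this
  have hc'K : ∀ w, c' w ≠ 0 → w ∈ K := by
    intro w hw
    by_contra hwK
    have hwF : w.Sublist F := by
      rcases (hc'_supp w hw).1 with h | h
      · exact absurd h hwK
      · exact h
    have hvw : v ∈ w := by
      by_contra h
      exact hw (hc'v w hwF hwK h)
    have hwn := hF.sublist hwF
    have hz : v ∉ w.erase v := by rw [hwn.mem_erase_iff]; simp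
    have hzF : (w.erase v).Sublist F := List.erase_sublist.trans hwF
    have hzK : w.erase v ∉ K := by
      rw [hr _ hwF] at hwK
      rw [hr _ hzF]
      push Not at hwK ⊢
      intro x hx
      rw [hwn.mem_erase_iff]
      exact ⟨by rintro rfl; exact hvr hx, hwK x hx⟩
    -- A new face `w` that contains `v` is the only tuple in the support of `c'` having `w.erase v`
    -- as a face: any other lies outside `K`, so it contains `v` and has the same entries. The
    -- coefficient of `w.erase v` in `diff c' = 0` is therefore `± c' w`.
    have h0 : diff c' (w.erase v) = 0 := by rw [hdc']; rfl
    rw [diff_apply, Finsupp.sum, Finset.sum_eq_single w] at h0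
    · rw [hε2 w ⟨hwn, hvw⟩ _ hz, if_pos rfl] at h0
      rcases mul_eq_zero.1 h0 with h | h
      · exact hw h
      · have := hε1 w ⟨hwn, hvw⟩
        rw [h] at this
        norm_num at this
    · intro u hu huw
      by_contra hne
      obtain ⟨h1, -⟩ := sublist_of_faceSum_ne_zero (right_ne_zero_of_mul hne)
      have hu' := Finsupp.mem_support_iff.1 hu
      have huK : u ∉ K := fun h => hzK (hdown u h _ h1)
      have huF : u.Sublist F := by
        rcases (hc'_supp u hu').1 with h | h
        · exact absurd h huK
        · exact h
      have hvu : v ∈ u := by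
        by_contra h
        exact hu' (hc'v u huF huK h)
      have hun := hF.sublist huF
      have hne' := right_ne_zero_of_mul hne
      rw [hε2 u ⟨hun, hvu⟩ _ hz] at hne'
      split_ifs at hne' with heq
      · apply huw
        refine sublist_eq_of_mem_iff hF huF hwF fun x => ?_
        by_cases hx : x = v
        · subst hx; simp [hvu, hvw]
        · have h2 := hun.mem_erase_iff (a := x) (b := v)
          have h3 := hwn.mem_erase_iff (a := x) (b := v)
          rw [← heq] at h2
          simp only [hx, ne_eq, not_false_eq_true, true_and] at h2 h3
          rw [← h2, ← h3]
      · exact hne' rfl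
    · intro h
      simp only [Finsupp.mem_support_iff, not_not] at h
      exact absurd h hw
  obtain ⟨e', he', hde'⟩ := hK j c' hj (fun w hw => ⟨hc'K w hw, (hc'_supp w hw).2⟩) hdc'
  refine ⟨e + e', fun w hw => ?_, by rw [map_add, hde', hc']; abel⟩
  by_cases h : e w = 0
  · have : e' w ≠ 0 := by intro h'; apply hw; simp [h, h']
    exact ⟨Or.inl (he' w this).1, (he' w this).2⟩
  · exact ⟨Or.inr (he_supp w h).1, (he_supp w h).2⟩

lemma exists_eq_erase_of_sublist [DecidableEq V] {R F : List V} (hF : F.Nodup) (h : R.Sublist F)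
    (hl : R.length + 1 = F.length) : ∃ v ∈ F, R = F.erase v := by
  obtain ⟨v, hv, hvR⟩ : ∃ v ∈ F, v ∉ R := by
    by_contra! hcon
    have := (sublist_of_subset hF (List.Sublist.refl F) h hcon).length_le
    omega
  refine ⟨v, hv, ?_⟩
  have hs : R.Sublist (F.erase v) := by
    refine sublist_of_subset hF h List.erase_sublist fun x hx => ?_
    rw [hF.mem_erase_iff]
    exact ⟨by rintro rfl; exact hvR hx, h.subset hx⟩
  exact hs.eq_of_length (by rw [List.length_erase_of_mem hv]; omega)

/-- The facets are added in shelling order. The empty union is acyclic for lack of chains, and the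
first facet is the case `r = ∅` of `AcyclicBelow.union_face`. -/
lemma IsShelling.acyclicBelow {X : Set (List V)} {L : List (List V)} (hL : IsShelling X L) {m : ℕ}
    (hnd : ∀ w ∈ X, w.Nodup) (hpure : ∀ F, IsFacet X F → F.length = m) :
    AcyclicBelow (⋃ F ∈ L, face F) m := by
  classical
  obtain ⟨hLn, hLF, hshell⟩ := hL
  have main : ∀ k ≤ L.length, AcyclicBelow (⋃ i : Fin k, ⋃ (_ : (i : ℕ) < L.length), face L[i]) m := by
    intro k
    induction k with
    | zero =>
      intro _ j c _ hc _
      refine ⟨0, by simp, ?_⟩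
      rw [map_zero]
      refine (Finsupp.ext fun w => ?_).symm
      by_contra hw
      simpa using (hc w hw).1
    | succ k ih =>
      intro hk
      have hk' : k < L.length := hk
      have hFX : IsFacet X L[k] := (hLF _).1 (List.getElem_mem _)
      have hFn := hnd _ hFX.1
      have heq : (⋃ i : Fin (k + 1), ⋃ (_ : (i : ℕ) < L.length), face L[i]) =
          (⋃ i : Fin k, ⋃ (_ : (i : ℕ) < L.length), face L[i]) ∪ face L[k] := by
        ext w
        simp only [Set.mem_iUnion, Set.mem_union]
        constructor
        · rintro ⟨i, hi, hw⟩
          rcases Nat.lt_succ_iff_lt_or_eq.1 i.2 with h | h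
          · exact Or.inl ⟨⟨i, h⟩, hi, hw⟩
          · right
            have : L[(i : ℕ)] = L[k] := by simp [h]
            rw [← this]
            exact hw
        · rintro (⟨i, hi, hw⟩ | hw)
          · exact ⟨i.castSucc, hi, hw⟩
          · exact ⟨Fin.last k, hk', hw⟩
      rw [heq]
      have hdown : ∀ w ∈ (⋃ i : Fin k, ⋃ (_ : (i : ℕ) < L.length), face L[i]),
          ∀ z : List V, z.Sublist w → z ∈ (⋃ i : Fin k, ⋃ (_ : (i : ℕ) < L.length), face L[i]) := by
        intro w hw z hz
        simp only [Set.mem_iUnion] at hw ⊢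
        obtain ⟨i, hi, hw⟩ := hw
        exact ⟨i, hi, hz.trans hw⟩
      rcases Nat.eq_zero_or_pos k with rfl | hpos
      · exact (ih (by omega)).union_face hdown hFn (hpure _ hFX) ∅ (by simp)
      · obtain ⟨S, -, hS1, hS2⟩ := hshell k hk' hpos
        -- Each face in `S` omits exactly one vertex of the facet; these vertices form the set `r`.
        refine (ih (by omega)).union_face hdown hFn (hpure _ hFX) {v | v ∈ L[k] ∧ L[k].erase v ∈ S}
          fun w hw => ?_
        have h1 : w ∈ (⋃ i : Fin k, ⋃ (_ : (i : ℕ) < L.length), face L[i]) ↔ w ∈ ⋃ R ∈ S, face R := by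
          rw [← hS2]
          simp only [Set.mem_iUnion, Set.mem_inter_iff]
          constructor
          · rintro ⟨i, hi, h⟩
            exact ⟨hw, i, h⟩
          · rintro ⟨_, i, h⟩
            exact ⟨i, by omega, h⟩
        rw [h1]
        simp only [Set.mem_iUnion, exists_prop, Set.mem_ofPred_eq]
        constructor
        · rintro ⟨R, hR, hwR⟩
          obtain ⟨hRF, hRl⟩ := hS1 R hR
          obtain ⟨v, hv, rfl⟩ := exists_eq_erase_of_sublist hFn hRF hRl
          exact ⟨v, ⟨hv, hR⟩, fun h => by simpa [hFn.mem_erase_iff] using hwR.subset h⟩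
        · rintro ⟨v, ⟨hv, hR⟩, hvw⟩
          refine ⟨_, hR, sublist_of_subset hFn hw List.erase_sublist fun x hx => ?_⟩
          rw [hFn.mem_erase_iff]
          exact ⟨by rintro rfl; exact hvw hx, hw.subset hx⟩
  convert main L.length le_rfl using 1
  ext w
  simp only [Set.mem_iUnion, exists_prop]
  constructor
  · rintro ⟨F, hF, hw⟩
    obtain ⟨i, hi, rfl⟩ := List.getElem_of_mem hF
    exact ⟨⟨i, hi⟩, hi, hw⟩
  · rintro ⟨i, hi, hw⟩
    exact ⟨L[i], List.getElem_mem _, hw⟩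

end Chains

/-! ### From acyclicity of the two complexes to torsion-freeness of eulerian magnitude homology. -/

section Torsion

variable {V : Type*} (G : SimpleGraph V)

lemma len_cons_le (x y : V) (w : List V) : len G (x :: w) ≤ G.edist x y + len G (y :: w) := by
  cases w with
  | nil => simp [len]
  | cons z w =>
    simp only [len]
    rw [← add_assoc]
    gcongr
    exact G.edist_triangle

/-- By the triangle inequality, omitting entries never lengthens a tuple; hence the tuples of
bounded length are closed under faces. -/
lemma len_cons_mono_of_sublist {w w' : List V} (h : w.Sublist w') (x : V) :
    len G (x :: w) ≤ len G (x :: w') := by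
  induction h generalizing x with
  | slnil => exact le_rfl
  | @cons w w' y h ih =>
    calc len G (x :: w) ≤ G.edist x y + len G (y :: w) := len_cons_le G x y w
      _ ≤ G.edist x y + len G (y :: w') := by gcongr; exact ih y
  | @cons_cons w w' y h ih =>
    simp only [len]
    gcongr
    exact ih y

lemma length_le_len {w : List V} (hw : w.Nodup) : (w.length : ℕ∞) ≤ len G w + 1 := by
  induction w with
  | nil => simp
  | cons x w ih =>
    cases w with
    | nil => simp
    | cons y w =>
      have h1 := ih (List.nodup_cons.1 hw).2
      have hne : x ≠ y := by rintro rfl; simp at hw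
      have h2 : 1 ≤ G.edist x y := by
        rw [Order.one_le_iff_ne_zero]
        simpa using hne
      simp only [len]
      rw [List.length_cons, Nat.cast_add, Nat.cast_one]
      calc ((y :: w).length : ℕ∞) + 1 ≤ (len G (y :: w) + 1) + 1 := by gcongr
        _ = 1 + len G (y :: w) + 1 := by rw [add_comm (len G (y :: w)) 1]
        _ ≤ _ := by gcongr

/-- The tuples `w`, possibly empty, such that `(a, w, b)` consists of distinct vertices and has
length at most `ℓ`: the simplices of `ET_{≤ ℓ}(a,b)` and possibly the empty one. -/
def augmentedET (a b : V) (ℓ : ℕ) : Set (List V) :=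
  {w | (a :: (w ++ [b])).Nodup ∧ len G (a :: (w ++ [b])) ≤ ℓ}

/-- Every tuple that has fewer than `ℓ - 1` entries can be refined. -/
def Refinable (a b : V) (ℓ : ℕ) : Prop :=
  ∀ w ∈ augmentedET G a b ℓ, w.length + 1 < ℓ →
    ∃ w' ∈ augmentedET G a b ℓ, w.Sublist w' ∧ w' ≠ w

variable {G} {a b : V} {ℓ : ℕ}

lemma augmentedET_of_sublist {w z : List V} (hw : w ∈ augmentedET G a b ℓ) (h : z.Sublist w) :
    z ∈ augmentedET G a b ℓ := by
  have hs : (z ++ [b]).Sublist (w ++ [b]) := h.append_right [b]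
  exact ⟨hw.1.sublist (hs.cons_cons a), (len_cons_mono_of_sublist G hs a).trans hw.2⟩

lemma length_lt_of_mem_augmentedET {w : List V} (hw : w ∈ augmentedET G a b ℓ) :
    w.length + 1 ≤ ℓ := by
  have h1 := (length_le_len G hw.1).trans (add_le_add_left hw.2 1)
  have h2 : ((a :: (w ++ [b])).length : ℕ∞) ≤ ((ℓ + 1 : ℕ) : ℕ∞) := by exact_mod_cast h1
  have h3 := Nat.cast_le.1 h2
  simp at h3
  omega

lemma exists_isFacet_of_mem {w : List V} (hw : w ∈ ET G a b ℓ) :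
    ∃ F, IsFacet (ET G a b ℓ) F ∧ w.Sublist F := by
  induction hn : ℓ - w.length using Nat.strong_induction_on generalizing w with
  | _ n ih =>
    by_cases hF : IsFacet (ET G a b ℓ) w
    · exact ⟨w, hF, List.Sublist.refl w⟩
    · simp only [IsFacet, hw, true_and, not_forall] at hF
      obtain ⟨w', hw', hs, hne⟩ := hF
      have h1 := hs.length_le
      have h2 : w.length ≠ w'.length := fun h => hne (hs.eq_of_length h).symm
      have h3 := length_lt_of_mem_augmentedET hw'.2
      obtain ⟨F, hF, hwF⟩ := ih (ℓ - w'.length) (by omega) hw' rfl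
      exact ⟨F, hF, hs.trans hwF⟩

/-- Refinability makes the complex pure with facets of `ℓ - 1` entries. With `2 ≤ ℓ` it also places
the empty tuple, when admissible, below a nonempty one, so the augmented complex is exactly the
union of the faces of the facets. -/
lemma AcyclicBelow_augmentedET (hℓ : 2 ≤ ℓ) (href : Refinable G a b ℓ)
    (hsh : Shellable (ET G a b ℓ)) : AcyclicBelow (augmentedET G a b ℓ) (ℓ - 1) := by
  obtain ⟨L, hL⟩ := hsh
  have hpure : ∀ F, IsFacet (ET G a b ℓ) F → F.length = ℓ - 1 := by
    intro F hF
    have h1 := length_lt_of_mem_augmentedET hF.1.2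
    by_contra hne
    obtain ⟨w', hw', hs, hne'⟩ := href F hF.1.2 (by omega)
    refine hne' (hF.2 w' ⟨?_, hw'⟩ hs)
    rintro rfl
    exact hF.1.1 (List.eq_nil_of_sublist_nil hs)
  have hnd : ∀ w ∈ ET G a b ℓ, w.Nodup := by
    intro w hw
    exact hw.2.1.sublist ((List.sublist_append_left w [b]).trans (List.sublist_cons_self _ _))
  convert hL.acyclicBelow hnd hpure using 1
  ext w
  simp only [Set.mem_iUnion, exists_prop]
  constructor
  · intro hw
    obtain ⟨w', hw', hs⟩ : ∃ w' ∈ ET G a b ℓ, w.Sublist w' := by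
      by_cases h : w = []
      · subst h
        obtain ⟨w', hw', hs, hne⟩ := href [] hw (by simp; omega)
        exact ⟨w', ⟨hne, hw'⟩, hs⟩
      · exact ⟨w, ⟨h, hw⟩, List.Sublist.refl w⟩
    obtain ⟨F, hF, hs'⟩ := exists_isFacet_of_mem hw'
    exact ⟨F, (hL.2.1 F).2 hF, hs.trans hs'⟩
  · rintro ⟨F, hF, hw⟩
    exact augmentedET_of_sublist ((hL.2.1 F).1 hF).1.2 hw

open Classical in
/-- The projection of chains of tuples to chains of eulerian trails. -/
noncomputable def toEMC (G : SimpleGraph V) (a b : V) (k ℓ : ℕ) :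
    (List V →₀ ℤ) →ₗ[ℤ] EMC G a b k ℓ :=
  Finsupp.linearCombination ℤ fun u =>
    if h : IsEulerianTrail G a b k ℓ (a :: (u ++ [b])) then Finsupp.single ⟨_, h⟩ 1 else 0

/-- The inclusion of chains of eulerian trails in chains of tuples. -/
noncomputable def ofEMC (G : SimpleGraph V) (a b : V) (k ℓ : ℕ) :
    EMC G a b k ℓ →ₗ[ℤ] (List V →₀ ℤ) :=
  Finsupp.lmapDomain ℤ ℤ fun w => w.1.tail.dropLast

lemma isEulerianTrail_cons_iff {k : ℕ} {u : List V} :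
    IsEulerianTrail G a b k ℓ (a :: (u ++ [b])) ↔
      (a :: (u ++ [b])).Nodup ∧ u.length + 1 = k ∧ len G (a :: (u ++ [b])) = ℓ := by
  simp only [IsEulerianTrail, List.length_cons, List.length_append, List.head?_cons]
  constructor
  · rintro ⟨h1, h2, -, -, h3⟩
    exact ⟨h1, by simpa using h2, h3⟩
  · rintro ⟨h1, h2, h3⟩
    refine ⟨h1, by simpa using h2, trivial, ?_, h3⟩
    rw [← List.cons_append, List.getLast?_append]
    simp

lemma IsEulerianTrail.eq_cons {k : ℕ} {w : List V} (hab : a ≠ b)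
    (h : IsEulerianTrail G a b k ℓ w) : w = a :: (w.tail.dropLast ++ [b]) := by
  obtain ⟨-, -, h3, h4, -⟩ := h
  cases w with
  | nil => simp at h3
  | cons x w =>
    simp only [List.head?_cons, Option.some.injEq] at h3
    subst h3
    cases w with
    | nil =>
      simp at h4
      exact absurd h4 hab
    | cons y w =>
      have h5 : (y :: w).getLast? = some b := by simpa using h4
      obtain ⟨l, hl⟩ := List.getLast?_eq_some_iff.1 h5
      rw [hl]
      simp

lemma toEMC_ofEMC {k : ℕ} (hab : a ≠ b) (c : EMC G a b k ℓ) :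
    toEMC G a b k ℓ (ofEMC G a b k ℓ c) = c := by
  induction c using Finsupp.induction_linear with
  | zero => simp
  | add f g hf hg => simp [hf, hg]
  | single w z =>
    have h := w.2.eq_cons hab
    have h' : IsEulerianTrail G a b k ℓ (a :: (w.1.tail.dropLast ++ [b])) := by
      rw [← h]; exact w.2
    rw [ofEMC, Finsupp.lmapDomain_apply, Finsupp.mapDomain_single, toEMC,
      Finsupp.linearCombination_single, dif_pos h', Finsupp.smul_single, smul_eq_mul, mul_one]
    congr 1
    exact Subtype.ext h.symm

lemma ofEMC_ne_zero {k : ℕ} (hab : a ≠ b) {c : EMC G a b k ℓ} {u : List V}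
    (hu : ofEMC G a b k ℓ c u ≠ 0) : IsEulerianTrail G a b k ℓ (a :: (u ++ [b])) := by
  classical
  have h1 : u ∈ (Finsupp.mapDomain (fun w : {w : List V // IsEulerianTrail G a b k ℓ w} =>
      w.1.tail.dropLast) c).support := Finsupp.mem_support_iff.2 hu
  obtain ⟨w, -, rfl⟩ := Finset.mem_image.1 (Finsupp.mapDomain_support h1)
  rw [← w.2.eq_cons hab]
  exact w.2

lemma toEMC_apply {k : ℕ} (c : List V →₀ ℤ) (u : List V)
    (h : IsEulerianTrail G a b k ℓ (a :: (u ++ [b]))) : toEMC G a b k ℓ c ⟨_, h⟩ = c u := by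
  classical
  induction c using Finsupp.induction_linear with
  | zero => simp
  | add f g hf hg => simp [hf, hg]
  | single w z =>
    rw [toEMC, Finsupp.linearCombination_single, Finsupp.single_apply]
    by_cases hwu : w = u
    · subst hwu
      simp [h]
    · rw [if_neg hwu]
      split_ifs with h'
      · rw [Finsupp.smul_single, Finsupp.single_apply, if_neg]
        simpa using hwu
      · simp

lemma toEMC_eq_zero {k : ℕ} {c : List V →₀ ℤ}
    (hc : ∀ u, c u ≠ 0 → len G (a :: (u ++ [b])) ≠ ℓ) : toEMC G a b k ℓ c = 0 := by
  rw [toEMC, Finsupp.linearCombination_apply]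
  refine Finset.sum_eq_zero fun u hu => ?_
  beta_reduce
  rw [dif_neg, smul_zero]
  intro h
  exact hc u (Finsupp.mem_support_iff.1 hu) h.2.2.2.2

/-- The sign appears because entry `i` of `u` is landmark `i + 1` of the trail. Faces of length
below `ℓ` vanish on both sides, and a tuple already shorter than `ℓ` has only such faces. -/
lemma toEMC_faceSum {k : ℕ} {u : List V} (hu : u ∈ augmentedET G a b ℓ) (hk : u.length = k) :
    toEMC G a b k ℓ (faceSum u) =
      -boundary G a b k ℓ (toEMC G a b (k + 1) ℓ (Finsupp.single u 1)) := by
  classical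
  by_cases hl : len G (a :: (u ++ [b])) = ℓ
  · have htr : IsEulerianTrail G a b (k + 1) ℓ (a :: (u ++ [b])) :=
      isEulerianTrail_cons_iff.2 ⟨hu.1, by omega, hl⟩
    rw [toEMC, toEMC, Finsupp.linearCombination_single, dif_pos htr, one_smul, boundary,
      Finsupp.linearCombination_single, one_smul, faceSum_eq_sum, map_sum,
      ← Finset.sum_neg_distrib, hk]
    rw [Finset.range_eq_Ico, ← Finset.Ico_succ_right_eq_Icc]
    rw [Finset.sum_Ico_eq_sum_range, Finset.sum_Ico_eq_sum_range]
    simp only [Nat.sub_zero, Nat.succ_eq_succ, Nat.succ_eq_add_one, Nat.add_sub_cancel]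
    refine Finset.sum_congr rfl fun i hi => ?_
    have hi' : i < u.length := by rw [hk]; simpa using hi
    have he : (a :: (u ++ [b])).eraseIdx (1 + i) = a :: (u.eraseIdx i ++ [b]) := by
      rw [add_comm, List.eraseIdx_cons_succ, List.eraseIdx_append_of_lt_length hi']
    rw [Finsupp.linearCombination_single, zero_add]
    by_cases h : IsEulerianTrail G a b k ℓ (a :: (u.eraseIdx i ++ [b]))
    · have h' : IsEulerianTrail G a b k ℓ ((a :: (u ++ [b])).eraseIdx (1 + i)) := by rwa [he]
      rw [dif_pos h, dif_pos h', Finsupp.smul_single, ← Finsupp.single_neg]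
      congr 1
      · exact Subtype.ext he.symm
      · rw [pow_add]; simp
    · have h' : ¬ IsEulerianTrail G a b k ℓ ((a :: (u ++ [b])).eraseIdx (1 + i)) := by rwa [he]
      rw [dif_neg h, dif_neg h', smul_zero, neg_zero]
  · rw [toEMC_eq_zero, toEMC_eq_zero, map_zero, neg_zero]
    · intro w hw
      rw [Finsupp.single_apply] at hw
      split_ifs at hw with h
      · rwa [← h]
      · exact absurd rfl hw
    · intro w hw
      have h1 := (sublist_of_faceSum_ne_zero hw).1.append_right [b]
      exact ((len_cons_mono_of_sublist G h1 a).trans_lt (lt_of_le_of_ne hu.2 hl)).ne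

lemma toEMC_diff {k : ℕ} {c : List V →₀ ℤ}
    (hc : ∀ u, c u ≠ 0 → u ∈ augmentedET G a b ℓ ∧ u.length = k) :
    toEMC G a b k ℓ (diff c) = -boundary G a b k ℓ (toEMC G a b (k + 1) ℓ c) := by
  have h : c = ∑ u ∈ c.support, c u • Finsupp.single u 1 := by
    conv_lhs => rw [← Finsupp.sum_single c]
    simp [Finsupp.sum]
  rw [h]
  simp only [map_sum, map_smul, diff_single, one_smul]
  rw [← Finset.sum_neg_distrib]
  refine Finset.sum_congr rfl fun u hu => ?_
  obtain ⟨h1, h2⟩ := hc u (Finsupp.mem_support_iff.1 hu)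
  rw [toEMC_faceSum h1 h2, smul_neg]

lemma isEmpty_trail_of_lt {k : ℕ} (h : ℓ < k) : IsEmpty {w : List V // IsEulerianTrail G a b k ℓ w} := by
  refine ⟨fun w => ?_⟩
  obtain ⟨h1, h2, -, -, h3⟩ := w.2
  have h4 := length_le_len G h1
  rw [h3, h2] at h4
  have h5 : ((k + 1 : ℕ) : ℕ∞) ≤ ((ℓ + 1 : ℕ) : ℕ∞) := by exact_mod_cast h4
  have := Nat.cast_le.1 h5
  omega

/-- With no chains in degree `k + 1` the homology is the group of cycles, which embeds in
integer-valued functions. -/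
lemma isAddTorsionFree_of_isEmpty {k : ℕ}
    (h : IsEmpty {w : List V // IsEulerianTrail G a b (k + 1) ℓ w}) :
    IsAddTorsionFree (EMH G a b k ℓ) := by
  have hbot : (LinearMap.range (boundary G a b k ℓ)).comap (cycles G a b k ℓ).subtype = ⊥ := by
    have : LinearMap.range (boundary G a b k ℓ) = ⊥ := by
      rw [LinearMap.range_eq_bot]
      exact Subsingleton.elim _ _
    rw [this]
    exact LinearMap.ker_eq_bot.2 (Submodule.injective_subtype _)
  let φ : EMH G a b k ℓ →+ ({w : List V // IsEulerianTrail G a b k ℓ w} → ℤ) :=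
    (Finsupp.coeFnAddHom.comp (cycles G a b k ℓ).subtype.toAddMonoidHom).comp
      (Submodule.quotEquivOfEqBot _ hbot).toLinearMap.toAddMonoidHom
  have hφ : Function.Injective φ := DFunLike.coe_injective.comp
    (Subtype.val_injective.comp (Submodule.quotEquivOfEqBot _ hbot).injective)
  exact hφ.isAddTorsionFree φ

lemma isAddTorsionFree_of_le {k : ℕ}
    (h : cycles G a b k ℓ ≤ LinearMap.range (boundary G a b k ℓ)) :
    IsAddTorsionFree (EMH G a b k ℓ) := by
  have : Subsingleton (EMH G a b k ℓ) := by
    rw [Submodule.Quotient.subsingleton_iff, Submodule.comap_subtype_eq_top]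
    exact h
  infer_instance

lemma isAddTorsionFree_EMH_self (a : V) (k : ℕ) :
    IsAddTorsionFree (EMH G a a k ℓ) := by
  refine isAddTorsionFree_of_isEmpty ⟨fun w => ?_⟩
  obtain ⟨h1, h2, h3, h4, -⟩ := w.2
  generalize w.1 = l at *
  cases l with
  | nil => simp at h2
  | cons x l =>
    cases l with
    | nil => simp at h2
    | cons y l =>
      simp only [List.head?_cons, Option.some.injEq] at h3
      subst h3
      have h5 : (y :: l).getLast? = some x := by simpa using h4
      exact (List.nodup_cons.1 h1).1 (List.mem_of_getLast? h5)

/-- The long exact sequence of the pair, as a diagram chase: for `k < ℓ` each relative cycle is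
corrected by a chain of the smaller complex to an absolute cycle, which bounds in the larger one. -/
theorem isAddTorsionFree_EMH (hab : a ≠ b) (hℓ : 3 ≤ ℓ) (h1 : Refinable G a b ℓ)
    (h2 : Refinable G a b (ℓ - 1)) (hs1 : Shellable (ET G a b ℓ))
    (hs2 : Shellable (ET G a b (ℓ - 1))) (k : ℕ) : IsAddTorsionFree (EMH G a b k ℓ) := by
  rcases le_or_gt ℓ k with hk | hk
  · exact isAddTorsionFree_of_isEmpty (isEmpty_trail_of_lt (by omega))
  have hX := AcyclicBelow_augmentedET (by omega) h1 hs1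
  have hA := AcyclicBelow_augmentedET (by omega) h2 hs2
  refine isAddTorsionFree_of_le fun c hc => ?_
  set c₁ := ofEMC G a b k ℓ c with hc₁
  have hsupp : ∀ u, c₁ u ≠ 0 → (a :: (u ++ [b])).Nodup ∧ u.length + 1 = k ∧
      len G (a :: (u ++ [b])) = ℓ := fun u hu => isEulerianTrail_cons_iff.1 (ofEMC_ne_zero hab hu)
  rcases k with - | t
  · have : c₁ = 0 := by
      ext u
      by_contra hu
      have := (hsupp u hu).2.1
      omega
    refine ⟨0, ?_⟩
    rw [map_zero, ← toEMC_ofEMC hab c, ← hc₁, this, map_zero]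
  have hsuppX : ∀ u, c₁ u ≠ 0 → u ∈ augmentedET G a b ℓ ∧ u.length = t := fun u hu => by
    obtain ⟨h1, h2, h3⟩ := hsupp u hu
    exact ⟨⟨h1, h3.le⟩, by omega⟩
  have hAX : ∀ u ∈ augmentedET G a b (ℓ - 1), u ∈ augmentedET G a b ℓ := fun u hu =>
    ⟨hu.1, hu.2.trans (Nat.cast_le.2 (Nat.sub_le ℓ 1))⟩
  -- Since `c` is a relative cycle, `diff c₁` is supported on tuples of length at most `ℓ - 1`. It
  -- is a cycle there, and acyclicity of the smaller complex provides `e`; the degree bound `s < ℓ -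
  -- 1 - 1` is `k < ℓ` with `k = s + 2`.
  obtain ⟨e, heA, hde⟩ : ∃ e : List V →₀ ℤ,
      (∀ u, e u ≠ 0 → u ∈ augmentedET G a b (ℓ - 1) ∧ u.length = t) ∧ diff e = diff c₁ := by
    rcases t with - | s
    · refine ⟨0, by simp, ?_⟩
      rw [map_zero]
      refine (Finsupp.ext fun z => ?_).symm
      by_contra hz
      obtain ⟨u, hu, -, h⟩ := exists_of_diff_apply_ne_zero hz
      have := (hsuppX u hu).2
      omega
    · refine hA s (diff c₁) (by omega) (fun z hz => ?_) (diff_diff _)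
      obtain ⟨u, hu, hzu, hl⟩ := exists_of_diff_apply_ne_zero hz
      obtain ⟨hu1, hu2⟩ := hsuppX u hu
      have hzX := augmentedET_of_sublist hu1 hzu
      have hzl : z.length = s := by omega
      refine ⟨⟨hzX.1, ?_⟩, hzl⟩
      by_contra hlen
      have hlt : len G (a :: (z ++ [b])) = ℓ := by
        refine le_antisymm hzX.2 ?_
        have := Order.add_one_le_of_lt (not_le.1 hlen)
        refine le_trans (le_of_eq ?_) this
        exact_mod_cast (by omega : ℓ = ℓ - 1 + 1)
      have htr : IsEulerianTrail G a b (s + 1) ℓ (a :: (z ++ [b])) :=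
        isEulerianTrail_cons_iff.2 ⟨hzX.1, by omega, hlt⟩
      apply hz
      rw [← toEMC_apply _ z htr, toEMC_diff hsuppX, hc₁, toEMC_ofEMC hab]
      have : boundary G a b (s + 1) ℓ c = 0 := hc
      rw [this]
      simp
  obtain ⟨f, hf, hdf⟩ := hX t (c₁ - e) (by omega) (fun u hu => by
      by_cases h : c₁ u = 0
      · have : e u ≠ 0 := by intro h'; apply hu; simp [h, h']
        exact ⟨hAX u (heA u this).1, (heA u this).2⟩
      · exact hsuppX u h) (by rw [map_sub, hde, sub_self])
  -- The correction `e` has length below `ℓ`, so it projects to zero and the boundary found for `c₁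
  -- - e` is a boundary for `c`.
  refine ⟨-toEMC G a b (t + 1 + 1) ℓ f, ?_⟩
  rw [map_neg, ← toEMC_diff hf, hdf, map_sub, hc₁, toEMC_ofEMC hab, toEMC_eq_zero, sub_zero]
  intro u hu h
  have := (heA u hu).1.2
  rw [h, Nat.cast_le] at this
  omega

end Torsion

/-! ### Two deterministic conditions under which short tuples can be refined. -/

section Refinement

variable {V : Type*} {G : SimpleGraph V} {a b : V} {ℓ : ℕ}

lemma len_insert_le {x y z : V} {c : ℕ∞} (h : G.edist x z + G.edist z y ≤ G.edist x y + c)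
    (l₁ l₂ : List V) : len G (l₁ ++ x :: z :: y :: l₂) ≤ len G (l₁ ++ x :: y :: l₂) + c := by
  induction l₁ with
  | nil =>
    simp only [List.nil_append, len]
    calc G.edist x z + (G.edist z y + len G (y :: l₂))
        = (G.edist x z + G.edist z y) + len G (y :: l₂) := by rw [add_assoc]
      _ ≤ (G.edist x y + c) + len G (y :: l₂) := by gcongr
      _ = _ := by rw [add_right_comm]
  | cons p l₁ ih =>
    cases l₁ with
    | nil =>
      simp only [List.cons_append, List.nil_append, len] at ih ⊢
      rw [add_assoc (G.edist p x)]
      gcongr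
    | cons q l₁ =>
      simp only [List.cons_append, len] at ih ⊢
      rw [add_assoc (G.edist p q)]
      gcongr

lemma len_add_one_of_isChain {x : V} {w : List V} (h : (x :: w).IsChain G.Adj) :
    len G (x :: w) = w.length := by
  induction w generalizing x with
  | nil => simp [len]
  | cons y w ih =>
    rw [List.isChain_cons_cons] at h
    rw [len, ih h.2, SimpleGraph.edist_eq_one_iff_adj.2 h.1, List.length_cons]
    push_cast
    rw [add_comm]

lemma edist_le_len {x y : V} {w : List V} (h : (x :: w).getLast? = some y) :
    G.edist x y ≤ len G (x :: w) := by
  induction w generalizing x with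
  | nil =>
    simp at h
    simp [h]
  | cons z w ih =>
    have : (z :: w).getLast? = some y := by simpa using h
    calc G.edist x y ≤ G.edist x z + G.edist z y := G.edist_triangle
      _ ≤ _ := by rw [len]; gcongr; exact ih this

lemma edist_le_len_of_mem {x y : V} {w : List V} (h : w.getLast? = some y) (hx : x ∈ w) :
    G.edist x y ≤ len G w := by
  induction w with
  | nil => simp at hx
  | cons z w ih =>
    rcases List.mem_cons.1 hx with rfl | hx
    · exact edist_le_len h
    · cases w with
      | nil => simp at hx
      | cons q w =>
        rw [len]
        exact (ih (by simpa using h) hx).trans le_add_self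

/-- A tuple whose length is the distance of its ends, without repetitions of consecutive entries,
has no repetitions. -/
lemma nodup_of_len_le {x y : V} {w : List V} (h : (x :: w).getLast? = some y)
    (hl : len G (x :: w) ≤ G.edist x y) (hfin : G.edist x y ≠ ⊤) (hc : (x :: w).IsChain (· ≠ ·)) :
    (x :: w).Nodup := by
  induction w generalizing x with
  | nil => simp
  | cons q w ih =>
    have hlast : (q :: w).getLast? = some y := by simpa using h
    rw [List.isChain_cons_cons] at hc
    rw [len] at hl
    have hq : G.edist x q ≠ ⊤ := ((le_self_add.trans hl).trans_lt (lt_top_iff_ne_top.2 hfin)).ne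
    have hw : len G (q :: w) ≠ ⊤ := ((le_add_self.trans hl).trans_lt (lt_top_iff_ne_top.2 hfin)).ne
    have hl' : len G (q :: w) ≤ G.edist q y :=
      (ENat.add_le_add_iff_left hq).1 (hl.trans G.edist_triangle)
    refine List.nodup_cons.2 ⟨fun hx => ?_, ih hlast hl' ((edist_le_len hlast).trans_lt
      (lt_top_iff_ne_top.2 hw)).ne hc.2⟩
    have h1 : G.edist x q + len G (q :: w) ≤ 0 + len G (q :: w) := by
      rw [zero_add]
      exact hl.trans (edist_le_len_of_mem hlast hx)
    have h2 := (ENat.add_le_add_iff_right hw).1 h1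
    exact hc.1 (by simpa using h2)

/-- The gap between `x` and `y` may start at `a` or end at `b`, but the inserted vertex always falls
strictly between these two ends. -/
lemma exists_refinement {w l₁ l₂ : List V} {x y z : V}
    (heq : a :: (w ++ [b]) = l₁ ++ x :: y :: l₂) (hnd : (l₁ ++ x :: z :: y :: l₂).Nodup)
    (hlen : len G (l₁ ++ x :: z :: y :: l₂) ≤ ℓ) :
    ∃ w' ∈ augmentedET G a b ℓ, w.Sublist w' ∧ w' ≠ w := by
  obtain ⟨w₁, h₁⟩ : ∃ w₁, l₁ ++ [x] = a :: w₁ := by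
    cases l₁ with
    | nil => exact ⟨[], by simp at heq; simp [heq.1]⟩
    | cons p l₁ => exact ⟨l₁ ++ [x], by simp at heq; simp [heq.1]⟩
  have hlast : (y :: l₂).getLast? = some b := by
    have := congrArg List.getLast? heq
    rw [← List.cons_append, List.getLast?_append] at this
    rw [List.getLast?_append] at this
    simpa using this.symm
  obtain ⟨w₂, h₂⟩ := List.getLast?_eq_some_iff.1 hlast
  have e1 : l₁ ++ x :: y :: l₂ = a :: (w₁ ++ w₂ ++ [b]) := by
    calc l₁ ++ x :: y :: l₂ = (l₁ ++ [x]) ++ (y :: l₂) := by simp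
      _ = _ := by rw [h₁, h₂]; simp
  have e2 : l₁ ++ x :: z :: y :: l₂ = a :: ((w₁ ++ z :: w₂) ++ [b]) := by
    calc l₁ ++ x :: z :: y :: l₂ = (l₁ ++ [x]) ++ z :: (y :: l₂) := by simp
      _ = _ := by rw [h₁, h₂]; simp
  have hw : w = w₁ ++ w₂ := by
    rw [e1, List.cons.injEq] at heq
    exact List.append_cancel_right heq.2
  refine ⟨w₁ ++ z :: w₂, ⟨by rwa [← e2], by rwa [← e2]⟩, ?_, ?_⟩
  · rw [hw]
    exact List.Sublist.append_left (List.sublist_cons_self z w₂) w₁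
  · intro h
    have := congrArg List.length h
    rw [hw] at this
    simp at this

lemma nodup_insert {l₁ l₂ : List V} {x y z : V} (h : (l₁ ++ x :: y :: l₂).Nodup)
    (hz : z ∉ l₁ ++ x :: y :: l₂) : (l₁ ++ x :: z :: y :: l₂).Nodup := by
  have hp : (l₁ ++ x :: z :: y :: l₂).Perm (z :: (l₁ ++ x :: y :: l₂)) := by
    have : l₁ ++ x :: z :: y :: l₂ = (l₁ ++ [x]) ++ z :: (y :: l₂) := by simp
    rw [this]
    refine List.perm_middle.trans ?_
    simp
  rw [hp.nodup_iff]
  exact List.nodup_cons.2 ⟨hz, h⟩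

-- If all steps of the tuple are edges, a detour through a common neighbour costs one unit of
-- length, which is available because the tuple has fewer than `ℓ - 1` interior entries. Otherwise
-- some step has distance at least two, and a common neighbour fits in at no cost. The set `U` is
-- the set of vertices already used.
open Classical in
theorem refinable_of_common_neighbors
    (h : ∀ x y : V, x ≠ y → ∀ U : Finset V, U.card ≤ ℓ + 1 → ∃ z ∉ U, G.Adj x z ∧ G.Adj z y) :
    Refinable G a b ℓ := by
  intro w hw hl
  have hcard : (a :: (w ++ [b])).toFinset.card ≤ ℓ + 1 := by
    refine (List.toFinset_card_le _).trans ?_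
    simp
    omega
  by_cases hc : (a :: (w ++ [b])).IsChain G.Adj
  · obtain ⟨y, l₂, hy⟩ : ∃ y l₂, w ++ [b] = y :: l₂ := by
      cases w with
      | nil => exact ⟨b, [], rfl⟩
      | cons y w => exact ⟨y, w ++ [b], rfl⟩
    have heq : a :: (w ++ [b]) = [] ++ a :: y :: l₂ := by rw [hy]; rfl
    have hay : G.Adj a y := by
      rw [hy] at hc
      exact (List.isChain_cons_cons.1 hc).1
    obtain ⟨z, hz, h1, h2⟩ := h a y hay.ne _ hcard
    rw [List.mem_toFinset] at hz
    have hw1 := hw.1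
    rw [heq] at hw1 hz
    refine exists_refinement heq (nodup_insert hw1 hz) ?_
    have h3 : G.edist a z + G.edist z y ≤ G.edist a y + 1 := by
      rw [edist_eq_one_iff_adj.2 h1, edist_eq_one_iff_adj.2 h2, edist_eq_one_iff_adj.2 hay]
    refine (len_insert_le h3 [] l₂).trans ?_
    rw [← heq, len_add_one_of_isChain hc]
    have : (w ++ [b]).length + 1 ≤ ℓ := by simp; omega
    exact_mod_cast this
  · rw [List.isChain_iff_forall_rel_of_append_cons_cons] at hc
    push Not at hc
    obtain ⟨x, y, l₁, l₂, heq, hxy⟩ := hc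
    have hw1 := hw.1
    have hw2 := hw.2
    rw [heq] at hw1 hw2 hcard
    have hne : x ≠ y := by
      rintro rfl
      rw [List.nodup_append] at hw1
      simp at hw1
    obtain ⟨z, hz, h1, h2⟩ := h x y hne _ hcard
    rw [List.mem_toFinset] at hz
    refine exists_refinement heq (nodup_insert hw1 hz) ?_
    have h3 : G.edist x z + G.edist z y ≤ G.edist x y + 0 := by
      rw [edist_eq_one_iff_adj.2 h1, edist_eq_one_iff_adj.2 h2, add_zero]
      have h4 : 1 < G.edist x y := by
        rw [lt_iff_le_and_ne]
        refine ⟨?_, fun h => hxy (edist_eq_one_iff_adj.1 h.symm)⟩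
        rw [Order.one_le_iff_ne_zero]
        simpa using hne
      exact Order.add_one_le_of_lt h4
    refine (len_insert_le h3 l₁ l₂).trans ?_
    rwa [add_zero]

lemma exists_adj_edist_add_one {x y : V} (hne : x ≠ y) (hfin : G.edist x y ≠ ⊤) :
    ∃ z, G.Adj x z ∧ G.edist z y + 1 ≤ G.edist x y := by
  obtain ⟨p, hp⟩ := (edist_ne_top_iff_reachable.1 hfin).exists_walk_length_eq_edist
  cases p with
  | nil => exact absurd rfl hne
  | cons h q =>
    refine ⟨_, h, ?_⟩
    rw [← hp, Walk.length_cons]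
    push_cast
    gcongr
    exact edist_le q

/-- Every admissible tuple then has length exactly `d(a,b) = ℓ`. With too few entries it has a step
that is not an edge, and the next vertex on a shortest path across that step can be inserted for
free. The new tuple is still geodesic, so its entries are distinct by `nodup_of_len_le`. -/
theorem refinable_of_le_edist (h : (ℓ : ℕ∞) ≤ G.edist a b) : Refinable G a b ℓ := by
  intro w hw hl
  have hlast : (a :: (w ++ [b])).getLast? = some b := by
    rw [← List.cons_append, List.getLast?_append]; simp
  have hlen : len G (a :: (w ++ [b])) = ℓ :=
    le_antisymm hw.2 (h.trans (edist_le_len hlast))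
  have hab : G.edist a b = ℓ := le_antisymm ((edist_le_len hlast).trans hw.2) h
  have hc : ¬ (a :: (w ++ [b])).IsChain G.Adj := by
    intro hc
    rw [len_add_one_of_isChain hc, Nat.cast_inj] at hlen
    simp at hlen
    omega
  rw [List.isChain_iff_forall_rel_of_append_cons_cons] at hc
  push Not at hc
  obtain ⟨x, y, l₁, l₂, heq, hxy⟩ := hc
  have hw1 := hw.1
  rw [heq] at hw1 hlen hlast
  have hne : x ≠ y := by
    rintro rfl
    rw [List.nodup_append] at hw1
    simp at hw1
  have hfin : G.edist x y ≠ ⊤ := by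
    have h1 : len G [x, y] ≤ len G (a :: (l₁ ++ x :: y :: l₂)) := by
      refine le_trans ?_ (len_cons_mono_of_sublist G (w := x :: y :: l₂) (by simp) a)
      refine le_trans ?_ (len_cons_mono_of_sublist G (w := [y]) (w' := y :: l₂) (by simp) x |>.trans
        (by simp [len]))
      exact le_rfl
    have h2 : len G (a :: (l₁ ++ x :: y :: l₂)) ≤ ℓ := by
      rw [← heq, len, edist_self, zero_add, heq, hlen]
    have h3 : G.edist x y ≤ ℓ := by simpa [len] using h1.trans h2
    exact (h3.trans_lt (ENat.natCast_lt_top ℓ)).ne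
  obtain ⟨z, hxz, hzy⟩ := exists_adj_edist_add_one hne hfin
  have h3 : G.edist x z + G.edist z y ≤ G.edist x y + 0 := by
    rw [edist_eq_one_iff_adj.2 hxz, add_zero, add_comm]
    exact hzy
  have hins : len G (l₁ ++ x :: z :: y :: l₂) ≤ ℓ :=
    (len_insert_le h3 l₁ l₂).trans (by rw [add_zero, hlen])
  have hzy' : z ≠ y := by
    rintro rfl
    exact hxy hxz
  refine exists_refinement heq ?_ hins
  obtain ⟨l, hl⟩ : ∃ l, l₁ ++ x :: z :: y :: l₂ = a :: l := by
    cases l₁ with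
    | nil => exact ⟨z :: y :: l₂, by simp at heq; simp [heq.1]⟩
    | cons p l₁ => exact ⟨l₁ ++ x :: z :: y :: l₂, by simp at heq; simp [heq.1]⟩
  have hchain : (l₁ ++ x :: z :: y :: l₂).IsChain (· ≠ ·) := by
    have h1 : (l₁ ++ x :: y :: l₂).IsChain (· ≠ ·) := List.Pairwise.isChain hw1
    have h2 := List.isChain_split.1 h1
    rw [List.isChain_split]
    refine ⟨h2.1, ?_⟩
    rw [List.isChain_cons_cons, List.isChain_cons_cons]
    exact ⟨hxz.ne, hzy', (List.isChain_cons_cons.1 h2.2).2⟩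
  have hlast' : (l₁ ++ x :: z :: y :: l₂).getLast? = some b := by
    rw [List.getLast?_append] at hlast ⊢
    simpa using hlast
  rw [hl] at hins hchain hlast' ⊢
  exact nodup_of_len_le hlast' (by rwa [hab]) (by rw [hab]; exact ENat.natCast_ne_top ℓ) hchain

end Refinement

/-! ### Isolated paths as an obstruction to shellability. -/

section Isolated

variable {V : Type*} {G : SimpleGraph V} {a b : V} {ℓ : ℕ}

/-- Each step between distinct vertices has length at least one, so a total equal to the number of
steps forces every step to be an edge. -/
lemma isChain_of_len_le {x : V} {w : List V} (hnd : (x :: w).Nodup)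
    (h : len G (x :: w) ≤ w.length) : (x :: w).IsChain G.Adj := by
  induction w generalizing x with
  | nil => simp
  | cons y w ih =>
    have hne : x ≠ y := by rintro rfl; simp at hnd
    have hnd' := (List.nodup_cons.1 hnd).2
    have h1 : 1 ≤ G.edist x y := by
      rw [Order.one_le_iff_ne_zero]
      simpa using hne
    have h2 : (w.length : ℕ∞) ≤ len G (y :: w) := by
      have := length_le_len G hnd'
      rw [List.length_cons, Nat.cast_add, Nat.cast_one] at this
      exact (ENat.add_le_add_iff_right ENat.one_ne_top).1 this
    rw [len, List.length_cons, Nat.cast_add, Nat.cast_one] at h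
    rw [List.isChain_cons_cons]
    constructor
    · rw [← edist_eq_one_iff_adj]
      refine le_antisymm ?_ h1
      have : G.edist x y + w.length ≤ 1 + w.length := by
        rw [add_comm 1]
        exact (add_le_add_right h2 _).trans h
      exact (ENat.add_le_add_iff_right (ENat.natCast_ne_top _)).1 this
    · refine ih hnd' ?_
      have : 1 + len G (y :: w) ≤ 1 + w.length := by
        rw [add_comm 1 (w.length : ℕ∞)]
        exact (add_le_add_left h1 _).trans h
      exact (ENat.add_le_add_iff_left ENat.one_ne_top).1 this

/-- The path `x 0, …, x ℓ` cannot be modified at a single vertex. -/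
structure IsIsolatedPath (G : SimpleGraph V) (ℓ : ℕ) (x : ℕ → V) : Prop where
  adj : ∀ i < ℓ, G.Adj (x i) (x (i + 1))
  not_adj : ∀ i, i + 2 ≤ ℓ → ¬ G.Adj (x i) (x (i + 2))
  not_adj_of_ne : ∀ y, (∀ i ≤ ℓ, y ≠ x i) → ∀ i, i + 2 ≤ ℓ → ¬ (G.Adj y (x i) ∧ G.Adj y (x (i + 2)))

/-- The interior vertices of the path `x 0, …, x ℓ`. -/
def interior (ℓ : ℕ) (x : ℕ → V) : List V := (List.range (ℓ - 1)).map fun i => x (i + 1)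

lemma cons_interior (hℓ : 1 ≤ ℓ) {x : ℕ → V} (h0 : x 0 = a) (h1 : x ℓ = b) :
    a :: (interior ℓ x ++ [b]) = (List.range (ℓ + 1)).map x := by
  rw [List.range_succ, List.map_append, List.map_singleton, h1, ← List.cons_append]
  congr 1
  obtain ⟨m, rfl⟩ : ∃ m, ℓ = m + 1 := ⟨ℓ - 1, by omega⟩
  rw [List.range_succ_eq_map, List.map_cons, h0, List.map_map]
  rfl

lemma isChain_map_range {x : ℕ → V} (h : ∀ i < ℓ, G.Adj (x i) (x (i + 1))) :
    ((List.range (ℓ + 1)).map x).IsChain G.Adj := by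
  rw [List.isChain_iff_getElem]
  intro i hi
  simp at hi
  simpa using h i hi

lemma IsIsolatedPath.isFacet {x : ℕ → V} (h : IsIsolatedPath G ℓ x) (hℓ : 2 ≤ ℓ)
    (h0 : x 0 = a) (h1 : x ℓ = b) (hinj : Set.InjOn x (Set.Iic ℓ)) :
    IsFacet (ET G a b ℓ) (interior ℓ x) := by
  have hc := cons_interior (by omega) h0 h1
  have hmem : interior ℓ x ∈ augmentedET G a b ℓ := by
    constructor
    · rw [hc]
      refine List.Nodup.map_on (fun i hi j hj hij => hinj ?_ ?_ hij) List.nodup_range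
      · simpa [Nat.lt_succ_iff] using hi
      · simpa [Nat.lt_succ_iff] using hj
    · rw [len_add_one_of_isChain (G := G)]
      · simp [interior]
        exact_mod_cast (by omega : ℓ - 1 + 1 ≤ ℓ)
      · rw [hc]
        exact isChain_map_range h.adj
  refine ⟨⟨?_, hmem⟩, fun w hw hs => ?_⟩
  · intro h
    have := congrArg List.length h
    simp [interior] at this
    omega
  · have := length_lt_of_mem_augmentedET hw.2
    refine (hs.eq_of_length_le ?_).symm
    simp [interior]
    omega

/-- A facet containing a codimension-one face of the isolated path also has `ℓ - 1` entries, so it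
comes from an edge path with `ℓ` edges. The two paths agree after one vertex is deleted from each,
and comparing the deleted positions contradicts isolation unless they coincide. -/
lemma IsIsolatedPath.eq_of_sublist {x : ℕ → V} (h : IsIsolatedPath G ℓ x) (hℓ : 2 ≤ ℓ)
    (h0 : x 0 = a) (h1 : x ℓ = b) (hinj : Set.InjOn x (Set.Iic ℓ)) {R F : List V}
    (hF : IsFacet (ET G a b ℓ) F) (hR : R.Sublist (interior ℓ x))
    (hRl : R.length + 1 = (interior ℓ x).length) (hRF : R.Sublist F) : F = interior ℓ x := by
  classical
  have hI := h.isFacet hℓ h0 h1 hinj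
  have hIl : (interior ℓ x).length = ℓ - 1 := by simp [interior]
  have hFl := length_lt_of_mem_augmentedET hF.1.2
  have hRF' : R.length + 1 = F.length := by
    have h2 := hRF.length_le
    by_contra hne
    have h3 : F = R := (hRF.eq_of_length (by omega)).symm
    have h4 := hF.2 _ hI.1 (h3 ▸ hR)
    rw [h4, h3] at hRl
    omega
  have hnd : ∀ w ∈ ET G a b ℓ, w.Nodup := fun w hw =>
    hw.2.1.sublist ((List.sublist_append_left w [b]).trans (List.sublist_cons_self _ _))
  have herase : ∀ w ∈ ET G a b ℓ, R.Sublist w → R.length + 1 = w.length →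
      ∃ i < w.length, R = w.eraseIdx i := by
    intro w hw hs hl
    obtain ⟨v, hv, rfl⟩ := exists_eq_erase_of_sublist (hnd w hw) hs hl
    obtain ⟨i, hi, rfl⟩ := List.getElem_of_mem hv
    exact ⟨i, hi, (hnd w hw).erase_getElem i hi⟩
  obtain ⟨i, hi, hRi⟩ := herase _ hI.1 hR hRl
  obtain ⟨j, hj, hRj⟩ := herase _ hF.1 hRF hRF'
  set P := a :: (F ++ [b]) with hP
  have hPl : P.length = ℓ + 1 := by simp [hP]; omega
  -- The default value is never used: only the indices `k ≤ ℓ` matter, and `P` has `ℓ + 1` entries.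
  set x' : ℕ → V := fun k => P.getD k a with hx'
  have hPx' : ∀ k ≤ ℓ, P[k]? = some (x' k) := by
    intro k hk
    simp only [hx', List.getD_eq_getElem?_getD]
    rw [List.getElem?_eq_getElem (by omega)]
    rfl
  have hcI := cons_interior (by omega) h0 h1
  have hQx : ∀ k ≤ ℓ, (a :: (interior ℓ x ++ [b]))[k]? = some (x k) := by
    intro k hk
    rw [hcI, List.getElem?_map, List.getElem?_range (by omega)]
    rfl
  have heq : (a :: (interior ℓ x ++ [b])).eraseIdx (i + 1) = P.eraseIdx (j + 1) := by
    rw [hP, List.eraseIdx_cons_succ, List.eraseIdx_cons_succ, List.eraseIdx_append_of_lt_length hi,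
      List.eraseIdx_append_of_lt_length hj, ← hRi, ← hRj]
  have hk : ∀ k < ℓ, x (if k < i + 1 then k else k + 1) = x' (if k < j + 1 then k else k + 1) := by
    intro k hk
    have h2 := congrArg (fun l : List V => l[k]?) heq
    simp only [List.getElem?_eraseIdx] at h2
    rw [← Option.some_inj, ← hQx _ (by split_ifs <;> omega), ← hPx' _ (by split_ifs <;> omega)]
    split_ifs at h2 ⊢ <;> exact h2
  have hadj' : ∀ k < ℓ, G.Adj (x' k) (x' (k + 1)) := by
    have hch : P.IsChain G.Adj := by
      refine isChain_of_len_le hF.1.2.1 (hF.1.2.2.trans ?_)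
      simp
      exact_mod_cast (by omega : ℓ ≤ F.length + 1)
    intro k hk
    have h2 := List.isChain_iff_getElem.1 hch k (by omega)
    have e1 := hPx' k (by omega)
    have e2 := hPx' (k + 1) (by omega)
    rw [List.getElem?_eq_getElem (by omega), Option.some_inj] at e1 e2
    rwa [e1, e2] at h2
  have hinj' : ∀ k ≤ ℓ, ∀ k' ≤ ℓ, x' k = x' k' → k = k' := by
    intro k hk k' hk' he
    refine (List.getElem?_inj (by omega : k < P.length) hF.1.2.1).1 ?_
    rw [hPx' k hk, hPx' k' hk', he]
  rw [hIl] at hi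
  -- If the deleted positions differ, the neighbours `x i` and `x (i + 2)` of the deleted vertex are
  -- consecutive in the other path, which gives a forbidden chord. If they are equal, either the
  -- replaced vertices coincide or the other one is a forbidden common neighbour.
  rcases lt_trichotomy i j with hij | rfl | hij
  · exfalso
    have e1 := hk i (by omega)
    have e2 := hk (i + 1) (by omega)
    rw [if_pos (by omega), if_pos (by omega)] at e1
    rw [if_neg (by omega), if_pos (by omega)] at e2
    refine h.not_adj i (by omega) ?_
    rw [e1, e2]
    exact hadj' i (by omega)
  · have hagree : ∀ k ≤ ℓ, k ≠ i + 1 → x k = x' k := by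
      intro k hkl hne
      rcases lt_or_gt_of_ne hne with hlt | hgt
      · have := hk k (by omega)
        rwa [if_pos hlt] at this
      · have := hk (k - 1) (by omega)
        rwa [if_neg (by omega), Nat.sub_add_cancel (by omega)] at this
    by_cases hy : x' (i + 1) = x (i + 1)
    · have hall : ∀ k ≤ ℓ, x k = x' k := by
        intro k hkl
        by_cases h2 : k = i + 1
        · rw [h2, hy]
        · exact hagree k hkl h2
      have hPQ : P = a :: (interior ℓ x ++ [b]) := by
        refine List.ext_getElem? fun k => ?_
        by_cases hkl : k ≤ ℓ
        · rw [hPx' k hkl, hQx k hkl, hall k hkl]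
        · rw [List.getElem?_eq_none (by omega), List.getElem?_eq_none (by simp [hIl]; omega)]
      rw [hP, List.cons.injEq] at hPQ
      exact List.append_cancel_right hPQ.2
    · exfalso
      refine h.not_adj_of_ne (x' (i + 1)) (fun k hkl he => ?_) i (by omega) ⟨?_, ?_⟩
      · by_cases h2 : k = i + 1
        · exact hy (h2 ▸ he)
        · rw [hagree k hkl h2] at he
          exact h2 (hinj' _ (by omega) _ hkl he).symm
      · rw [hagree i (by omega) (by omega)]
        exact (hadj' i (by omega)).symm
      · rw [hagree (i + 2) (by omega) (by omega)]
        exact hadj' (i + 1) (by omega)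
  · exfalso
    have e1 := hk i (by omega)
    have e2 := hk (i + 1) (by omega)
    rw [if_pos (by omega), if_neg (by omega)] at e1
    rw [if_neg (by omega), if_neg (by omega)] at e2
    refine h.not_adj i (by omega) ?_
    rw [e1, e2]
    exact hadj' (i + 1) (by omega)

/-- In a shelling, every facet but the first shares a codimension-one face with an earlier facet. An
isolated path shares none, so it must have index zero, and there is room for only one. -/
theorem not_shellable_of_isIsolatedPath {x y : ℕ → V} (hx : IsIsolatedPath G ℓ x)
    (hy : IsIsolatedPath G ℓ y) (hℓ : 2 ≤ ℓ) (hx0 : x 0 = a) (hx1 : x ℓ = b)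
    (hxi : Set.InjOn x (Set.Iic ℓ)) (hy0 : y 0 = a) (hy1 : y ℓ = b)
    (hyi : Set.InjOn y (Set.Iic ℓ)) (hne : interior ℓ x ≠ interior ℓ y) :
    ¬ Shellable (ET G a b ℓ) := by
  rintro ⟨L, hLn, hLF, hsh⟩
  have key : ∀ (z : ℕ → V), IsIsolatedPath G ℓ z → z 0 = a → z ℓ = b →
      Set.InjOn z (Set.Iic ℓ) → ∀ (k : ℕ) (hk : k < L.length), L[k] = interior ℓ z → k = 0 := by
    intro z hz h0 h1 hi k hk hkz
    by_contra hk0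
    obtain ⟨S, ⟨R, hR⟩, hS1, hS2⟩ := hsh k hk (Nat.pos_of_ne_zero hk0)
    obtain ⟨hRF, hRl⟩ := hS1 R hR
    have : R ∈ face L[k] ∩ ⋃ i : Fin k, face L[i] := by
      rw [hS2]
      exact Set.mem_biUnion hR (List.Sublist.refl R)
    obtain ⟨i, hi'⟩ := Set.mem_iUnion.1 this.2
    rw [hkz] at hRF hRl
    have hF := hz.eq_of_sublist hℓ h0 h1 hi ((hLF L[i]).1 (List.getElem_mem _)) hRF hRl hi'
    rw [← hkz] at hF
    have := (hLn.getElem_inj_iff).1 hF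
    have := i.2
    omega
  obtain ⟨i, hi, hix⟩ := List.getElem_of_mem ((hLF _).2 (hx.isFacet hℓ hx0 hx1 hxi))
  obtain ⟨j, hj, hjy⟩ := List.getElem_of_mem ((hLF _).2 (hy.isFacet hℓ hy0 hy1 hyi))
  have h1 := key x hx hx0 hx1 hxi i hi hix
  have h2 := key y hy hy0 hy1 hyi j hj hjy
  subst h1 h2
  exact hne (hix.symm.trans hjy)

end Isolated

/-! ### Independence of edges in the random graph. -/

section RandomGraph

open ProbabilityTheory

variable {n : ℕ} (p : unitInterval)

instance : DiscreteMeasurableSpace (SimpleGraph (Fin n)) := by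
  have : MeasurableSingletonClass (SimpleGraph (Fin n)) := by
    refine ⟨fun G => ?_⟩
    have : ({G} : Set (SimpleGraph (Fin n))) = edgeSet ⁻¹' {G.edgeSet} := by
      ext H
      simp
    rw [this]
    exact measurableEmbedding_edgeSet.measurable (Set.toFinite _).measurableSet
  infer_instance

lemma iIndepFun_mem_edgeSet :
    iIndepFun (fun (e : Sym2 (Fin n)) (G : SimpleGraph (Fin n)) => (e ∈ G.edgeSet : Prop))
      (binomialRandom (Fin n) p) := by
  set ν : Sym2 (Fin n) → Measure Prop := fun i =>
    unitInterval.toNNReal p • Measure.dirac (i ∈ (Sym2.diagSetᶜ : Set (Sym2 (Fin n)))) +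
      unitInterval.toNNReal (unitInterval.symm p) • Measure.dirac False with hν
  -- Diagonal pairs are coordinates of the product measure, but `fromEdgeSet` discards them; hence
  -- the extra condition.
  have h0 : iIndepFun (fun (e : Sym2 (Fin n)) (ω : Sym2 (Fin n) → Prop) => (ω e ∧ ¬ e.IsDiag : Prop))
      (Measure.infinitePi ν) :=
    iIndepFun_infinitePi (X := fun (e : Sym2 (Fin n)) (q : Prop) => (q ∧ ¬ e.IsDiag : Prop))
      (fun i => .of_discrete)
  have hm1 : Measurable fun ω : Sym2 (Fin n) → Prop => {i | ω i} :=
    MeasurableEquiv.setOfPred.measurable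
  have hmap : binomialRandom (Fin n) p =
      (Measure.infinitePi ν).map fun ω => fromEdgeSet {i | ω i} := by
    rw [binomialRandom_eq_map, setBernoulli_eq_map, Measure.map_map measurable_fromEdgeSet hm1]
    rfl
  have hm : Measurable fun ω : Sym2 (Fin n) → Prop => fromEdgeSet {i | ω i} :=
    measurable_fromEdgeSet.comp hm1
  rw [iIndepFun_iff_measure_inter_preimage_eq_mul] at h0 ⊢
  intro S sets hS
  have key : ∀ (e : Sym2 (Fin n)) (s : Set Prop), (fun ω : Sym2 (Fin n) → Prop =>
      fromEdgeSet {i | ω i}) ⁻¹' ((fun G : SimpleGraph (Fin n) => (e ∈ G.edgeSet : Prop)) ⁻¹' s) =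
      (fun ω : Sym2 (Fin n) → Prop => (ω e ∧ ¬ e.IsDiag : Prop)) ⁻¹' s := by
    intro e s
    ext ω
    simp
  rw [hmap, Measure.map_apply hm .of_discrete, Set.preimage_iInter₂]
  simp_rw [key]
  rw [h0 S hS]
  refine Finset.prod_congr rfl fun e _ => ?_
  rw [Measure.map_apply hm .of_discrete, key]

lemma binomialRandom_real_mem_edgeSet {e : Sym2 (Fin n)} (he : ¬ e.IsDiag) :
    (binomialRandom (Fin n) p).real {G | e ∈ G.edgeSet} = p := by
  have hm1 : Measurable fun ω : Sym2 (Fin n) → Prop => {i | ω i} :=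
    MeasurableEquiv.setOfPred.measurable
  have hs : {ω : Sym2 (Fin n) → Prop | ω e} = (({e} : Finset (Sym2 (Fin n))) : Set _).pi
      fun _ => {q : Prop | q} := by
    ext ω; simp
  have hset : (fun ω : Sym2 (Fin n) → Prop => {i | ω i}) ⁻¹' (fromEdgeSet ⁻¹'
      {G : SimpleGraph (Fin n) | e ∈ G.edgeSet}) = {ω : Sym2 (Fin n) → Prop | ω e} := by
    ext ω
    simp [he]
  rw [measureReal_def, binomialRandom_eq_map, Measure.map_apply measurable_fromEdgeSet .of_discrete,
    setBernoulli_eq_map, Measure.map_apply hm1 (measurable_fromEdgeSet .of_discrete), hset, hs,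
    Measure.infinitePi_pi _ (fun _ _ => .of_discrete)]
  simp [he]

/-- The event `B` only depends on which elements of `S` are edges. -/
def DeterminedBy (B : Set (SimpleGraph (Fin n))) (S : Finset (Sym2 (Fin n))) : Prop :=
  ∀ G H : SimpleGraph (Fin n), (∀ e ∈ S, e ∈ G.edgeSet ↔ e ∈ H.edgeSet) → G ∈ B → H ∈ B

variable {p}

/-- An event determined by `S` is the preimage of its own image under the map recording the pairs of
`S`, so independence of the two families of coordinates applies. -/
lemma DeterminedBy.real_inter {B C : Set (SimpleGraph (Fin n))} {S T : Finset (Sym2 (Fin n))}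
    (hB : DeterminedBy B S) (hC : DeterminedBy C T) (hST : Disjoint S T) :
    (binomialRandom (Fin n) p).real (B ∩ C) =
      (binomialRandom (Fin n) p).real B * (binomialRandom (Fin n) p).real C := by
  have h := (iIndepFun_mem_edgeSet (n := n) p).indepFun_finset S T hST (fun _ => .of_discrete)
  have key : ∀ {B : Set (SimpleGraph (Fin n))} {S : Finset (Sym2 (Fin n))}, DeterminedBy B S →
      (fun (G : SimpleGraph (Fin n)) (e : S) => ((e : Sym2 (Fin n)) ∈ G.edgeSet : Prop)) ⁻¹'
        ((fun (G : SimpleGraph (Fin n)) (e : S) => ((e : Sym2 (Fin n)) ∈ G.edgeSet : Prop)) '' B) =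
        B := by
    intro B S hB
    refine Set.Subset.antisymm ?_ (Set.subset_preimage_image _ _)
    rintro H ⟨G, hG, hGH⟩
    exact hB G H (fun e he => (congrFun hGH ⟨e, he⟩).to_iff) hG
  have h2 := h.measure_inter_preimage_eq_mul
    ((fun (G : SimpleGraph (Fin n)) (e : S) => ((e : Sym2 (Fin n)) ∈ G.edgeSet : Prop)) '' B)
    ((fun (G : SimpleGraph (Fin n)) (e : T) => ((e : Sym2 (Fin n)) ∈ G.edgeSet : Prop)) '' C)
    (Set.toFinite _).measurableSet (Set.toFinite _).measurableSet
  rw [key hB, key hC] at h2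
  rw [measureReal_def, h2, ENNReal.toReal_mul]
  rfl

lemma DeterminedBy.mono {B : Set (SimpleGraph (Fin n))} {S T : Finset (Sym2 (Fin n))}
    (hB : DeterminedBy B S) (h : S ⊆ T) : DeterminedBy B T :=
  fun G H hGH => hB G H fun e he => hGH e (h he)

lemma DeterminedBy.inter {B C : Set (SimpleGraph (Fin n))} {S : Finset (Sym2 (Fin n))}
    (hB : DeterminedBy B S) (hC : DeterminedBy C S) : DeterminedBy (B ∩ C) S :=
  fun G H hGH h => ⟨hB G H hGH h.1, hC G H hGH h.2⟩

lemma DeterminedBy.biInter {ι : Type*} {I : Finset ι} {B : ι → Set (SimpleGraph (Fin n))}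
    {S : Finset (Sym2 (Fin n))} (hB : ∀ i ∈ I, DeterminedBy (B i) S) :
    DeterminedBy (⋂ i ∈ I, B i) S := by
  intro G H hGH h
  rw [Set.mem_iInter₂] at h ⊢
  exact fun i hi => hB i hi G H hGH (h i hi)

lemma DeterminedBy.real_biInter {ι : Type*} [DecidableEq ι] {I : Finset ι}
    {B : ι → Set (SimpleGraph (Fin n))} {S : ι → Finset (Sym2 (Fin n))}
    (hB : ∀ i ∈ I, DeterminedBy (B i) (S i))
    (hS : ∀ i ∈ I, ∀ j ∈ I, i ≠ j → Disjoint (S i) (S j)) :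
    (binomialRandom (Fin n) p).real (⋂ i ∈ I, B i) =
      ∏ i ∈ I, (binomialRandom (Fin n) p).real (B i) := by
  classical
  induction I using Finset.induction_on with
  | empty => simp
  | insert i I hi ih =>
    have h1 : DeterminedBy (⋂ j ∈ I, B j) (I.biUnion S) :=
      .biInter fun j hj => (hB j (Finset.mem_insert_of_mem hj)).mono
        (Finset.subset_biUnion_of_mem S hj)
    have h2 : Disjoint (S i) (I.biUnion S) := by
      rw [Finset.disjoint_biUnion_right]
      exact fun j hj => hS i (Finset.mem_insert_self i I) j (Finset.mem_insert_of_mem hj)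
        (by rintro rfl; exact hi hj)
    rw [Finset.set_biInter_insert, (hB i (Finset.mem_insert_self i I)).real_inter h1 h2,
      Finset.prod_insert hi, ih (fun j hj => hB j (Finset.mem_insert_of_mem hj))
        fun j hj k hk => hS j (Finset.mem_insert_of_mem hj) k (Finset.mem_insert_of_mem hk)]

lemma determinedBy_mem_edgeSet (e : Sym2 (Fin n)) : DeterminedBy {G | e ∈ G.edgeSet} {e} :=
  fun _ _ hGH h => (hGH e (Finset.mem_singleton_self e)).1 h

lemma determinedBy_subset_edgeSet (E : Finset (Sym2 (Fin n))) :
    DeterminedBy {G | (E : Set (Sym2 (Fin n))) ⊆ G.edgeSet} E :=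
  fun _ _ hGH h e he => (hGH e he).1 (h he)

lemma binomialRandom_real_subset_edgeSet {E : Finset (Sym2 (Fin n))} (hE : ∀ e ∈ E, ¬ e.IsDiag) :
    (binomialRandom (Fin n) p).real {G | (E : Set (Sym2 (Fin n))) ⊆ G.edgeSet} = (p : ℝ) ^ E.card := by
  classical
  have h : {G : SimpleGraph (Fin n) | (E : Set (Sym2 (Fin n))) ⊆ G.edgeSet} =
      ⋂ e ∈ E, {G | e ∈ G.edgeSet} := by
    ext G
    simp [Set.subset_def]
  rw [h, DeterminedBy.real_biInter (fun e _ => determinedBy_mem_edgeSet e)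
    fun e _ f _ hef => by simpa using hef,
    Finset.prod_congr rfl fun e he => binomialRandom_real_mem_edgeSet p (hE e he)]
  simp

end RandomGraph

/-! ### First moment bounds for short paths and for missing common neighbours. -/

section FirstMoment

variable {n : ℕ} {p : unitInterval}

/-- The path from `a` to `b` with the `K` interior vertices `f`. -/
def pathVertex {V : Type*} (a b : V) {K : ℕ} (f : Fin K → V) (i : ℕ) : V :=
  if i = 0 then a else if h : i - 1 < K then f ⟨i - 1, h⟩ else b

lemma pathVertex_zero {V : Type*} (a b : V) {K : ℕ} (f : Fin K → V) : pathVertex a b f 0 = a := by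
  simp [pathVertex]

lemma pathVertex_succ {V : Type*} (a b : V) {K : ℕ} (f : Fin K → V) (i : Fin K) :
    pathVertex a b f (i + 1) = f i := by
  simp [pathVertex]

lemma pathVertex_last {V : Type*} (a b : V) {K : ℕ} (f : Fin K → V) :
    pathVertex a b f (K + 1) = b := by
  simp [pathVertex]

/-- The edges of the path `x 0, …, x ℓ`. -/
def pathEdges {V : Type*} [DecidableEq V] (ℓ : ℕ) (x : ℕ → V) : Finset (Sym2 V) :=
  (Finset.range ℓ).image fun i => s(x i, x (i + 1))

lemma pathEdges_subset_edgeSet_iff {V : Type*} [DecidableEq V] {G : SimpleGraph V} {ℓ : ℕ}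
    {x : ℕ → V} :
    (pathEdges ℓ x : Set (Sym2 V)) ⊆ G.edgeSet ↔ ∀ i < ℓ, G.Adj (x i) (x (i + 1)) := by
  simp [pathEdges, Set.subset_def]

lemma not_isDiag_of_mem_pathEdges {V : Type*} [DecidableEq V] {ℓ : ℕ} {x : ℕ → V}
    (hx : Set.InjOn x (Set.Iic ℓ)) : ∀ e ∈ pathEdges ℓ x, ¬ e.IsDiag := by
  intro e he
  obtain ⟨i, hi, rfl⟩ := Finset.mem_image.1 he
  rw [Finset.mem_range] at hi
  rw [Sym2.mk_isDiag_iff]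
  intro h
  have := hx (Set.mem_Iic.2 hi.le) (Set.mem_Iic.2 hi) h
  omega

lemma card_pathEdges {V : Type*} [DecidableEq V] {ℓ : ℕ} {x : ℕ → V}
    (hx : Set.InjOn x (Set.Iic ℓ)) : (pathEdges ℓ x).card = ℓ := by
  rw [pathEdges, Finset.card_image_of_injOn, Finset.card_range]
  intro i hi j hj hij
  simp only [Finset.coe_range, Set.mem_Iio] at hi hj
  rcases Sym2.eq_iff.1 hij with ⟨h, -⟩ | ⟨h1, h2⟩
  · exact hx (Set.mem_Iic.2 hi.le) (Set.mem_Iic.2 hj.le) h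
  · have e1 := hx (Set.mem_Iic.2 hi.le) (Set.mem_Iic.2 hj) h1
    have e2 := hx (Set.mem_Iic.2 hi) (Set.mem_Iic.2 hj.le) h2
    omega

lemma exists_pathEdges_subset {a b : Fin n} (hab : a ≠ b) {ℓ : ℕ} {G : SimpleGraph (Fin n)}
    (h : ¬ (ℓ : ℕ∞) ≤ G.edist a b) :
    ∃ K < ℓ - 1, ∃ f : Fin K → Fin n, Set.InjOn (pathVertex a b f) (Set.Iic (K + 1)) ∧
      (pathEdges (K + 1) (pathVertex a b f) : Set (Sym2 (Fin n))) ⊆ G.edgeSet := by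
  rw [not_le] at h
  have hr := edist_ne_top_iff_reachable.1 (h.trans_le le_top).ne
  obtain ⟨q, hq, hlen⟩ := hr.exists_path_of_dist
  have hd : q.length < ℓ := by
    rw [← hr.coe_dist_eq_edist, ← hlen] at h
    exact_mod_cast h
  have hpos : 0 < q.length := by
    rw [Nat.pos_iff_ne_zero]
    exact fun h0 => hab (Walk.eq_of_length_eq_zero h0)
  obtain ⟨K, hK⟩ : ∃ K, q.length = K + 1 := ⟨q.length - 1, by omega⟩
  set f : Fin K → Fin n := fun i => q.getVert (i + 1) with hf
  have hx : ∀ i ≤ K + 1, pathVertex a b f i = q.getVert i := by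
    intro i hi
    rcases i with - | i
    · simp [pathVertex]
    · by_cases h : i < K
      · simp [pathVertex, h, hf]
      · have : i = K := by omega
        subst this
        rw [pathVertex_last, ← hK, Walk.getVert_length]
  refine ⟨K, by omega, f, ?_, ?_⟩
  · intro i hi j hj hij
    rw [hx i hi, hx j hj] at hij
    exact hq.getVert_injOn (by simpa [hK] using hi) (by simpa [hK] using hj) hij
  · rw [pathEdges_subset_edgeSet_iff]
    intro i hi
    rw [hx i hi.le, hx (i + 1) hi]
    exact q.adj_getVert_succ (by omega)

/-- A union bound over paths with `K` interior vertices: at most `n ^ K` choices, each needing `K +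
1` edges. -/
lemma real_edist_lt_le {a b : Fin n} (hab : a ≠ b) (ℓ : ℕ) :
    (binomialRandom (Fin n) p).real {G | ¬ (ℓ : ℕ∞) ≤ G.edist a b} ≤
      ∑ K ∈ Finset.range (ℓ - 1), (n : ℝ) ^ K * (p : ℝ) ^ (K + 1) := by
  classical
  set I : ℕ → Finset (Σ K : ℕ, Fin K → Fin n) := fun L => (Finset.range L).sigma fun _ => Finset.univ
  have hsub : {G : SimpleGraph (Fin n) | ¬ (ℓ : ℕ∞) ≤ G.edist a b} ⊆
      ⋃ i ∈ I (ℓ - 1), {G | Set.InjOn (pathVertex a b i.2) (Set.Iic (i.1 + 1)) ∧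
        (pathEdges (i.1 + 1) (pathVertex a b i.2) : Set (Sym2 (Fin n))) ⊆ G.edgeSet} := by
    intro G hG
    obtain ⟨K, hK, f, h1, h2⟩ := exists_pathEdges_subset hab hG
    refine Set.mem_iUnion₂.2 ⟨⟨K, f⟩, ?_, h1, h2⟩
    exact Finset.mem_sigma.2 ⟨Finset.mem_range.2 hK, Finset.mem_univ _⟩
  refine (measureReal_mono hsub (measure_ne_top _ _)).trans ((measureReal_biUnion_finset_le _ _).trans ?_)
  rw [Finset.sum_sigma]
  refine Finset.sum_le_sum fun K _ => ?_
  calc _ ≤ ∑ _f : Fin K → Fin n, (p : ℝ) ^ (K + 1) := by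
        refine Finset.sum_le_sum fun f _ => ?_
        by_cases hinj : Set.InjOn (pathVertex a b f) (Set.Iic (K + 1))
        · simp only [hinj, true_and]
          rw [binomialRandom_real_subset_edgeSet (not_isDiag_of_mem_pathEdges hinj),
            card_pathEdges hinj]
        · simp only [hinj, false_and, Set.ofPred_false, measureReal_empty]
          exact pow_nonneg p.2.1 _
    _ = _ := by simp

lemma DeterminedBy.not {B : SimpleGraph (Fin n) → Prop} {S : Finset (Sym2 (Fin n))}
    (hB : DeterminedBy {G | B G} S) : DeterminedBy {G | ¬ B G} S :=
  fun G H hGH h h' => h (hB H G (fun e he => (hGH e he).symm) h')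

lemma determinedBy_adj {x y : Fin n} {S : Finset (Sym2 (Fin n))} (h : s(x, y) ∈ S) :
    DeterminedBy {G | G.Adj x y} S :=
  fun _ _ hGH h' => (hGH _ h).1 h'

lemma real_not {B : SimpleGraph (Fin n) → Prop} :
    (binomialRandom (Fin n) p).real {G | ¬ B G} = 1 - (binomialRandom (Fin n) p).real {G | B G} :=
  probReal_compl_eq_one_sub (s := {G | B G}) .of_discrete

lemma real_adj_and_adj {x y z : Fin n} (hxy : x ≠ y) (hzx : z ≠ x) (hzy : z ≠ y) :
    (binomialRandom (Fin n) p).real {G | G.Adj z x ∧ G.Adj z y} = (p : ℝ) ^ 2 := by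
  classical
  have h : {G : SimpleGraph (Fin n) | G.Adj z x ∧ G.Adj z y} =
      {G | ((({s(z, x), s(z, y)} : Finset (Sym2 (Fin n))) : Set (Sym2 (Fin n)))) ⊆ G.edgeSet} := by
    ext G
    simp [Set.subset_def]
  have hne : s(z, x) ≠ s(z, y) := by
    rw [Ne, Sym2.congr_right]
    exact hxy
  rw [h, binomialRandom_real_subset_edgeSet, Finset.card_pair hne]
  intro e he
  rcases Finset.mem_insert.1 he with rfl | he
  · simpa using hzx
  · rw [Finset.mem_singleton.1 he]
    simpa using hzy

/-- A union bound over `x`, `y` and the avoided set, the latter listed by a map from `Fin L`, which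
gives the factor `n ^ (L + 2)`. The at least `n - (L + 2)` remaining vertices fail independently to
be common neighbours, each with probability `1 - p ^ 2`. -/
lemma real_not_common_neighbors_le (L : ℕ) :
    (binomialRandom (Fin n) p).real {G | ¬ ∀ x y : Fin n, x ≠ y → ∀ U : Finset (Fin n),
        U.card ≤ L → ∃ z ∉ U, G.Adj x z ∧ G.Adj z y} ≤
      (n : ℝ) ^ (L + 2) * (1 - (p : ℝ) ^ 2) ^ (n - (L + 2)) := by
  classical
  have hp0 : (0 : ℝ) ≤ p := p.2.1
  have hp1 : (p : ℝ) ^ 2 ≤ 1 := pow_le_one₀ hp0 p.2.2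
  set W : Fin n × Fin n × (Fin L → Fin n) → Finset (Fin n) := fun i =>
    Finset.univ \ (insert i.1 (insert i.2.1 (Finset.univ.image i.2.2))) with hW
  have hsub : {G : SimpleGraph (Fin n) | ¬ ∀ x y : Fin n, x ≠ y → ∀ U : Finset (Fin n),
        U.card ≤ L → ∃ z ∉ U, G.Adj x z ∧ G.Adj z y} ⊆
      ⋃ i ∈ (Finset.univ : Finset (Fin n × Fin n × (Fin L → Fin n))),
        {G | i.1 ≠ i.2.1 ∧ G ∈ ⋂ z ∈ W i, {G | ¬ (G.Adj z i.1 ∧ G.Adj z i.2.1)}} := by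
    intro G hG
    simp only [Set.mem_ofPred_eq] at hG
    push Not at hG
    obtain ⟨x, y, hxy, U, hU, h⟩ := hG
    -- Smaller sets `U` are padded with `x`, which is excluded anyway.
    refine Set.mem_iUnion₂.2 ⟨(x, y, fun i : Fin L => U.toList.getD i x), Finset.mem_univ _, hxy, ?_⟩
    rw [Set.mem_iInter₂]
    rintro z hz ⟨h1, h2⟩
    refine h z (fun hzU => ?_) h1.symm h2
    rw [hW, Finset.mem_sdiff] at hz
    refine hz.2 (Finset.mem_insert_of_mem (Finset.mem_insert_of_mem (Finset.mem_image.2 ?_)))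
    obtain ⟨i, hi, hiz⟩ := List.getElem_of_mem (Finset.mem_toList.2 hzU)
    have hi' : i < L := by rw [Finset.length_toList] at hi; omega
    refine ⟨⟨i, hi'⟩, Finset.mem_univ _, ?_⟩
    simp only [List.getD_eq_getElem?_getD]
    rw [List.getElem?_eq_getElem hi]
    exact hiz
  refine (measureReal_mono hsub (measure_ne_top _ _)).trans ((measureReal_biUnion_finset_le _ _).trans ?_)
  calc _ ≤ ∑ _i : Fin n × Fin n × (Fin L → Fin n), (1 - (p : ℝ) ^ 2) ^ (n - (L + 2)) := by
        refine Finset.sum_le_sum fun i _ => ?_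
        obtain ⟨x, y, u⟩ := i
        by_cases hxy : x = y
        · simp only [hxy, ne_eq, not_true_eq_false, false_and, Set.ofPred_false, measureReal_empty]
          exact pow_nonneg (by linarith) _
        simp only [ne_eq, hxy, not_false_eq_true, true_and, Set.ofPred_mem_eq]
        rw [DeterminedBy.real_biInter (S := fun z => {s(z, x), s(z, y)})]
        · have : ∀ z ∈ W (x, y, u),
              (binomialRandom (Fin n) p).real {G | ¬ (G.Adj z x ∧ G.Adj z y)} = 1 - (p : ℝ) ^ 2 := by
            intro z hz
            simp only [hW, Finset.mem_sdiff, Finset.mem_insert, not_or] at hz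
            rw [real_not, real_adj_and_adj hxy hz.2.1 hz.2.2.1]
          rw [Finset.prod_congr rfl this, Finset.prod_const]
          refine pow_le_pow_of_le_one (by linarith) (by nlinarith) ?_
          rw [hW, Finset.card_sdiff_of_subset (Finset.subset_univ _), Finset.card_univ,
            Fintype.card_fin]
          refine Nat.sub_le_sub_left ?_ _
          refine (Finset.card_insert_le _ _).trans (Nat.succ_le_succ ?_)
          refine (Finset.card_insert_le _ _).trans (Nat.succ_le_succ ?_)
          exact Finset.card_image_le.trans (by simp)
        · intro z _
          refine DeterminedBy.not ?_
          exact DeterminedBy.inter (determinedBy_adj (by simp)) (determinedBy_adj (by simp))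
        · intro z hz z' hz' hne
          simp only [hW, Finset.mem_sdiff, Finset.mem_insert, not_or] at hz hz'
          rw [Finset.disjoint_left]
          intro e he he'
          simp only [Finset.mem_insert, Finset.mem_singleton] at he he'
          have h1 : z ∈ e := by rcases he with rfl | rfl <;> simp
          rcases he' with rfl | rfl
          · rcases Sym2.mem_iff.1 h1 with h | h
            · exact hne h
            · exact hz.2.1 h
          · rcases Sym2.mem_iff.1 h1 with h | h
            · exact hne h
            · exact hz.2.2.1 h
    _ = _ := by
        simp only [Finset.sum_const, Finset.card_univ, Fintype.card_prod, Fintype.card_fun,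
          Fintype.card_fin, nsmul_eq_mul]
        push_cast
        ring

lemma tendsto_natCast_add_one : Tendsto (fun n : ℕ => ((n + 1 : ℕ) : ℝ)) atTop atTop :=
  tendsto_natCast_atTop_atTop.comp (tendsto_add_atTop_nat 1)

lemma coe_edgeProb {α : ℝ} (hα : 0 ≤ α) (n : ℕ) : (edgeProb α hα n : ℝ) = (n : ℝ) ^ (-α) := rfl

lemma tendsto_edist_bound {α : ℝ} (hα : 0 ≤ α) {ℓ : ℕ} (hℓ : 1 ≤ ℓ) (h : 1 - 1 / (ℓ : ℝ) ≤ α) :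
    Tendsto (fun n : ℕ => ∑ K ∈ Finset.range (ℓ - 1),
      ((n + 1 : ℕ) : ℝ) ^ K * (edgeProb α hα (n + 1) : ℝ) ^ (K + 1)) atTop (𝓝 0) := by
  have : ∀ K ∈ Finset.range (ℓ - 1), Tendsto (fun n : ℕ =>
      ((n + 1 : ℕ) : ℝ) ^ K * (edgeProb α hα (n + 1) : ℝ) ^ (K + 1)) atTop (𝓝 0) := by
    intro K hK
    have hK' : K + 1 < ℓ := by have := Finset.mem_range.1 hK; omega
    -- The general term is `n ^ (K - α (K + 1))`, and `K + 1 < ℓ` gives `α ≥ 1 - 1/ℓ > 1 - 1/(K +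
    -- 1)`.
    have hexp : 0 < α * (K + 1) - K := by
      have hl : (0 : ℝ) < ℓ := by exact_mod_cast hℓ
      have h1 : ((K : ℝ) + 1) < ℓ := by exact_mod_cast hK'
      have h2 : ((K : ℝ) + 1) / ℓ < 1 := by rwa [div_lt_one hl]
      have h3 : (1 - 1 / (ℓ : ℝ)) * (K + 1) ≤ α * (K + 1) := by gcongr
      have h4 : (1 - 1 / (ℓ : ℝ)) * (K + 1) = K + 1 - (K + 1) / ℓ := by ring
      linarith
    refine ((tendsto_rpow_neg_atTop hexp).comp tendsto_natCast_add_one).congr fun n => ?_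
    have hx : (0 : ℝ) < ((n + 1 : ℕ) : ℝ) := by positivity
    rw [coe_edgeProb, ← Real.rpow_natCast, ← Real.rpow_natCast, ← Real.rpow_mul hx.le,
      ← Real.rpow_add hx, Function.comp_apply]
    congr 1
    push_cast
    ring
  simpa using tendsto_finsetSum _ this

/-- With `x = n + 1` and `y = x ^ (1 - 2α)` the second factor is at most `exp(-y / 2)`, and the
polynomial factor is a power of `y`. -/
lemma tendsto_common_neighbors_bound {α : ℝ} (hα : 0 ≤ α) (h : α < 1 / 2) (L : ℕ) :
    Tendsto (fun n : ℕ => ((n + 1 : ℕ) : ℝ) ^ (L + 2) *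
      (1 - (edgeProb α hα (n + 1) : ℝ) ^ 2) ^ (n + 1 - (L + 2))) atTop (𝓝 0) := by
  have hε : 0 < 1 - 2 * α := by linarith
  set ε := 1 - 2 * α with hεdef
  have hmain : Tendsto (fun y : ℝ => y ^ ((L + 2 : ℝ) / ε) * Real.exp (-(1 / 2) * y)) atTop (𝓝 0) :=
    tendsto_rpow_mul_exp_neg_mul_atTop_nhds_zero _ _ (by norm_num)
  have hcomp := hmain.comp ((tendsto_rpow_atTop hε).comp tendsto_natCast_add_one)
  refine squeeze_zero' ?_ ?_ hcomp
  · filter_upwards with n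
    have hp1 : (edgeProb α hα (n + 1) : ℝ) ^ 2 ≤ 1 :=
      pow_le_one₀ (edgeProb α hα (n + 1)).2.1 (edgeProb α hα (n + 1)).2.2
    have : 0 ≤ 1 - (edgeProb α hα (n + 1) : ℝ) ^ 2 := by linarith
    positivity
  · filter_upwards [eventually_ge_atTop (2 * (L + 2))] with n hn
    set x : ℝ := ((n + 1 : ℕ) : ℝ) with hx
    have hx0 : 0 < x := by positivity
    have hp2 : (edgeProb α hα (n + 1) : ℝ) ^ 2 = x ^ (-(2 * α)) := by
      rw [coe_edgeProb, ← Real.rpow_natCast, ← Real.rpow_mul hx0.le]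
      congr 1
      push_cast
      ring
    have hp1 : (edgeProb α hα (n + 1) : ℝ) ^ 2 ≤ 1 :=
      pow_le_one₀ (edgeProb α hα (n + 1)).2.1 (edgeProb α hα (n + 1)).2.2
    simp only [Function.comp_apply]
    rw [← Real.rpow_mul hx0.le, mul_div_cancel₀ _ hε.ne']
    have e1 : x ^ (L + 2) = x ^ ((L + 2 : ℝ)) := by
      rw [← Real.rpow_natCast]; push_cast; rfl
    rw [e1]
    gcongr
    calc (1 - (edgeProb α hα (n + 1) : ℝ) ^ 2) ^ (n + 1 - (L + 2))
        ≤ (Real.exp (-(edgeProb α hα (n + 1) : ℝ) ^ 2)) ^ (n + 1 - (L + 2)) := by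
          gcongr
          have := Real.add_one_le_exp (-(edgeProb α hα (n + 1) : ℝ) ^ 2)
          linarith
      _ = Real.exp (-((n + 1 - (L + 2) : ℕ) * (edgeProb α hα (n + 1) : ℝ) ^ 2)) := by
          rw [← Real.exp_nat_mul]; ring_nf
      _ ≤ _ := by
          rw [Real.exp_le_exp, hp2]
          have h1 : x / 2 ≤ ((n + 1 - (L + 2) : ℕ) : ℝ) := by
            rw [div_le_iff₀ (by norm_num), hx]
            exact_mod_cast (by omega : n + 1 ≤ (n + 1 - (L + 2)) * 2)
          have h2 : x ^ ε = x * x ^ (-(2 * α)) := by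
            rw [hεdef, sub_eq_add_neg, Real.rpow_add hx0, Real.rpow_one]
          rw [h2]
          have h3 : 0 ≤ x ^ (-(2 * α)) := by positivity
          nlinarith

end FirstMoment

/-! ### Probabilities that one path or two paths are isolated. -/

section SecondMoment

variable {n : ℕ} {p : unitInterval}

/-- Pairs inside `W`, and the stars joining the various `y ∉ W` to `W`, are pairwise disjoint sets
of edges. -/
lemma real_inter_stars {W Y : Finset (Fin n)} (hWY : Disjoint W Y) {E : Finset (Sym2 (Fin n))}
    (hE : ∀ e ∈ E, ∀ v ∈ e, v ∈ W) {B : Set (SimpleGraph (Fin n))}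
    {C : Fin n → Set (SimpleGraph (Fin n))} (hB : DeterminedBy B E)
    (hC : ∀ y ∈ Y, DeterminedBy (C y) (W.image fun w => s(y, w))) :
    (binomialRandom (Fin n) p).real (B ∩ ⋂ y ∈ Y, C y) =
      (binomialRandom (Fin n) p).real B * ∏ y ∈ Y, (binomialRandom (Fin n) p).real (C y) := by
  have hYW : ∀ y ∈ Y, y ∉ W := fun y hy hw => Finset.disjoint_left.1 hWY hw hy
  rw [← DeterminedBy.real_biInter hC]
  · have h1 : DeterminedBy (⋂ y ∈ Y, C y) (Y.biUnion fun y => W.image fun w => s(y, w)) :=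
      .biInter fun y hy => (hC y hy).mono
        (Finset.subset_biUnion_of_mem (fun y => W.image fun w => s(y, w)) hy)
    refine hB.real_inter h1 ?_
    rw [Finset.disjoint_left]
    intro e he he'
    obtain ⟨y, hy, he'⟩ := Finset.mem_biUnion.1 he'
    obtain ⟨w, _, rfl⟩ := Finset.mem_image.1 he'
    exact hYW y hy (hE _ he y (by simp))
  · intro y hy z hz hyz
    rw [Finset.disjoint_left]
    intro e he he'
    obtain ⟨w, _, rfl⟩ := Finset.mem_image.1 he
    obtain ⟨w', hw', h⟩ := Finset.mem_image.1 he'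
    rcases Sym2.eq_iff.1 h with ⟨h1, -⟩ | ⟨-, h2⟩
    · exact hyz h1.symm
    · exact hYW y hy (h2 ▸ hw')

lemma one_sub_le_real_no_cherry {ι : Type*} {J : Finset ι} {u v : ι → Fin n} {y : Fin n}
    (huv : ∀ j ∈ J, u j ≠ v j) (hyu : ∀ j ∈ J, y ≠ u j) (hyv : ∀ j ∈ J, y ≠ v j) :
    1 - J.card * (p : ℝ) ^ 2 ≤
      (binomialRandom (Fin n) p).real {G | ∀ j ∈ J, ¬ (G.Adj y (u j) ∧ G.Adj y (v j))} := by
  have h1 : {G : SimpleGraph (Fin n) | ¬ ∀ j ∈ J, ¬ (G.Adj y (u j) ∧ G.Adj y (v j))} ⊆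
      ⋃ j ∈ J, {G | G.Adj y (u j) ∧ G.Adj y (v j)} := by
    intro G hG
    rw [Set.mem_ofPred_eq] at hG
    push Not at hG
    obtain ⟨j, hj, h⟩ := hG
    exact Set.mem_iUnion₂.2 ⟨j, hj, h⟩
  have h2 := (measureReal_mono (μ := binomialRandom (Fin n) p) h1 (measure_ne_top _ _)).trans
    (measureReal_biUnion_finset_le _ _)
  rw [real_not, Finset.sum_congr rfl fun j hj => real_adj_and_adj (huv j hj) (hyu j hj) (hyv j hj),
    Finset.sum_const, nsmul_eq_mul] at h2
  linarith

/-- Two different cherries centred at `y` use at least three edges together. -/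
lemma real_cherries_le {u v u' v' y : Fin n} (huv : u ≠ v) (huv' : u' ≠ v')
    (hne : s(u, v) ≠ s(u', v')) (hu : y ≠ u) (hv : y ≠ v) (hu' : y ≠ u') (hv' : y ≠ v') :
    (binomialRandom (Fin n) p).real
      {G | (G.Adj y u ∧ G.Adj y v) ∧ (G.Adj y u' ∧ G.Adj y v')} ≤ (p : ℝ) ^ 3 := by
  classical
  have key : ∀ w, w ≠ u → w ≠ v → y ≠ w → (binomialRandom (Fin n) p).real
      {G | (G.Adj y u ∧ G.Adj y v) ∧ G.Adj y w} = (p : ℝ) ^ 3 := by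
    intro w h1 h2 h3
    have hset : {G : SimpleGraph (Fin n) | (G.Adj y u ∧ G.Adj y v) ∧ G.Adj y w} =
        {G | (((({u, v, w} : Finset (Fin n)).image fun w => s(y, w)) :
          Finset (Sym2 (Fin n))) : Set (Sym2 (Fin n))) ⊆ G.edgeSet} := by
      ext G
      simp [Set.subset_def, and_assoc]
    rw [hset, binomialRandom_real_subset_edgeSet, Finset.card_image_of_injective]
    · rw [Finset.card_eq_three.2 ⟨u, v, w, huv, h1.symm, h2.symm, rfl⟩]
    · intro w w' h
      exact Sym2.congr_right.1 h
    · intro e he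
      obtain ⟨w', hw', rfl⟩ := Finset.mem_image.1 he
      simp only [Finset.mem_insert, Finset.mem_singleton] at hw'
      rw [Sym2.mk_isDiag_iff]
      rcases hw' with rfl | rfl | rfl <;> assumption
  by_cases h : u' = u ∨ u' = v
  · have h1 : v' ≠ u := by
      rintro rfl
      rcases h with rfl | rfl
      · exact huv' rfl
      · exact hne Sym2.eq_swap
    have h2 : v' ≠ v := by
      rintro rfl
      rcases h with rfl | rfl
      · exact hne rfl
      · exact huv' rfl
    rw [← key v' h1 h2 hv']
    exact measureReal_mono (fun G hG => ⟨hG.1, hG.2.2⟩) (measure_ne_top _ _)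
  · push Not at h
    rw [← key u' h.1 h.2 hu']
    exact measureReal_mono (fun G hG => ⟨hG.1, hG.2.1⟩) (measure_ne_top _ _)

lemma integral_indicator_eq_real (B : Set (SimpleGraph (Fin n))) :
    ∫ G, B.indicator (fun _ => (1 : ℝ)) G ∂(binomialRandom (Fin n) p) =
      (binomialRandom (Fin n) p).real B := by
  rw [integral_indicator .of_discrete]
  simp

/-- A Bonferroni bound: if `N` cherries occur, the indicator of `N = 0` is at most `1 - N + N (N -
1)`, the last term counting ordered pairs. -/
lemma real_no_cherry_le {ι : Type*} {J : Finset ι} {u v : ι → Fin n} {y : Fin n}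
    (huv : ∀ j ∈ J, u j ≠ v j) (hyu : ∀ j ∈ J, y ≠ u j) (hyv : ∀ j ∈ J, y ≠ v j)
    (hne : ∀ j ∈ J, ∀ k ∈ J, j ≠ k → s(u j, v j) ≠ s(u k, v k)) :
    (binomialRandom (Fin n) p).real {G | ∀ j ∈ J, ¬ (G.Adj y (u j) ∧ G.Adj y (v j))} ≤
      1 - J.card * (p : ℝ) ^ 2 + (J.card : ℝ) ^ 2 * (p : ℝ) ^ 3 := by
  classical
  set H : ι → Set (SimpleGraph (Fin n)) := fun j => {G | G.Adj y (u j) ∧ G.Adj y (v j)} with hH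
  have hpt : ∀ G : SimpleGraph (Fin n),
      ({G | ∀ j ∈ J, ¬ (G.Adj y (u j) ∧ G.Adj y (v j))} : Set _).indicator (fun _ => (1 : ℝ)) G ≤
        1 - ∑ j ∈ J, (H j).indicator (fun _ => (1 : ℝ)) G +
          ∑ j ∈ J, ∑ k ∈ J.erase j, (H j ∩ H k).indicator (fun _ => (1 : ℝ)) G := by
    intro G
    by_cases hG : ∀ j ∈ J, ¬ (G.Adj y (u j) ∧ G.Adj y (v j))
    · rw [Set.indicator_of_mem (by exact hG), Finset.sum_eq_zero fun j hj =>
        Set.indicator_of_notMem (by exact hG j hj) _]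
      have : 0 ≤ ∑ j ∈ J, ∑ k ∈ J.erase j, (H j ∩ H k).indicator (fun _ => (1 : ℝ)) G :=
        Finset.sum_nonneg fun j _ => Finset.sum_nonneg fun k _ =>
          Set.indicator_nonneg (fun _ _ => zero_le_one) _
      linarith
    · rw [Set.indicator_of_notMem (by exact hG)]
      set T := J.filter fun j => G ∈ H j with hT
      have e1 : ∑ j ∈ J, (H j).indicator (fun _ => (1 : ℝ)) G = T.card := by
        simp only [Set.indicator_apply]
        rw [Finset.sum_boole]
      have e2 : ∑ j ∈ J, ∑ k ∈ J.erase j, (H j ∩ H k).indicator (fun _ => (1 : ℝ)) G =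
          T.card * (T.card - 1) := by
        have : ∀ j ∈ J, ∑ k ∈ J.erase j, (H j ∩ H k).indicator (fun _ => (1 : ℝ)) G =
            if G ∈ H j then (T.card : ℝ) - 1 else 0 := by
          intro j hj
          split_ifs with hGj
          · have h1 : ∀ k ∈ J.erase j, (H j ∩ H k).indicator (fun _ => (1 : ℝ)) G =
                if G ∈ H k then 1 else 0 := by
              intro k _
              rw [Set.indicator_apply]
              simp [hGj]
            rw [Finset.sum_congr rfl h1, Finset.sum_boole, Finset.filter_erase,
              Finset.card_erase_of_mem (Finset.mem_filter.2 ⟨hj, hGj⟩), Nat.cast_sub, Nat.cast_one]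
            exact Finset.card_pos.2 ⟨j, Finset.mem_filter.2 ⟨hj, hGj⟩⟩
          · refine Finset.sum_eq_zero fun k _ => Set.indicator_of_notMem (fun h => hGj h.1) _
        rw [Finset.sum_congr rfl this, ← Finset.sum_filter, Finset.sum_const, nsmul_eq_mul]
      rw [e1, e2]
      have hpos : 1 ≤ T.card := by
        push Not at hG
        obtain ⟨j, hj, h⟩ := hG
        exact Finset.card_pos.2 ⟨j, Finset.mem_filter.2 ⟨hj, h⟩⟩
      have : (1 : ℝ) ≤ T.card := by exact_mod_cast hpos
      nlinarith
  have hint := integral_mono (μ := binomialRandom (Fin n) p) .of_finite .of_finite hpt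
  rw [integral_indicator_eq_real, integral_add .of_finite .of_finite,
    integral_sub .of_finite .of_finite, integral_finsetSum _ fun _ _ => .of_finite,
    integral_finsetSum _ fun _ _ => .of_finite] at hint
  simp_rw [integral_indicator_eq_real] at hint
  refine hint.trans ?_
  rw [Finset.sum_congr rfl fun j hj => real_adj_and_adj (huv j hj) (hyu j hj) (hyv j hj)]
  have h3 : ∑ j ∈ J, ∫ G, ∑ k ∈ J.erase j, (H j ∩ H k).indicator (fun _ => (1 : ℝ)) G
      ∂(binomialRandom (Fin n) p) ≤ ∑ j ∈ J, ∑ k ∈ J, (p : ℝ) ^ 3 := by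
    refine Finset.sum_le_sum fun j hj => ?_
    rw [integral_finsetSum _ fun _ _ => .of_finite]
    simp_rw [integral_indicator_eq_real]
    calc _ ≤ ∑ k ∈ J.erase j, (p : ℝ) ^ 3 := by
          refine Finset.sum_le_sum fun k hk => ?_
          obtain ⟨hkj, hk⟩ := Finset.mem_erase.1 hk
          exact real_cherries_le (huv j hj) (huv k hk) (hne j hj k hk hkj.symm) (hyu j hj)
            (hyv j hj) (hyu k hk) (hyv k hk)
      _ ≤ _ := Finset.sum_le_sum_of_subset_of_nonneg (Finset.erase_subset _ _)
          fun _ _ _ => pow_nonneg p.2.1 _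
  simp only [Finset.sum_const, nsmul_eq_mul, integral_const, probReal_univ, smul_eq_mul,
    mul_one] at h3 ⊢
  nlinarith

/-- The vertices of the path `x 0, …, x ℓ`. -/
def pathSupport (ℓ : ℕ) (x : ℕ → Fin n) : Finset (Fin n) := (Finset.range (ℓ + 1)).image x

lemma mem_pathSupport {ℓ : ℕ} {x : ℕ → Fin n} {i : ℕ} (hi : i ≤ ℓ) : x i ∈ pathSupport ℓ x :=
  Finset.mem_image_of_mem _ (Finset.mem_range.2 (by omega))

lemma card_pathSupport_le (ℓ : ℕ) (x : ℕ → Fin n) : (pathSupport ℓ x).card ≤ ℓ + 1 :=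
  Finset.card_image_le.trans (by simp)

/-- The factors account for the `K + 1` edges, the absence of the `K` chords of span two (a union
bound given the edges), and the absence of outside common neighbours, independently over the outside
vertices. -/
lemma le_real_isIsolatedPath {K : ℕ} {x : ℕ → Fin n} (hx : Set.InjOn x (Set.Iic (K + 1)))
    (hp : K * (p : ℝ) ^ 2 ≤ 1) :
    (p : ℝ) ^ (K + 1) * (1 - K * p) * (1 - K * (p : ℝ) ^ 2) ^ n ≤
      (binomialRandom (Fin n) p).real {G | IsIsolatedPath G (K + 1) x} := by
  classical
  have hp0 : (0 : ℝ) ≤ p := p.2.1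
  have hxne : ∀ i ≤ K + 1, ∀ j ≤ K + 1, i ≠ j → x i ≠ x j := fun i hi j hj hij h => hij (hx hi hj h)
  set W := pathSupport (K + 1) x with hW
  set A : Set (SimpleGraph (Fin n)) := {G | (pathEdges (K + 1) x : Set (Sym2 (Fin n))) ⊆ G.edgeSet}
  set D : ℕ → Set (SimpleGraph (Fin n)) := fun i => {G | G.Adj (x i) (x (i + 2))}
  set B : Set (SimpleGraph (Fin n)) := A ∩ ⋂ i ∈ Finset.range K, {G | ¬ G.Adj (x i) (x (i + 2))}
  set C : Fin n → Set (SimpleGraph (Fin n)) := fun y =>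
    {G | ∀ i ∈ Finset.range K, ¬ (G.Adj y (x i) ∧ G.Adj y (x (i + 2)))}
  have hsub : B ∩ ⋂ y ∈ Wᶜ, C y ⊆ {G | IsIsolatedPath G (K + 1) x} := by
    rintro G ⟨⟨h1, h2⟩, h3⟩
    rw [Set.mem_iInter₂] at h2 h3
    refine ⟨pathEdges_subset_edgeSet_iff.1 h1, fun i hi => h2 i (Finset.mem_range.2 (by omega)),
      fun y hy i hi => h3 y ?_ i (Finset.mem_range.2 (by omega))⟩
    rw [Finset.mem_compl, hW, pathSupport]
    intro hmem
    obtain ⟨j, hj, rfl⟩ := Finset.mem_image.1 hmem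
    exact hy j (by have := Finset.mem_range.1 hj; omega) rfl
  refine le_trans ?_ (measureReal_mono hsub (measure_ne_top _ _))
  set E := pathEdges (K + 1) x ∪ (Finset.range K).image fun i => s(x i, x (i + 2))
  have hEW : ∀ e ∈ E, ∀ v ∈ e, v ∈ W := by
    intro e he v hv
    rcases Finset.mem_union.1 he with he | he
    · obtain ⟨i, hi, rfl⟩ := Finset.mem_image.1 he
      have := Finset.mem_range.1 hi
      rcases Sym2.mem_iff.1 hv with rfl | rfl
      · exact mem_pathSupport (by omega)
      · exact mem_pathSupport (by omega)
    · obtain ⟨i, hi, rfl⟩ := Finset.mem_image.1 he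
      have := Finset.mem_range.1 hi
      rcases Sym2.mem_iff.1 hv with rfl | rfl
      · exact mem_pathSupport (by omega)
      · exact mem_pathSupport (by omega)
  have hB : DeterminedBy B E := by
    refine .inter ((determinedBy_subset_edgeSet _).mono Finset.subset_union_left) (.biInter ?_)
    intro i hi
    exact .not (determinedBy_adj (Finset.mem_union_right _ (Finset.mem_image_of_mem _ hi)))
  have hC : ∀ y ∈ Wᶜ, DeterminedBy (C y) (W.image fun w => s(y, w)) := by
    intro y _
    have : C y = ⋂ i ∈ Finset.range K, {G | ¬ (G.Adj y (x i) ∧ G.Adj y (x (i + 2)))} := by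
      ext G
      simp [C]
    rw [this]
    refine .biInter fun i hi => .not (.inter (determinedBy_adj ?_) (determinedBy_adj ?_))
    · exact Finset.mem_image_of_mem _ (mem_pathSupport (by have := Finset.mem_range.1 hi; omega))
    · exact Finset.mem_image_of_mem _ (mem_pathSupport (by have := Finset.mem_range.1 hi; omega))
  rw [real_inter_stars disjoint_compl_right hEW hB hC]
  have hA : (binomialRandom (Fin n) p).real A = (p : ℝ) ^ (K + 1) := by
    rw [binomialRandom_real_subset_edgeSet (not_isDiag_of_mem_pathEdges hx), card_pathEdges hx]
  have hAD : ∀ i ∈ Finset.range K, (binomialRandom (Fin n) p).real (A ∩ D i) =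
      (p : ℝ) ^ (K + 2) := by
    intro i hi
    have hiK := Finset.mem_range.1 hi
    have hnot : s(x i, x (i + 2)) ∉ pathEdges (K + 1) x := by
      intro h
      obtain ⟨j, hj, hji⟩ := Finset.mem_image.1 h
      have := Finset.mem_range.1 hj
      rcases Sym2.eq_iff.1 hji with ⟨h1, h2⟩ | ⟨h1, h2⟩
      · have e1 := hx (Set.mem_Iic.2 (by omega)) (Set.mem_Iic.2 (by omega)) h1
        have e2 := hx (Set.mem_Iic.2 (by omega)) (Set.mem_Iic.2 (by omega)) h2
        omega
      · have e1 := hx (Set.mem_Iic.2 (by omega)) (Set.mem_Iic.2 (by omega)) h1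
        have e2 := hx (Set.mem_Iic.2 (by omega)) (Set.mem_Iic.2 (by omega)) h2
        omega
    have hset : A ∩ D i = {G | ((insert s(x i, x (i + 2)) (pathEdges (K + 1) x) :
        Finset (Sym2 (Fin n))) : Set (Sym2 (Fin n))) ⊆ G.edgeSet} := by
      ext G
      rw [Finset.coe_insert]
      simp only [Set.mem_ofPred_eq, Set.insert_subset_iff, A, D, Set.mem_inter_iff]
      exact and_comm
    rw [hset, binomialRandom_real_subset_edgeSet, Finset.card_insert_of_notMem hnot,
      card_pathEdges hx]
    intro e he
    rcases Finset.mem_insert.1 he with rfl | he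
    · rw [Sym2.mk_isDiag_iff]
      exact hxne _ (by omega) _ (by omega) (by omega)
    · exact not_isDiag_of_mem_pathEdges hx e he
  have hBge : (p : ℝ) ^ (K + 1) * (1 - K * p) ≤ (binomialRandom (Fin n) p).real B := by
    have hcov : A ⊆ B ∪ ⋃ i ∈ Finset.range K, (A ∩ D i) := by
      intro G hG
      by_cases h : ∀ i ∈ Finset.range K, ¬ G.Adj (x i) (x (i + 2))
      · exact Or.inl ⟨hG, Set.mem_iInter₂.2 h⟩
      · push Not at h
        obtain ⟨i, hi, h⟩ := h
        exact Or.inr (Set.mem_iUnion₂.2 ⟨i, hi, hG, h⟩)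
    have h1 := (measureReal_mono (μ := binomialRandom (Fin n) p) hcov (measure_ne_top _ _)).trans
      ((measureReal_union_le _ _).trans (add_le_add_right (measureReal_biUnion_finset_le _ _) _))
    rw [hA, Finset.sum_congr rfl hAD, Finset.sum_const, Finset.card_range, nsmul_eq_mul] at h1
    have : (p : ℝ) ^ (K + 2) = (p : ℝ) ^ (K + 1) * p := pow_succ _ _
    rw [this] at h1
    linarith
  have hCge : (1 - K * (p : ℝ) ^ 2) ^ n ≤ ∏ y ∈ Wᶜ, (binomialRandom (Fin n) p).real (C y) := by
    have h0 : 0 ≤ 1 - K * (p : ℝ) ^ 2 := by linarith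
    calc (1 - K * (p : ℝ) ^ 2) ^ n ≤ (1 - K * (p : ℝ) ^ 2) ^ (Wᶜ).card := by
          refine pow_le_pow_of_le_one h0 ?_ ?_
          · have : 0 ≤ K * (p : ℝ) ^ 2 := by positivity
            linarith
          · exact (Finset.card_le_univ _).trans (by simp)
      _ = ∏ y ∈ Wᶜ, (1 - K * (p : ℝ) ^ 2) := by rw [Finset.prod_const]
      _ ≤ _ := by
          refine Finset.prod_le_prod (fun _ _ => h0) fun y hy => ?_
          rw [Finset.mem_compl] at hy
          have hyx : ∀ i ≤ K + 1, y ≠ x i := by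
            rintro i hi rfl
            exact hy (mem_pathSupport hi)
          have := one_sub_le_real_no_cherry (p := p) (J := Finset.range K) (u := x)
            (v := fun i => x (i + 2)) (y := y)
            (fun i hi => hxne i (by have := Finset.mem_range.1 hi; omega) _
              (by have := Finset.mem_range.1 hi; omega) (by omega))
            (fun i hi => hyx _ (by have := Finset.mem_range.1 hi; omega))
            (fun i hi => hyx _ (by have := Finset.mem_range.1 hi; omega))
          rwa [Finset.card_range] at this
  refine mul_le_mul hBge hCge (pow_nonneg (by linarith) _) measureReal_nonneg

lemma real_isIsolatedPath_le {ℓ : ℕ} {x : ℕ → Fin n} (hx : Set.InjOn x (Set.Iic ℓ)) :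
    (binomialRandom (Fin n) p).real {G | IsIsolatedPath G ℓ x} ≤ (p : ℝ) ^ ℓ := by
  classical
  have h := binomialRandom_real_subset_edgeSet (p := p) (not_isDiag_of_mem_pathEdges hx)
  rw [card_pathEdges hx] at h
  rw [← h]
  exact measureReal_mono (fun G hG => pathEdges_subset_edgeSet_iff.2 hG.adj) (measure_ne_top _ _)

lemma real_isIsolatedPath_inter_le {ℓ : ℕ} {x y : ℕ → Fin n} (hx : Set.InjOn x (Set.Iic ℓ))
    (hy : Set.InjOn y (Set.Iic ℓ)) :
    (binomialRandom (Fin n) p).real ({G | IsIsolatedPath G ℓ x} ∩ {G | IsIsolatedPath G ℓ y}) ≤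
      (p : ℝ) ^ (pathEdges ℓ x ∪ pathEdges ℓ y).card := by
  classical
  rw [← binomialRandom_real_subset_edgeSet (p := p)]
  · refine measureReal_mono (fun G hG => ?_) (measure_ne_top _ _)
    rw [Set.mem_ofPred_eq, Finset.coe_union, Set.union_subset_iff]
    exact ⟨pathEdges_subset_edgeSet_iff.2 hG.1.adj, pathEdges_subset_edgeSet_iff.2 hG.2.adj⟩
  · intro e he
    rcases Finset.mem_union.1 he with he | he
    · exact not_isDiag_of_mem_pathEdges hx e he
    · exact not_isDiag_of_mem_pathEdges hy e he

/-- For `α = 1/2` the factor `(1 - K p²) ^ n` stays away from `1`, so the edge bound alone is too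
weak. Each of the at least `n - 2 (K + 2)` outside vertices must avoid `2K` distinct cherries, which
recovers the square of that factor asymptotically. -/
lemma real_isIsolatedPath_inter_le_of_disjoint {K : ℕ} {x y : ℕ → Fin n}
    (hx : Set.InjOn x (Set.Iic (K + 1))) (hy : Set.InjOn y (Set.Iic (K + 1)))
    (hdisj : Disjoint (pathEdges (K + 1) x) (pathEdges (K + 1) y))
    (hne : ∀ i < K, ∀ j < K, s(x i, x (i + 2)) ≠ s(y j, y (j + 2)))
    (hp : 2 * K * (p : ℝ) ≤ 1) :
    (binomialRandom (Fin n) p).real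
        ({G | IsIsolatedPath G (K + 1) x} ∩ {G | IsIsolatedPath G (K + 1) y}) ≤
      (p : ℝ) ^ (2 * (K + 1)) * Real.exp (-(2 * K * (p : ℝ) ^ 2 - 4 * K ^ 2 * (p : ℝ) ^ 3) *
        (n - 2 * (K + 2))) := by
  classical
  have hp0 : (0 : ℝ) ≤ p := p.2.1
  have hxne : ∀ i ≤ K + 1, ∀ j ≤ K + 1, i ≠ j → x i ≠ x j := fun i hi j hj hij h => hij (hx hi hj h)
  have hyne : ∀ i ≤ K + 1, ∀ j ≤ K + 1, i ≠ j → y i ≠ y j := fun i hi j hj hij h => hij (hy hi hj h)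
  set W := pathSupport (K + 1) x ∪ pathSupport (K + 1) y with hW
  set E := pathEdges (K + 1) x ∪ pathEdges (K + 1) y with hE
  -- The Boolean tag selects the path, so `J` indexes the `2K` cherries of both.
  set J : Finset (Bool × ℕ) := Finset.univ ×ˢ Finset.range K with hJ
  set z : Bool → ℕ → Fin n := fun c => if c then x else y with hz
  have hJK : ∀ j ∈ J, j.2 < K := fun j hj => by simpa [hJ] using hj
  have hzW : ∀ c, ∀ i ≤ K + 1, z c i ∈ W := by
    intro c i hi
    cases c
    · exact Finset.mem_union_right _ (mem_pathSupport hi)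
    · exact Finset.mem_union_left _ (mem_pathSupport hi)
  set C : Fin n → Set (SimpleGraph (Fin n)) := fun w =>
    {G | ∀ j ∈ J, ¬ (G.Adj w (z j.1 j.2) ∧ G.Adj w (z j.1 (j.2 + 2)))} with hCdef
  have hsub : {G | IsIsolatedPath G (K + 1) x} ∩ {G | IsIsolatedPath G (K + 1) y} ⊆
      {G | (E : Set (Sym2 (Fin n))) ⊆ G.edgeSet} ∩ ⋂ w ∈ Wᶜ, C w := by
    rintro G ⟨h1, h2⟩
    refine ⟨?_, Set.mem_iInter₂.2 fun w hw => ?_⟩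
    · rw [Set.mem_ofPred_eq, hE, Finset.coe_union, Set.union_subset_iff]
      exact ⟨pathEdges_subset_edgeSet_iff.2 h1.adj, pathEdges_subset_edgeSet_iff.2 h2.adj⟩
    · rintro ⟨c, i⟩ hj
      have hi := hJK _ hj
      rw [Finset.mem_compl] at hw
      have hwz : ∀ c, ∀ i ≤ K + 1, w ≠ z c i := by
        rintro c i hi rfl
        exact hw (hzW c i hi)
      cases c
      · exact h2.not_adj_of_ne w (hwz false) i (by simp only at hi; omega)
      · exact h1.not_adj_of_ne w (hwz true) i (by simp only at hi; omega)
  refine (measureReal_mono hsub (measure_ne_top _ _)).trans ?_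
  have hEW : ∀ e ∈ E, ∀ v ∈ e, v ∈ W := by
    intro e he v hv
    rcases Finset.mem_union.1 he with he | he <;>
    · obtain ⟨i, hi, rfl⟩ := Finset.mem_image.1 he
      have := Finset.mem_range.1 hi
      rcases Sym2.mem_iff.1 hv with rfl | rfl
      · first | exact hzW true _ (by omega) | exact hzW false _ (by omega)
      · first | exact hzW true _ (by omega) | exact hzW false _ (by omega)
  have hC : ∀ w ∈ Wᶜ, DeterminedBy (C w) (W.image fun v => s(w, v)) := by
    intro w _
    have : C w = ⋂ j ∈ J, {G | ¬ (G.Adj w (z j.1 j.2) ∧ G.Adj w (z j.1 (j.2 + 2)))} := by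
      ext G
      simp only [hCdef, Set.mem_iInter, Set.mem_ofPred_eq]
    rw [this]
    refine .biInter fun j hj => .not (.inter (determinedBy_adj ?_) (determinedBy_adj ?_))
    · exact Finset.mem_image_of_mem _ (hzW _ _ (by have := hJK j hj; omega))
    · exact Finset.mem_image_of_mem _ (hzW _ _ (by have := hJK j hj; omega))
  rw [real_inter_stars disjoint_compl_right hEW (determinedBy_subset_edgeSet E) hC,
    binomialRandom_real_subset_edgeSet, hE, Finset.card_union_of_disjoint hdisj, card_pathEdges hx,
    card_pathEdges hy, two_mul]
  swap
  · intro e he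
    rcases Finset.mem_union.1 he with he | he
    · exact not_isDiag_of_mem_pathEdges hx e he
    · exact not_isDiag_of_mem_pathEdges hy e he
  refine mul_le_mul_of_nonneg_left ?_ (pow_nonneg hp0 _)
  set δ : ℝ := 2 * K * (p : ℝ) ^ 2 - 4 * K ^ 2 * (p : ℝ) ^ 3 with hδ
  have hδ0 : 0 ≤ δ := by
    have : δ = 2 * K * (p : ℝ) ^ 2 * (1 - 2 * K * p) := by rw [hδ]; ring
    rw [this]
    exact mul_nonneg (by positivity) (by linarith)
  have hCle : ∀ w ∈ Wᶜ, (binomialRandom (Fin n) p).real (C w) ≤ Real.exp (-δ) := by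
    intro w hw
    rw [Finset.mem_compl] at hw
    have hwz : ∀ c, ∀ i ≤ K + 1, w ≠ z c i := by
      rintro c i hi rfl
      exact hw (hzW c i hi)
    have hzne : ∀ c, ∀ i ≤ K + 1, ∀ j ≤ K + 1, i ≠ j → z c i ≠ z c j := by
      intro c
      cases c
      · exact hyne
      · exact hxne
    have h1 := real_no_cherry_le (p := p) (J := J) (u := fun j => z j.1 j.2)
      (v := fun j => z j.1 (j.2 + 2)) (y := w)
      (fun j hj => hzne _ _ (by have := hJK j hj; omega) _ (by have := hJK j hj; omega) (by omega))
      (fun j hj => hwz _ _ (by have := hJK j hj; omega))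
      (fun j hj => hwz _ _ (by have := hJK j hj; omega)) ?_
    · have hcard : (J.card : ℝ) = 2 * K := by simp [hJ]
      rw [hcard] at h1
      have h2 := Real.add_one_le_exp (-δ)
      refine h1.trans (le_trans (le_of_eq ?_) h2)
      rw [hδ]
      ring
    · rintro ⟨c, i⟩ hi ⟨d, j⟩ hj hij heq
      have hi' := hJK _ hi
      have hj' := hJK _ hj
      simp only at hi' hj' heq
      have hsame : ∀ c, s(z c i, z c (i + 2)) = s(z c j, z c (j + 2)) → i = j := by
        intro c h
        by_contra hne
        rcases Sym2.eq_iff.1 h with ⟨h1, -⟩ | ⟨h1, h2⟩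
        · exact hzne c i (by omega) j (by omega) hne h1
        · by_cases h3 : i = j + 2
          · exact hzne c (i + 2) (by omega) j (by omega) (by omega) h2
          · exact hzne c i (by omega) (j + 2) (by omega) h3 h1
      cases c <;> cases d
      · exact hij (by rw [hsame _ heq])
      · exact hne j hj' i hi' heq.symm
      · exact hne i hi' j hj' heq
      · exact hij (by rw [hsame _ heq])
  calc ∏ w ∈ Wᶜ, (binomialRandom (Fin n) p).real (C w) ≤ ∏ w ∈ Wᶜ, Real.exp (-δ) :=
        Finset.prod_le_prod (fun _ _ => measureReal_nonneg) hCle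
    _ = Real.exp (-δ * (Wᶜ).card) := by
        rw [Finset.prod_const, ← Real.exp_nat_mul, mul_comm]
    _ ≤ _ := by
        rw [Real.exp_le_exp, neg_mul, neg_mul, neg_le_neg_iff]
        refine mul_le_mul_of_nonneg_left ?_ hδ0
        have h1 : W.card ≤ 2 * (K + 2) := by
          refine (Finset.card_union_le _ _).trans ?_
          have h2 := card_pathSupport_le (K + 1) x
          have h3 := card_pathSupport_le (K + 1) y
          omega
        rw [Finset.card_compl, Fintype.card_fin]
        have h2 : n ≤ (n - W.card) + 2 * (K + 2) := by omega
        have h3 : (n : ℝ) ≤ ((n - W.card : ℕ) : ℝ) + 2 * (K + 2) := by exact_mod_cast h2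
        linarith

end SecondMoment

/-! ### Second moment of the number of isolated paths through disjoint blocks of vertices. -/

section PathFamily

variable {n : ℕ} {p : unitInterval} {a b : Fin n} {K m : ℕ} {e : Fin K × Fin m → Fin n}

/-- The path from `a` to `b` whose `i`-th interior vertex is the `f i`-th vertex of block `i`. -/
def blockPath (a b : Fin n) (e : Fin K × Fin m → Fin n) (f : Fin K → Fin m) : ℕ → Fin n :=
  pathVertex a b fun i => e (i, f i)

/-- The vertices `a`, `b` and `e i` are pairwise distinct. -/
structure IsBlockSystem (a b : Fin n) (e : Fin K × Fin m → Fin n) : Prop where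
  ne : a ≠ b
  inj : Function.Injective e
  ne_left : ∀ i, e i ≠ a
  ne_right : ∀ i, e i ≠ b

lemma eq_zero_or_succ_or_last {i : ℕ} (hi : i ≤ K + 1) :
    i = 0 ∨ (∃ k : Fin K, i = k + 1) ∨ i = K + 1 := by
  by_cases h0 : i = 0
  · exact Or.inl h0
  · by_cases h1 : i = K + 1
    · exact Or.inr (Or.inr h1)
    · exact Or.inr (Or.inl ⟨⟨i - 1, by omega⟩, by simp; omega⟩)

/-- A vertex knows its block, so two block paths can only meet at equal positions; this keeps the
count of shared edges simple. -/
lemma IsBlockSystem.blockPath_eq (he : IsBlockSystem a b e) {f g : Fin K → Fin m} {i j : ℕ}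
    (hi : i ≤ K + 1) (hj : j ≤ K + 1) (h : blockPath a b e f i = blockPath a b e g j) :
    i = j ∧ ∀ k : Fin K, i = k + 1 → f k = g k := by
  unfold blockPath at h
  rcases eq_zero_or_succ_or_last hi with rfl | ⟨k, rfl⟩ | rfl <;>
  rcases eq_zero_or_succ_or_last hj with rfl | ⟨k', rfl⟩ | rfl <;>
  simp only [pathVertex_zero, pathVertex_succ, pathVertex_last] at h
  · exact ⟨rfl, fun k hk => by omega⟩
  · exact absurd h.symm (he.ne_left _)
  · exact absurd h he.ne
  · exact absurd h (he.ne_left _)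
  · have h1 := he.inj h
    rw [Prod.mk.injEq] at h1
    obtain ⟨rfl, h2⟩ := h1
    refine ⟨rfl, fun k' hk' => ?_⟩
    have : k' = k := by apply Fin.ext; omega
    rw [this, h2]
  · exact absurd h (he.ne_right _)
  · exact absurd h.symm he.ne
  · exact absurd h.symm (he.ne_right _)
  · exact ⟨rfl, fun k hk => by have := k.2; omega⟩

lemma IsBlockSystem.injOn (he : IsBlockSystem a b e) (f : Fin K → Fin m) :
    Set.InjOn (blockPath a b e f) (Set.Iic (K + 1)) :=
  fun _ hi _ hj h => (he.blockPath_eq hi hj h).1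

/-- The positions at which two paths have the same interior vertex. -/
def agreement (f g : Fin K → Fin m) : Finset (Fin K) := Finset.univ.filter fun i => f i = g i

/-- A shared edge joins two positions of agreement. Sending it to its endpoint nearer to a fixed
position of disagreement is injective and always yields an interior position. -/
lemma IsBlockSystem.card_pathEdges_inter_le (he : IsBlockSystem a b e) {f g : Fin K → Fin m}
    (hfg : f ≠ g) :
    (pathEdges (K + 1) (blockPath a b e f) ∩ pathEdges (K + 1) (blockPath a b e g)).card ≤
      (agreement f g).card := by
  classical
  set x := blockPath a b e f
  set y := blockPath a b e g
  obtain ⟨k, hk⟩ := Function.ne_iff.1 hfg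
  set T := (Finset.range (K + 1)).filter fun i => x i = y i ∧ x (i + 1) = y (i + 1) with hT
  have h1 : pathEdges (K + 1) x ∩ pathEdges (K + 1) y ⊆ T.image fun i => s(x i, x (i + 1)) := by
    intro s hs
    obtain ⟨hs1, hs2⟩ := Finset.mem_inter.1 hs
    obtain ⟨i, hi, rfl⟩ := Finset.mem_image.1 hs1
    obtain ⟨j, hj, hji⟩ := Finset.mem_image.1 hs2
    have hi' := Finset.mem_range.1 hi
    have hj' := Finset.mem_range.1 hj
    refine Finset.mem_image.2 ⟨i, Finset.mem_filter.2 ⟨hi, ?_⟩, rfl⟩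
    rcases Sym2.eq_iff.1 hji.symm with ⟨e1, e2⟩ | ⟨e1, e2⟩
    · obtain rfl := (he.blockPath_eq (by omega) (by omega) e1).1
      exact ⟨e1, e2⟩
    · have e3 := (he.blockPath_eq (by omega) (by omega) e1).1
      have e4 := (he.blockPath_eq (by omega) (by omega) e2).1
      omega
  have h2 : T.card ≤ ((agreement f g).image fun i : Fin K => (i : ℕ) + 1).card := by
    have hkne : x (k + 1) ≠ y (k + 1) := fun h =>
      hk ((he.blockPath_eq (by have := k.2; omega) (by have := k.2; omega) h).2 k rfl)
    have hmem : ∀ i, 0 < i → i ≤ K → x i = y i → i ∈ (agreement f g).image fun i : Fin K => (i : ℕ) + 1 := by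
      intro i h0 hi h
      have hi' : i = ((⟨i - 1, by omega⟩ : Fin K) : ℕ) + 1 := by simp; omega
      refine Finset.mem_image.2 ⟨⟨i - 1, by omega⟩, ?_, hi'.symm⟩
      exact Finset.mem_filter.2 ⟨Finset.mem_univ _,
        (he.blockPath_eq (by omega) (by omega) h).2 _ hi'⟩
    refine Finset.card_le_card_of_injOn (fun i => if i < k + 1 then i + 1 else i) ?_ ?_
    · intro i hi
      obtain ⟨hi1, hi2, hi3⟩ := Finset.mem_filter.1 hi
      have := Finset.mem_range.1 hi1
      beta_reduce
      split_ifs with h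
      · refine hmem _ (by omega) ?_ hi3
        have := k.2
        omega
      · refine hmem _ (by omega) ?_ hi2
        by_contra hcon
        omega
    · intro i hi j hj hij
      obtain ⟨-, hi2, hi3⟩ := Finset.mem_filter.1 hi
      obtain ⟨-, hj2, hj3⟩ := Finset.mem_filter.1 hj
      have hi4 : i ≠ k + 1 := by rintro rfl; exact hkne hi2
      have hi5 : i + 1 ≠ k + 1 := by intro h; rw [h] at hi3; exact hkne hi3
      have hj4 : j ≠ k + 1 := by rintro rfl; exact hkne hj2
      have hj5 : j + 1 ≠ k + 1 := by intro h; rw [h] at hj3; exact hkne hj3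
      beta_reduce at hij
      split_ifs at hij <;> omega
  exact (Finset.card_le_card h1).trans (Finset.card_image_le.trans
    (h2.trans Finset.card_image_le))

/-- The event that the path given by `f` is isolated. -/
def isolatedEvent (a b : Fin n) (e : Fin K × Fin m → Fin n) (f : Fin K → Fin m) :
    Set (SimpleGraph (Fin n)) :=
  {G | IsIsolatedPath G (K + 1) (blockPath a b e f)}

/-- The product over positions equals `p⁻¹` to the number `s` of agreements. For `s = 0` its term
vanishes and the sharp bound for edge-disjoint paths is used. For `s ≥ 1` the edge bound costs a
factor `p⁻ˢ ≤ 2 (p⁻ˢ - 1)`, because `p⁻¹ ≥ 2`. -/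
lemma IsBlockSystem.real_inter_le (he : IsBlockSystem a b e) (hK : 2 ≤ K) (hp0 : 0 < (p : ℝ))
    (hp : 2 * K * (p : ℝ) ≤ 1) (f g : Fin K → Fin m) :
    (binomialRandom (Fin n) p).real (isolatedEvent a b e f ∩ isolatedEvent a b e g) ≤
      (p : ℝ) ^ (2 * (K + 1)) *
        (Real.exp (-(2 * K * (p : ℝ) ^ 2 - 4 * K ^ 2 * (p : ℝ) ^ 3) * (n - 2 * (K + 2))) +
          2 * (∏ i, (if f i = g i then (p : ℝ)⁻¹ else 1) - 1)) +
      if f = g then (p : ℝ) ^ (K + 1) else 0 := by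
  classical
  have hprod : ∏ i, (if f i = g i then (p : ℝ)⁻¹ else 1) = ((p : ℝ)⁻¹) ^ (agreement f g).card := by
    rw [Finset.prod_ite]
    simp [agreement]
  have hinv : 2 ≤ (p : ℝ)⁻¹ := by
    rw [le_inv_comm₀ (by norm_num) hp0]
    have : (2 : ℝ) ≤ K := by exact_mod_cast hK
    nlinarith
  rw [hprod]
  have hone : 1 ≤ ((p : ℝ)⁻¹) ^ (agreement f g).card := one_le_pow₀ (by linarith)
  set Q := Real.exp (-(2 * K * (p : ℝ) ^ 2 - 4 * K ^ 2 * (p : ℝ) ^ 3) * (n - 2 * (K + 2))) with hQ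
  have hQ0 : 0 ≤ Q := (Real.exp_pos _).le
  have hp2 : (0 : ℝ) ≤ (p : ℝ) ^ (2 * (K + 1)) := by positivity
  by_cases hfg : f = g
  · subst hfg
    rw [if_pos rfl, Set.inter_self]
    have h1 := real_isIsolatedPath_le (p := p) (he.injOn f)
    have h2 : 0 ≤ (p : ℝ) ^ (2 * (K + 1)) * (Q + 2 * (((p : ℝ)⁻¹) ^ (agreement f f).card - 1)) :=
      mul_nonneg hp2 (by linarith)
    unfold isolatedEvent
    linarith
  rw [if_neg hfg, add_zero]
  have hinter := he.card_pathEdges_inter_le hfg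
  rcases Nat.eq_zero_or_pos (agreement f g).card with h0 | hpos
  · have hag : ∀ i, f i ≠ g i := by
      intro i hi
      rw [Finset.card_eq_zero] at h0
      have : i ∈ agreement f g := Finset.mem_filter.2 ⟨Finset.mem_univ _, hi⟩
      rw [h0] at this
      simp at this
    rw [h0] at hinter ⊢
    have hdisj : Disjoint (pathEdges (K + 1) (blockPath a b e f))
        (pathEdges (K + 1) (blockPath a b e g)) := by
      rw [Finset.disjoint_iff_inter_eq_empty, ← Finset.card_eq_zero]
      omega
    have := real_isIsolatedPath_inter_le_of_disjoint (p := p) (he.injOn f) (he.injOn g) hdisj ?_ hp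
    · rw [pow_zero, sub_self, mul_zero, add_zero]
      exact this
    · intro i hi j hj heq
      rcases Sym2.eq_iff.1 heq with ⟨h1, h2⟩ | ⟨h1, h2⟩
      · have e1 := he.blockPath_eq (by omega) (by omega) h1
        have e2 := he.blockPath_eq (by omega) (by omega) h2
        by_cases hi0 : i = 0
        · exact hag ⟨1, by omega⟩ (e2.2 ⟨1, by omega⟩ (by simp [hi0]))
        · exact hag ⟨i - 1, by omega⟩ (e1.2 ⟨i - 1, by omega⟩ (by simp; omega))
      · have e1 := he.blockPath_eq (by omega) (by omega) h1
        have e2 := he.blockPath_eq (by omega) (by omega) h2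
        omega
  · have h1 := real_isIsolatedPath_inter_le (p := p) (he.injOn f) (he.injOn g)
    have h2 : (p : ℝ) ^ (pathEdges (K + 1) (blockPath a b e f) ∪
        pathEdges (K + 1) (blockPath a b e g)).card ≤
        (p : ℝ) ^ (2 * (K + 1)) * ((p : ℝ)⁻¹) ^ (agreement f g).card := by
      rw [inv_pow, ← div_eq_mul_inv, le_div_iff₀ (by positivity), ← pow_add]
      refine pow_le_pow_of_le_one hp0.le p.2.2 ?_
      have := Finset.card_union_add_card_inter (pathEdges (K + 1) (blockPath a b e f))
        (pathEdges (K + 1) (blockPath a b e g))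
      rw [card_pathEdges (he.injOn f), card_pathEdges (he.injOn g)] at this
      omega
    have h3 : 2 ≤ ((p : ℝ)⁻¹) ^ (agreement f g).card := by
      calc (2 : ℝ) ≤ (p : ℝ)⁻¹ := hinv
        _ ≤ _ := le_self_pow₀ (by linarith) (by omega)
    refine (h1.trans h2).trans (mul_le_mul_of_nonneg_left ?_ hp2)
    linarith

/-- For fixed `f` the sum over `g` factorises over positions, each contributing at most `m + t`. -/
lemma sum_prod_agreement_le (hm : 0 < m) (t : ℝ) (ht : 0 ≤ t) :
    ∑ f : Fin K → Fin m, ∑ g : Fin K → Fin m, ∏ i, (if f i = g i then t else 1) ≤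
      ((m : ℝ) ^ K) ^ 2 * (1 + t / m) ^ K := by
  classical
  have hm' : (0 : ℝ) < m := by exact_mod_cast hm
  have h1 : ∀ f : Fin K → Fin m, ∑ g : Fin K → Fin m, ∏ i, (if f i = g i then t else 1) ≤
      (m + t) ^ K := by
    intro f
    have h2 := Finset.prod_univ_sum (fun _ : Fin K => (Finset.univ : Finset (Fin m)))
      fun i y => if f i = y then t else 1
    rw [Fintype.piFinset_univ] at h2
    rw [← h2]
    calc _ ≤ ∏ _i : Fin K, ((m : ℝ) + t) := by
          refine Finset.prod_le_prod (fun i _ => Finset.sum_nonneg fun y _ => ?_) fun i _ => ?_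
          · split_ifs <;> linarith
          · calc ∑ y, (if f i = y then t else 1) ≤ ∑ y : Fin m, (1 + if f i = y then t else 0) := by
                  refine Finset.sum_le_sum fun y _ => ?_
                  split_ifs <;> linarith
              _ = _ := by simp [Finset.sum_add_distrib]
      _ = _ := by simp
  calc _ ≤ ∑ f : Fin K → Fin m, ((m : ℝ) + t) ^ K := Finset.sum_le_sum fun f _ => h1 f
    _ = (m : ℝ) ^ K * (m + t) ^ K := by simp
    _ = _ := by
        have h2 : (m : ℝ) + t = m * (1 + t / m) := by field_simp
        rw [h2, mul_pow]
        ring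

/-- The number of isolated paths. -/
noncomputable def isolatedCount (a b : Fin n) (e : Fin K × Fin m → Fin n)
    (G : SimpleGraph (Fin n)) : ℝ :=
  ∑ f : Fin K → Fin m, (isolatedEvent a b e f).indicator (fun _ => (1 : ℝ)) G

lemma le_integral_isolatedCount (he : IsBlockSystem a b e) (hp : K * (p : ℝ) ^ 2 ≤ 1) :
    (m : ℝ) ^ K * (p : ℝ) ^ (K + 1) * ((1 - K * p) * (1 - K * (p : ℝ) ^ 2) ^ n) ≤
      ∫ G, isolatedCount a b e G ∂(binomialRandom (Fin n) p) := by
  unfold isolatedCount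
  rw [integral_finsetSum _ fun _ _ => .of_finite]
  simp_rw [integral_indicator_eq_real]
  calc _ = ∑ _f : Fin K → Fin m,
        (p : ℝ) ^ (K + 1) * (1 - K * p) * (1 - K * (p : ℝ) ^ 2) ^ n := by
        simp; ring
    _ ≤ _ := Finset.sum_le_sum fun f _ => le_real_isIsolatedPath (he.injOn f) hp

lemma integral_isolatedCount_sq_le (he : IsBlockSystem a b e) (hm : 0 < m) (hK : 2 ≤ K)
    (hp0 : 0 < (p : ℝ)) (hp : 2 * K * (p : ℝ) ≤ 1) :
    ∫ G, isolatedCount a b e G ^ 2 ∂(binomialRandom (Fin n) p) ≤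
      ((m : ℝ) ^ K * (p : ℝ) ^ (K + 1)) ^ 2 *
        (Real.exp (-(2 * K * (p : ℝ) ^ 2 - 4 * K ^ 2 * (p : ℝ) ^ 3) * (n - 2 * (K + 2))) +
          2 * ((1 + 1 / (m * p)) ^ K - 1) + 1 / ((m : ℝ) ^ K * (p : ℝ) ^ (K + 1))) := by
  classical
  have hm' : (0 : ℝ) < m := by exact_mod_cast hm
  have hsq : ∀ G, isolatedCount a b e G ^ 2 = ∑ f : Fin K → Fin m, ∑ g : Fin K → Fin m,
      (isolatedEvent a b e f ∩ isolatedEvent a b e g).indicator (fun _ => (1 : ℝ)) G := by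
    intro G
    rw [isolatedCount, sq, Finset.sum_mul_sum]
    refine Finset.sum_congr rfl fun f _ => Finset.sum_congr rfl fun g _ => ?_
    simp only [Set.indicator_apply, Set.mem_inter_iff]
    by_cases h1 : G ∈ isolatedEvent a b e f <;> by_cases h2 : G ∈ isolatedEvent a b e g <;>
      simp [h1, h2]
  simp_rw [hsq]
  rw [integral_finsetSum _ fun _ _ => .of_finite]
  set Q := Real.exp (-(2 * K * (p : ℝ) ^ 2 - 4 * K ^ 2 * (p : ℝ) ^ 3) * (n - 2 * (K + 2)))
  calc _ ≤ ∑ f : Fin K → Fin m, ∑ g : Fin K → Fin m, ((p : ℝ) ^ (2 * (K + 1)) *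
        (Q + 2 * (∏ i, (if f i = g i then (p : ℝ)⁻¹ else 1) - 1)) +
        if f = g then (p : ℝ) ^ (K + 1) else 0) := by
        refine Finset.sum_le_sum fun f _ => ?_
        rw [integral_finsetSum _ fun _ _ => .of_finite]
        simp_rw [integral_indicator_eq_real]
        exact Finset.sum_le_sum fun g _ => he.real_inter_le hK hp0 hp f g
    _ = (p : ℝ) ^ (2 * (K + 1)) * (((m : ℝ) ^ K) ^ 2 * (Q - 2) +
        2 * ∑ f : Fin K → Fin m, ∑ g : Fin K → Fin m,
          ∏ i, (if f i = g i then (p : ℝ)⁻¹ else 1)) + (m : ℝ) ^ K * (p : ℝ) ^ (K + 1) := by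
        simp only [Finset.sum_add_distrib, ← Finset.mul_sum, Finset.sum_sub_distrib,
          Finset.sum_const, Finset.card_univ, Fintype.card_fun, Fintype.card_fin, nsmul_eq_mul,
          Finset.sum_ite_eq, Finset.mem_univ, if_true]
        push_cast
        ring
    _ ≤ (p : ℝ) ^ (2 * (K + 1)) * (((m : ℝ) ^ K) ^ 2 * (Q - 2) +
        2 * (((m : ℝ) ^ K) ^ 2 * (1 + (p : ℝ)⁻¹ / m) ^ K)) + (m : ℝ) ^ K * (p : ℝ) ^ (K + 1) := by
        have := sum_prod_agreement_le (K := K) hm (p : ℝ)⁻¹ (inv_nonneg.2 hp0.le)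
        gcongr
    _ = _ := by
        have h1 : (p : ℝ)⁻¹ / m = 1 / (m * p) := by field_simp
        have h2 : (m : ℝ) ^ K * (p : ℝ) ^ (K + 1) ≠ 0 := by positivity
        rw [h1, mul_add _ _ (1 / _), sq ((m : ℝ) ^ K * (p : ℝ) ^ (K + 1)), mul_assoc _ _ (1 / _),
          mul_one_div_cancel h2, pow_mul, pow_right_comm, sq ((p : ℝ) ^ (K + 1))]
        ring

/-- Chebyshev's inequality for the probability that there is at most one isolated path. -/
lemma real_isolatedCount_le_one_le {E : ℝ} (hE : 2 ≤ E)
    (hE' : E ≤ ∫ G, isolatedCount a b e G ∂(binomialRandom (Fin n) p)) :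
    (binomialRandom (Fin n) p).real {G | isolatedCount a b e G ≤ 1} ≤
      4 * ((∫ G, isolatedCount a b e G ^ 2 ∂(binomialRandom (Fin n) p)) / E ^ 2 - 1) := by
  set μ := binomialRandom (Fin n) p
  set X := isolatedCount a b e
  set I := ∫ G, X G ∂μ
  -- The square is centred at the lower bound `E` rather than at the mean; `X ≤ 1 ≤ E` gives `(X -
  -- E)² ≥ (E - 1)²`.
  have h1 : ∀ G, (E - 1) ^ 2 * ({G | X G ≤ 1} : Set (SimpleGraph (Fin n))).indicator
      (fun _ => (1 : ℝ)) G ≤ X G ^ 2 - 2 * E * X G + E ^ 2 := by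
    intro G
    rw [Set.indicator_apply]
    split_ifs with h
    · have h' : X G ≤ 1 := h
      nlinarith
    · nlinarith [sq_nonneg (X G - E)]
  have h2 := integral_mono (μ := μ) .of_finite .of_finite h1
  rw [integral_const_mul, integral_indicator_eq_real, integral_add .of_finite .of_finite,
    integral_sub .of_finite .of_finite, integral_const_mul, integral_const, probReal_univ,
    one_smul] at h2
  set S := ∫ G, X G ^ 2 ∂μ
  have h3 : (E - 1) ^ 2 * μ.real {G | X G ≤ 1} ≤ S - E ^ 2 := by
    have : 2 * E * E ≤ 2 * E * I := by gcongr
    nlinarith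
  have h4 : (0 : ℝ) ≤ μ.real {G | X G ≤ 1} := measureReal_nonneg
  have h5 : E ^ 2 * μ.real {G | X G ≤ 1} ≤ 4 * (S - E ^ 2) := by
    have h6 : E ^ 2 ≤ 4 * (E - 1) ^ 2 := by nlinarith
    nlinarith
  have h6 : 4 * (S / E ^ 2 - 1) = 4 * (S - E ^ 2) / E ^ 2 := by field_simp
  rw [h6, le_div_iff₀ (by positivity)]
  linarith

lemma not_shellable_of_one_lt_isolatedCount (he : IsBlockSystem a b e) (hK : 1 ≤ K)
    {G : SimpleGraph (Fin n)} (h : ¬ isolatedCount a b e G ≤ 1) :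
    ¬ Shellable (ET G a b (K + 1)) := by
  classical
  have hcount : isolatedCount a b e G =
      ((Finset.univ.filter fun f : Fin K → Fin m => G ∈ isolatedEvent a b e f).card : ℝ) := by
    simp only [isolatedCount, Set.indicator_apply]
    rw [Finset.sum_boole]
  rw [hcount, not_le, ← Nat.cast_one, Nat.cast_lt, Finset.one_lt_card] at h
  obtain ⟨f, hf, g, hg, hfg⟩ := h
  have hf' := (Finset.mem_filter.1 hf).2
  have hg' := (Finset.mem_filter.1 hg).2
  refine not_shellable_of_isIsolatedPath hf' hg' (by omega) (pathVertex_zero a b _)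
    (pathVertex_last a b _) (he.injOn f) (pathVertex_zero a b _) (pathVertex_last a b _)
    (he.injOn g) fun heq => hfg (funext fun k => ?_)
  have h1 := List.map_inj_left.1 heq k (List.mem_range.2 (by simp))
  exact (he.blockPath_eq (by have := k.2; omega) (by have := k.2; omega) h1).2 k rfl

end PathFamily

/-! ### Asymptotics in the three ranges of the exponent. -/

section Asymptotics

/-- The bound for the normalized second moment of the number of isolated paths, as a function of
the edge probability and of the contribution of the pairs of paths that are not disjoint. -/
noncomputable def momentBound (K : ℕ) (q r : ℝ) : ℝ :=
  (Real.exp (4 * K ^ 2 * q + 4 * K * (K + 2) * q ^ 2 + 4 * K ^ 2 * q ^ 2) +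
    r * Real.exp (2 * K + 4 * K ^ 2 * q ^ 2)) / (1 - K * q) ^ 2

lemma exp_le_one_sub {u : ℝ} (h : u ≤ 1 / 2) : Real.exp (-(u + 2 * u ^ 2)) ≤ 1 - u := by
  rw [Real.exp_neg, inv_le_comm₀ (Real.exp_pos _) (by linarith)]
  refine le_trans ?_ (Real.add_one_le_exp _)
  rw [inv_le_iff_one_le_mul₀ (by linarith)]
  nlinarith [sq_nonneg u, mul_nonneg (sq_nonneg u) (by linarith : 0 ≤ 1 - 2 * u)]

lemma exists_isBlockSystem {n K m : ℕ} {a b : Fin n} (hab : a ≠ b) (h : K * m + 2 ≤ n) :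
    ∃ e : Fin K × Fin m → Fin n, IsBlockSystem a b e := by
  classical
  have hcard : Fintype.card (Fin K × Fin m) ≤
      Fintype.card {x // x ∈ (({a, b} : Finset (Fin n))ᶜ)} := by
    rw [Fintype.card_coe, Finset.card_compl, Finset.card_pair hab]
    simp
    omega
  obtain ⟨φ⟩ := Function.Embedding.nonempty_of_card_le hcard
  have hφ : ∀ i, (φ i : Fin n) ≠ a ∧ (φ i : Fin n) ≠ b := by
    intro i
    have := (φ i).2
    rw [Finset.mem_compl, Finset.mem_insert, Finset.mem_singleton, not_or] at this
    exact this
  exact ⟨fun i => φ i, hab, Subtype.val_injective.comp φ.injective, fun i => (hφ i).1,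
    fun i => (hφ i).2⟩

lemma exp_le_one_sub_pow {u : ℝ} (h : u ≤ 1 / 2) (n : ℕ) :
    Real.exp (-(n * u + 2 * (n * u ^ 2))) ≤ (1 - u) ^ n := by
  calc Real.exp (-(n * u + 2 * (n * u ^ 2))) = Real.exp (-(u + 2 * u ^ 2)) ^ n := by
        rw [← Real.exp_nat_mul]; ring_nf
    _ ≤ _ := by
        have := exp_le_one_sub h
        gcongr

/-- The leading terms `2 K n q²` in the exponents of the two sides cancel. Using `n q² ≤ 1`, the
remainders are at most `4K²q` from triple edges, `4K(K + 2)q²` from the excluded vertices and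
`4K²q²` from comparing `1 - u` with an exponential; these are the exponents in `momentBound`. -/
lemma exp_add_le_momentBound_mul {K n : ℕ} {q r : ℝ} (hK : 1 ≤ K) (hq0 : 0 ≤ q)
    (hq : 2 * K * q ≤ 1) (hnq : n * q ^ 2 ≤ 1) (hr : 0 ≤ r) :
    Real.exp (-(2 * K * q ^ 2 - 4 * K ^ 2 * q ^ 3) * (n - 2 * (K + 2))) + r ≤
      momentBound K q r * ((1 - K * q) * (1 - K * q ^ 2) ^ n) ^ 2 := by
  have hK' : (1 : ℝ) ≤ K := by exact_mod_cast hK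
  have hq1 : q ≤ 1 := by nlinarith
  have hu1 : K * q ^ 2 ≤ 1 / 2 := by nlinarith
  have hpos : 0 < 1 - K * q := by linarith
  have hpow := exp_le_one_sub_pow hu1 n
  have hnu : n * (K * q ^ 2) ≤ K := by nlinarith
  have hnu2 : n * (K * q ^ 2) ^ 2 ≤ K ^ 2 * q ^ 2 := by
    calc n * (K * q ^ 2) ^ 2 = (n * q ^ 2) * (K ^ 2 * q ^ 2) := by ring
      _ ≤ 1 * (K ^ 2 * q ^ 2) := by gcongr
      _ = _ := one_mul _
  have hnq3 : n * q ^ 3 * K ^ 2 ≤ q * K ^ 2 := by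
    calc n * q ^ 3 * K ^ 2 = (n * q ^ 2) * (q * K ^ 2) := by ring
      _ ≤ 1 * (q * K ^ 2) := by gcongr
      _ = _ := one_mul _
  have hK3 : 0 ≤ (K : ℝ) ^ 2 * q ^ 3 * (K + 2) := by positivity
  set s : ℝ := n * (K * q ^ 2) + 2 * (n * (K * q ^ 2) ^ 2) with hs
  have h1 : Real.exp (-(2 * K * q ^ 2 - 4 * K ^ 2 * q ^ 3) * (n - 2 * (K + 2))) ≤
      Real.exp (4 * K ^ 2 * q + 4 * K * (K + 2) * q ^ 2 + 4 * K ^ 2 * q ^ 2) *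
        Real.exp (-s) ^ 2 := by
    rw [← Real.exp_nat_mul, ← Real.exp_add, Real.exp_le_exp]
    have e : -(2 * K * q ^ 2 - 4 * K ^ 2 * q ^ 3) * (n - 2 * (K + 2)) =
        -2 * (n * (K * q ^ 2)) + 4 * (n * q ^ 3 * K ^ 2) + 4 * K * (K + 2) * q ^ 2 -
          8 * (K ^ 2 * q ^ 3 * (K + 2)) := by ring
    rw [e, hs]
    push_cast
    linarith
  have h2 : r ≤ r * Real.exp (2 * K + 4 * K ^ 2 * q ^ 2) * Real.exp (-s) ^ 2 := by
    rw [mul_assoc, ← Real.exp_nat_mul, ← Real.exp_add]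
    refine le_mul_of_one_le_right hr (Real.one_le_exp ?_)
    push_cast
    linarith
  calc _ ≤ (Real.exp (4 * K ^ 2 * q + 4 * K * (K + 2) * q ^ 2 + 4 * K ^ 2 * q ^ 2) +
          r * Real.exp (2 * K + 4 * K ^ 2 * q ^ 2)) * Real.exp (-s) ^ 2 := by
        rw [add_mul]
        exact add_le_add h1 h2
    _ = momentBound K q r * ((1 - K * q) ^ 2 * Real.exp (-s) ^ 2) := by
        rw [momentBound, ← mul_assoc, div_mul_cancel₀ _ (pow_ne_zero 2 hpos.ne')]
    _ ≤ momentBound K q r * ((1 - K * q) ^ 2 * ((1 - K * q ^ 2) ^ n) ^ 2) := by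
        have : 0 ≤ momentBound K q r := by
          unfold momentBound
          positivity
        gcongr
    _ = _ := by rw [mul_pow]

lemma real_shellable_le {n K m : ℕ} {p : unitInterval} {a b : Fin n} (hab : a ≠ b) (hK : 2 ≤ K)
    (hm : 0 < m) (hn : K * m + 2 ≤ n) (hp0 : 0 < (p : ℝ)) (hp : 2 * K * (p : ℝ) ≤ 1)
    (hnp : n * (p : ℝ) ^ 2 ≤ 1)
    (hM : 2 ≤ (m : ℝ) ^ K * (p : ℝ) ^ (K + 1) * (1 / 2 * Real.exp (-(2 * K)))) :
    (binomialRandom (Fin n) p).real {G | Shellable (ET G a b (K + 1))} ≤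
      4 * (momentBound K p (2 * ((1 + 1 / (m * p)) ^ K - 1) +
        1 / ((m : ℝ) ^ K * (p : ℝ) ^ (K + 1))) - 1) := by
  obtain ⟨e, he⟩ := exists_isBlockSystem hab hn
  have hK' : (2 : ℝ) ≤ K := by exact_mod_cast hK
  have hp1 : (p : ℝ) ≤ 1 := p.2.2
  have hS := integral_isolatedCount_sq_le (p := p) he hm hK hp0 hp
  have hu1 : K * (p : ℝ) ^ 2 ≤ 1 / 2 := by nlinarith
  have hE' := le_integral_isolatedCount (p := p) he (hu1.trans (by norm_num))
  have hr0 : 0 ≤ 2 * ((1 + 1 / (m * (p : ℝ))) ^ K - 1) +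
      1 / ((m : ℝ) ^ K * (p : ℝ) ^ (K + 1)) := by
    have h1 : 1 ≤ (1 + 1 / (m * (p : ℝ))) ^ K := one_le_pow₀ (by
      have : 0 ≤ 1 / (m * (p : ℝ)) := by positivity
      linarith)
    have h2 : 0 ≤ 1 / ((m : ℝ) ^ K * (p : ℝ) ^ (K + 1)) := by positivity
    linarith
  have hmain := exp_add_le_momentBound_mul (n := n) (by omega) hp0.le hp hnp hr0
  have hM0 : 0 < (m : ℝ) ^ K * (p : ℝ) ^ (K + 1) := by positivity
  -- With `n p² ≤ 1` the probability of having no outside common neighbour stays bounded below; this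
  -- is where `α ≥ 1/2` enters.
  have hpow : Real.exp (-(2 * K)) ≤ (1 - K * (p : ℝ) ^ 2) ^ n := by
    refine le_trans (Real.exp_le_exp.2 ?_) (exp_le_one_sub_pow hu1 n)
    have h1 : n * (K * (p : ℝ) ^ 2) ≤ K := by nlinarith
    have h2 : n * (K * (p : ℝ) ^ 2) * (K * (p : ℝ) ^ 2) ≤ K * (1 / 2) :=
      mul_le_mul h1 hu1 (by positivity) (by positivity)
    have h3 : n * (K * (p : ℝ) ^ 2) ^ 2 = n * (K * (p : ℝ) ^ 2) * (K * (p : ℝ) ^ 2) := by ring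
    rw [h3]
    linarith
  have hcge : 1 / 2 * Real.exp (-(2 * K)) ≤ (1 - K * p) * (1 - K * (p : ℝ) ^ 2) ^ n :=
    mul_le_mul (by linarith) hpow (Real.exp_pos _).le (by linarith)
  generalize (m : ℝ) ^ K * (p : ℝ) ^ (K + 1) = M at *
  generalize (1 - K * (p : ℝ)) * (1 - K * (p : ℝ) ^ 2) ^ n = c at *
  have hE : 2 ≤ M * c := hM.trans (by gcongr)
  have hc0 : 0 < c := lt_of_lt_of_le (by positivity) hcge
  have hcheb := real_isolatedCount_le_one_le (p := p) (e := e) hE hE'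
  have hsub : {G : SimpleGraph (Fin n) | Shellable (ET G a b (K + 1))} ⊆
      {G | isolatedCount a b e G ≤ 1} := by
    intro G hG
    by_contra h
    exact not_shellable_of_one_lt_isolatedCount he (by omega) h hG
  refine (measureReal_mono hsub (measure_ne_top _ _)).trans (hcheb.trans ?_)
  refine mul_le_mul_of_nonneg_left (sub_le_sub_right ?_ 1) (by norm_num)
  rw [div_le_iff₀ (by positivity)]
  rw [← add_assoc] at hmain
  calc _ ≤ _ := hS
    _ ≤ M ^ 2 * _ := mul_le_mul_of_nonneg_left hmain (sq_nonneg M)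
    _ = _ := by ring

lemma tendsto_momentBound (K : ℕ) {q r : ℕ → ℝ} (hq : Tendsto q atTop (𝓝 0))
    (hr : Tendsto r atTop (𝓝 0)) :
    Tendsto (fun n => momentBound K (q n) (r n)) atTop (𝓝 1) := by
  have hcont : ContinuousAt (fun z : ℝ × ℝ => momentBound K z.1 z.2) (0, 0) := by
    unfold momentBound
    refine ContinuousAt.div (by fun_prop) (by fun_prop) (by simp)
  have h := hcont.tendsto.comp (hq.prodMk_nhds hr)
  have h1 : momentBound K 0 0 = 1 := by simp [momentBound]
  rwa [h1] at h

/-- The expected number of paths has order `n ^ (K - α (K + 1))`, which grows exactly because `α < 1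
- 1/(K + 1)`. Overlapping pairs are negligible because `m p` also tends to infinity, as `α < 1`. -/
theorem exists_real_shellable_bound {α : ℝ} (hα : 0 ≤ α) (h1 : 1 / 2 ≤ α) {ℓ : ℕ} (hℓ : 3 ≤ ℓ)
    (h2 : α < 1 - 1 / (ℓ : ℝ)) :
    ∃ β : ℕ → ℝ, Tendsto β atTop (𝓝 0) ∧ ∀ᶠ n in atTop, ∀ a b : Fin (n + 1), a ≠ b →
      (erdosRenyi α hα (n + 1)).real {G | Shellable (ET G a b ℓ)} ≤ β n := by
  obtain ⟨K, rfl⟩ : ∃ K, ℓ = K + 1 := ⟨ℓ - 1, by omega⟩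
  have hK : 2 ≤ K := by omega
  have hKr : (2 : ℝ) ≤ K := by exact_mod_cast hK
  have hK1 : (0 : ℝ) < K + 1 := by positivity
  push_cast at h2
  have hα1 : α < 1 := by
    have : 0 < 1 / ((K : ℝ) + 1) := by positivity
    linarith
  have hexp : 0 < K - α * (K + 1) := by
    have h3 : α * (K + 1) < (1 - 1 / ((K : ℝ) + 1)) * (K + 1) := by gcongr
    have h4 : (1 - 1 / ((K : ℝ) + 1)) * (K + 1) = K := by field_simp; ring
    linarith
  set x : ℕ → ℝ := fun n => ((n + 1 : ℕ) : ℝ) with hx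
  have hx0 : ∀ n, 0 < x n := fun n => by simp only [hx]; positivity
  have hxt : Tendsto x atTop atTop := tendsto_natCast_add_one
  set q : ℕ → ℝ := fun n => (edgeProb α hα (n + 1) : ℝ) with hq
  have hqx : ∀ n, q n = x n ^ (-α) := fun n => rfl
  have hq0 : ∀ n, 0 < q n := fun n => by rw [hqx]; exact Real.rpow_pos_of_pos (hx0 n) _
  have hqt : Tendsto q atTop (𝓝 0) :=
    (tendsto_rpow_neg_atTop (by linarith : 0 < α)).comp hxt
  -- There are `n + 1` vertices; after removing `a` and `b`, the other `n - 1` are split into `K`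
  -- blocks.
  set m : ℕ → ℕ := fun n => (n - 1) / K with hm
  have hmx : ∀ᶠ n in atTop, x n / (2 * K) ≤ m n := by
    filter_upwards [eventually_ge_atTop (2 * K + 1)] with n hn
    rw [div_le_iff₀ (by positivity)]
    have e1 := Nat.div_add_mod (n - 1) K
    have e2 := Nat.mod_lt (n - 1) (by omega : 0 < K)
    have e3 : n + 1 ≤ (n - 1) / K * (2 * K) := by
      have : (n - 1) / K * (2 * K) = 2 * (K * ((n - 1) / K)) := by ring
      omega
    simp only [hx, hm]
    exact_mod_cast e3
  have hmq : Tendsto (fun n => m n * q n) atTop atTop := by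
    have ht : Tendsto (fun n => x n ^ (1 - α) / (2 * K)) atTop atTop :=
      ((tendsto_rpow_atTop (by linarith : 0 < 1 - α)).comp hxt).atTop_div_const (by positivity)
    refine tendsto_atTop_mono' _ ?_ ht
    filter_upwards [hmx] with n hn
    calc x n ^ (1 - α) / (2 * K) = x n / (2 * K) * q n := by
          rw [hqx, sub_eq_add_neg, Real.rpow_add (hx0 n), Real.rpow_one]; ring
      _ ≤ _ := mul_le_mul_of_nonneg_right hn (hq0 n).le
  have hM : Tendsto (fun n => (m n : ℝ) ^ K * q n ^ (K + 1)) atTop atTop := by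
    have ht : Tendsto (fun n => x n ^ (K - α * (K + 1)) / (2 * K) ^ K) atTop atTop :=
      ((tendsto_rpow_atTop hexp).comp hxt).atTop_div_const (by positivity)
    refine tendsto_atTop_mono' _ ?_ ht
    filter_upwards [hmx] with n hn
    have h0 := hx0 n
    calc x n ^ (K - α * (K + 1)) / (2 * K) ^ K = (x n / (2 * K)) ^ K * q n ^ (K + 1) := by
          rw [hqx, ← Real.rpow_natCast (x n ^ (-α)), ← Real.rpow_mul h0.le, div_pow,
            sub_eq_add_neg, Real.rpow_add h0, Real.rpow_natCast]
          push_cast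
          ring_nf
      _ ≤ _ := by
          have := (hq0 n).le
          gcongr
  set r : ℕ → ℝ := fun n => 2 * ((1 + 1 / (m n * q n)) ^ K - 1) +
    1 / ((m n : ℝ) ^ K * q n ^ (K + 1)) with hr
  have hrt : Tendsto r atTop (𝓝 0) := by
    have e1 : Tendsto (fun n => 1 / (m n * q n)) atTop (𝓝 0) := by
      simp only [one_div]
      exact hmq.inv_tendsto_atTop
    have e2 : Tendsto (fun n => 1 / ((m n : ℝ) ^ K * q n ^ (K + 1))) atTop (𝓝 0) := by
      simp only [one_div]
      exact hM.inv_tendsto_atTop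
    have e3 := ((((e1.const_add 1).pow K).sub_const 1).const_mul 2).add e2
    rwa [add_zero, add_zero, one_pow, sub_self, mul_zero] at e3
  refine ⟨fun n => 4 * (momentBound K (q n) (r n) - 1), ?_, ?_⟩
  · simpa using ((tendsto_momentBound K hqt hrt).sub_const 1).const_mul 4
  have hq1 : ∀ᶠ n in atTop, 2 * K * q n ≤ 1 := by
    have : Tendsto (fun n => 2 * K * q n) atTop (𝓝 (2 * K * 0)) := hqt.const_mul _
    rw [mul_zero] at this
    exact this.eventually_le_const one_pos
  have hM2 : ∀ᶠ n in atTop,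
      2 ≤ (m n : ℝ) ^ K * q n ^ (K + 1) * (1 / 2 * Real.exp (-(2 * K))) :=
    (hM.atTop_mul_const (by positivity)).eventually_ge_atTop 2
  filter_upwards [hmx, hq1, hM2, eventually_ge_atTop 1] with n hn1 hn2 hn3 hn4 a b hab
  have hmpos : 0 < m n := by
    have : (0 : ℝ) < m n := lt_of_lt_of_le (div_pos (hx0 n) (by positivity)) hn1
    exact_mod_cast this
  refine real_shellable_le hab hK hmpos ?_ (hq0 n) hn2 ?_ hn3
  · have := Nat.mul_div_le (n - 1) K
    simp only [hm]
    omega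
  · have h0 := hx0 n
    have : q n ^ 2 = x n ^ (-(2 * α)) := by
      rw [hqx, ← Real.rpow_natCast, ← Real.rpow_mul h0.le]
      congr 1
      push_cast
      ring
    change x n * q n ^ 2 ≤ 1
    rw [this]
    calc x n * x n ^ (-(2 * α)) = x n ^ (1 - 2 * α) := by
          rw [sub_eq_add_neg, Real.rpow_add h0, Real.rpow_one]
      _ ≤ 1 := Real.rpow_le_one_of_one_le_of_nonpos (by simp [hx]) (by linarith)

theorem exists_real_sdiff_bound {α : ℝ} (hα : 0 ≤ α) {ℓ : ℕ} (hℓ : 3 ≤ ℓ) :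
    ∃ β : ℕ → ℝ, Tendsto β atTop (𝓝 0) ∧ ∀ᶠ n in atTop, ∀ a b : Fin (n + 1), a ≠ b →
      (erdosRenyi α hα (n + 1)).real (bothShellable a b ℓ \ torsionFree a b ℓ) ≤ β n := by
  have hfin : ∀ (n : ℕ) (S : Set (SimpleGraph (Fin (n + 1)))), erdosRenyi α hα (n + 1) S ≠ ⊤ :=
    fun n S => by unfold erdosRenyi; exact measure_ne_top _ _
  rcases lt_or_ge α (1 / 2) with h1 | h1
  · refine ⟨_, tendsto_common_neighbors_bound hα h1 (ℓ + 1), Eventually.of_forall fun n a b hab => ?_⟩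
    refine le_trans (measureReal_mono ?_ (hfin n _)) (real_not_common_neighbors_le (ℓ + 1))
    rintro G ⟨⟨hs1, hs2⟩, ht⟩ hC
    refine ht (isAddTorsionFree_EMH hab hℓ (refinable_of_common_neighbors hC)
      (refinable_of_common_neighbors fun x y hxy U hU => hC x y hxy U (by omega)) hs1 hs2)
  rcases lt_or_ge α (1 - 1 / (ℓ : ℝ)) with h2 | h2
  · obtain ⟨β, hβ, hb⟩ := exists_real_shellable_bound hα h1 hℓ h2
    refine ⟨β, hβ, hb.mono fun n hn a b hab => le_trans (measureReal_mono ?_ (hfin n _)) (hn a b hab)⟩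
    exact fun G hG => hG.1.1
  · refine ⟨_, tendsto_edist_bound hα (by omega) h2, Eventually.of_forall fun n a b hab => ?_⟩
    refine le_trans (measureReal_mono ?_ (hfin n _)) (real_edist_lt_le hab ℓ)
    rintro G ⟨⟨hs1, hs2⟩, ht⟩ hd
    exact ht (isAddTorsionFree_EMH hab hℓ (refinable_of_le_edist hd)
      (refinable_of_le_edist ((Nat.cast_le.2 (Nat.sub_le ℓ 1)).trans hd)) hs1 hs2)

theorem tendsto_sdiff {α : ℝ} (hα : 0 ≤ α) {ℓ : ℕ} (hℓ : 3 ≤ ℓ) (a b : (n : ℕ) → Fin (n + 1)) :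
    Tendsto (fun n : ℕ => erdosRenyi α hα (n + 1)
      (bothShellable (a n) (b n) ℓ \ torsionFree (a n) (b n) ℓ)) atTop (𝓝 0) := by
  obtain ⟨β, hβ, hb⟩ := exists_real_sdiff_bound hα hℓ
  -- The bound `β` holds only eventually and for `a ≠ b`, so it need not be nonnegative where the
  -- two ends coincide; hence the absolute value.
  have hβ' : Tendsto (fun n => ENNReal.ofReal |β n|) atTop (𝓝 0) := by
    have := (ENNReal.continuous_ofReal.tendsto _).comp hβ.abs
    rwa [abs_zero, ENNReal.ofReal_zero] at this
  refine tendsto_of_tendsto_of_tendsto_of_le_of_le' tendsto_const_nhds hβ'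
    (Eventually.of_forall fun _ => zero_le) ?_
  filter_upwards [hb] with n hn
  by_cases hab : a n = b n
  · have : bothShellable (a n) (b n) ℓ \ torsionFree (a n) (b n) ℓ = ∅ := by
      rw [Set.sdiff_eq_empty, hab]
      exact fun G _ k => isAddTorsionFree_EMH_self (b n) k
    rw [this, measure_empty]
    exact zero_le
  · rw [← ENNReal.ofReal_toReal (a := erdosRenyi α hα (n + 1) _)
      (by unfold erdosRenyi; exact measure_ne_top _ _)]
    exact ENNReal.ofReal_le_ofReal ((hn _ _ hab).trans (le_abs_self _))

end Asymptotics

end EulerianMagnitude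

theorem mainTheorem5 (α : ℝ) (hα : 0 ≤ α) (ℓ : ℕ) (hℓ : 3 ≤ ℓ)
    (a b : (n : ℕ) → Fin (n + 1)) :
    (Tendsto (fun n : ℕ => EulerianMagnitude.erdosRenyi α hα (n + 1)
        (EulerianMagnitude.bothShellable (a n) (b n) ℓ)) atTop (𝓝 1) →
      Tendsto (fun n : ℕ => EulerianMagnitude.erdosRenyi α hα (n + 1)
        (EulerianMagnitude.torsionFree (a n) (b n) ℓ)) atTop (𝓝 1)) ∧
    Tendsto (fun n : ℕ => EulerianMagnitude.erdosRenyi α hα (n + 1)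
      (EulerianMagnitude.bothShellable (a n) (b n) ℓ \
        EulerianMagnitude.torsionFree (a n) (b n) ℓ)) atTop (𝓝 0) := by
  have h := EulerianMagnitude.tendsto_sdiff hα hℓ a b
  refine ⟨fun hS => ?_, h⟩
  -- The probability of torsion-freeness is squeezed between `P(S) - P(S \ T)` and `1`.
  have hsub := ENNReal.Tendsto.sub hS h (Or.inl ENNReal.one_ne_top)
  rw [tsub_zero] at hsub
  refine tendsto_of_tendsto_of_tendsto_of_le_of_le hsub tendsto_const_nhds (fun n => ?_) fun n => ?_
  · rw [tsub_le_iff_left]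
    refine (measure_mono fun G hG => ?_).trans (measure_union_le _ _)
    by_cases hT : G ∈ EulerianMagnitude.torsionFree (a n) (b n) ℓ
    · exact Or.inr hT
    · exact Or.inl ⟨hG, hT⟩
  · unfold EulerianMagnitude.erdosRenyi
    exact prob_le_one
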